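/- **Setting.** Let $d\ge 1$, $\beta>0$, $\alpha<0$, $a>b>0$, $\mu\in\mathbb R$. Put $q_k=(4\pi\beta)^{-d/2}k^{-(1+d/2)}$ and $\overline q^{(s)}=\sum_{k\ge1}q_ke^{\beta sk}$. For a box $\Lambda\subset\mathbb R^d$ and $m\in\mathbb N$ let $\mathsf Q_\Lambda$ be the law of cycle counts $(|\Lambda|\lambda_k)_{k\ge1}$ (finitely supported sequences in $\mathbb N_0$) given by $$\mathsf Q_\Lambda(\lambda=x)=e^{-|\Lambda|\overline q^{(\alpha)}}\prod_{k\ge1}\frac{(|\Lambda|q_ke^{\beta\alpha k})^{|\Lambda|x_k}}{(|\Lambda|x_k)!},$$ let $$H_\Lambda(\lambda)=|\Lambda|\Big(-(\mu-\alpha)\sum_kk\lambda_k+\tfrac a2\Big(\sum_kk\lambda_k\Big)^2-\tfrac b2\sum_{k\ge m}k^2\lambda_k^2\Big),$$ and let $\mathbb E_\Lambda$ be the expectation under the Gibbs distribution $d\mathsf P_\Lambda/d\mathsf Q_\Lambda=e^{-\beta H_\Lambda}/\int e^{-\beta H_\Lambda}d\mathsf Q_\Lambda$. The limit $\Lambda\uparrow\mathbb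 R^d$ is taken along sequences of centred boxes with $|\Lambda|\to\infty$ and cut-offs $m=m_\Lambda\to\infty$ with $m_\Lambda/|\Lambda|\to\kappa\in[0,\infty]$. Define $$\varrho^{(\kappa)}(\mu)=\lim_{\Lambda\uparrow\mathbb R^d}\mathbb E_\Lambda\Big[\sum_{k\ge m_\Lambda}k\lambda_k\Big],\qquad \Delta^{(\kappa)}(\mu)=\lim_{K\to\infty}\lim_{\Lambda\uparrow\mathbb R^d}\mathbb E_\Lambda\Big[\sum_{k>K}k\lambda_k\Big].$$ Let $p_0(\beta,s)=\overline q^{(s)}/\beta$ (which is $+\infty$ for $s>0$), $f_0(\beta,x)=\sup_{s\in\mathbb R}\{sx-p_0(\beta,s)\}$, and let $\varrho_c=(4\pi\beta)^{-d/2}\zeta(d/2)$ if $d\ge3$ and $\varrho_c=+\infty$ if $d=1,2$ (so that $(\mu/a-\varrho_c)_+=0$ then). Let $\mathbb K(\kappa)=\mathbb R_+\times(\{0\}\cup[\kappa,\infty))$, and let $I^{(\kappa)}(x,y)=f_0(\beta,x)-\mu(x+y)+\frac a2(x+y)^2-\frac b2y^2+p^{(\kappa)}$ on $\mathbb K(\kappa)$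 and $I^{(\kappa)}=+\infty$ elsewhere, where $p^{(\kappa)}$ is the constant that makes $\inf I^{(\kappa)}=0$. For $\kappa\in[0,\infty)$ the transition chemical potential $\mu^*_\kappa$ is the real number such that $I^{(\kappa)}$ has zeroes for every $\mu\ne\mu^*_\kappa$, all of them with second component $0$ if $\mu<\mu^*_\kappa$, and all of them with positive second component if $\mu>\mu^*_\kappa$; write $\mu^*=\mu^*_0$. Let $s_\beta(x)=0$ for $x\ge\varrho_c$ and let $s_\beta(x)$ be the unique $s<0$ with $p_0'(\beta,s)=x$ for $0<x<\varrho_c$; let $\mu_t=\inf_{s<0}\{a\,p_0'(\beta,s)-\frac{a-b}bs\}$; for $\mu\ge\mu_t$ let $\tilde x_2(\mu)$ be the minimal solution $x>0$ of $s_\beta(x)=-\frac b{a-b}(\mu-ax)$; and let $\mu_r=\mu_r(\kappa)=\inf\{s\ge\mu_t:\tilde x_2(s)\le\frac1a(s-\kappa(a-b))\}$. **Theorem (Condensate Density).** The transition potentials $\mu^*_\kappa$, $\kappa\in[0,\infty)$, exist, and the following holds. The values of all limits, and the potentials $\mu^*_\kappa,\hat\mu^*_\kappa$ below, do not depend on the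 chosen sequence of boxes and cut-offs, only on $\kappa$ and the parameters of the model. (a) *$\kappa=0$:* for $\mu\ne\mu^*$ the limits $\Delta^{(0)}(\mu)$ and $\varrho^{(0)}(\mu)$ exist and $\Delta^{(0)}(\mu)=\varrho^{(0)}(\mu)$. At every $\mu\in\mathbb R$ and along every admissible sequence, if one of the two limits exists, then so does the other and they are equal. *$\kappa=\infty$:* $\Delta^{(\infty)}(\mu)$ exists and equals $\big(\frac\mu a-\varrho_c\big)_+$ for every $\mu\in\mathbb R$. *$\kappa\in(0,\infty)$:* there is $\hat\mu^*_\kappa\in[\mu^*_\kappa,\max\{\mu^*_\kappa,\mu_r\}]$ such that $\Delta^{(\kappa)}(\mu)$ exists for all $\mu\neq\hat\mu^*_\kappa$, $\varrho^{(\kappa)}(\mu)$ exists for all $\mu>\hat\mu^*_\kappa$, and $$\Delta^{(\kappa)}(\mu)=\begin{cases}\big(\frac\mu a-\varrho_c\big)_+&\text{for }\mu<\hat\mu^*_\kappa,\\ \varrho^{(\kappa)}(\mu)&\text{for }\mu>\hat\mu^*_\kappa.\end{cases}$$ (b) Let $\mu\in\mathbb R$, $a>0$ and $\kappa\in[0,\infty)$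 be fixed. Then $\Delta^{(\kappa)}(\mu)$ exists for all $b<a$ close enough to $a$, and $\Delta^{(\kappa)}(\mu)\sim\big(\frac\mu{a-b}\big)_+$ as $b\uparrow a$ (for $\mu\le0$ this means that $\Delta^{(\kappa)}(\mu)=0$ for $b$ close to $a$). (c) Let $a>b>0$ and $\kappa\in[0,\infty)$ be fixed. Then $\Delta^{(\kappa)}(\mu)$ exists for all large $\mu$, and $\Delta^{(\kappa)}(\mu)\sim\frac\mu{a-b}$ as $\mu\to\infty$. -/

import Mathlib

open MeasureTheory Filter Topology Asymptotics
open scoped ENNReal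

noncomputable section

namespace CycleHYL

/-! ## The ideal Bose gas -/

/-- The weight `q_k = (4πβ)^{-d/2} k^{-(1+d/2)}` of cycles of length `k ≥ 1`. -/
def cycleWeight (d : ℕ) (β : ℝ) (k : ℕ+) : ℝ :=
  1 / ((4 * Real.pi * β) ^ ((d : ℝ) / 2) * (k : ℝ) ^ (1 + (d : ℝ) / 2))

/-- `q̄^{(α)} = ∑_k q_k e^{βαk}`. The series converges exactly for `α ≤ 0`. -/
def totalWeight (d : ℕ) (β α : ℝ) : ℝ :=
  ∑' k : ℕ+, cycleWeight d β k * Real.exp (β * α * k)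

/-- Pressure `p₀(β,s) = q̄^{(s)} / β` of the ideal Bose gas, used only for `s ≤ 0`; for `s > 0` the
series diverges, that is, `p₀ = +∞`. -/
def idealPressure (d : ℕ) (β s : ℝ) : ℝ :=
  1 / β * totalWeight d β s

/-- Free energy `f₀(β,x) = sup_s (s x - p₀(β,s))` of the ideal Bose gas, for `x ≥ 0`. The supremum
is over the effective domain `s ≤ 0` of `p₀`, as `p₀(β,s) = +∞` for `s > 0`. -/
def freeEnergy (d : ℕ) (β x : ℝ) : ℝ :=
  ⨆ s : Set.Iic (0 : ℝ), ((s : ℝ) * x - idealPressure d β s)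

/-- Critical density of the ideal Bose gas: `(4πβ)^{-d/2} ζ(d/2)` for `d ≥ 3`, and `+∞` for
`d = 1, 2`. -/
def criticalDensity (d : ℕ) (β : ℝ) : EReal :=
  if 3 ≤ d then
    ((1 / (4 * Real.pi * β) ^ ((d : ℝ) / 2) * ∑' k : ℕ+, 1 / (k : ℝ) ^ ((d : ℝ) / 2) : ℝ) : EReal)
  else ⊤

/-- `(μ/a - ϱ_c)_+`. It is finite, as `ϱ_c ≥ 0`, and it is `0` if `ϱ_c = +∞`. -/
def meanFieldExcess (d : ℕ) (β a μ : ℝ) : ℝ :=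
  (max (((μ / a : ℝ) : EReal) - criticalDensity d β) 0).toReal

/-! ## The reference process and the Gibbs distribution in a box of volume `V` -/

/-- Cycle counts: `n k` is the number of cycles of length `k`, and `λ_k = n k / V`. Sequences of
counts with `∑ λ_k < ∞` are finitely supported. -/
abbrev Counts : Type := ℕ+ →₀ ℕ

instance : MeasurableSpace Counts := ⊤

/-- Law of the cycle counts in the ideal gas:
`Q(n) = e^{-V q̄^{(α)}} ∏_k (V q_k e^{βαk})^{n_k} / n_k!`. -/
def referenceMeasure (d : ℕ) (β α V : ℝ) : Measure Counts :=
  Measure.sum fun n : Counts =>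
    ENNReal.ofReal (Real.exp (-(V * totalWeight d β α)) *
      n.prod fun k j => (V * cycleWeight d β k * Real.exp (β * α * k)) ^ j / (j.factorial : ℝ)) •
      Measure.dirac n

/-- Density of particles in cycles of length greater than `K`: `D_K = ∑_{k > K} k λ_k`. -/
def densityAbove (V : ℝ) (K : ℕ) (n : Counts) : ℝ :=
  n.sum fun k j => if K < (k : ℕ) then (k : ℝ) * ((j : ℝ) / V) else 0

/-- Density of particles in cycles of length at least `m`: `∑_{k ≥ m} k λ_k`. -/
def densityFrom (V : ℝ) (m : ℕ) (n : Counts) : ℝ :=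
  n.sum fun k j => if m ≤ (k : ℕ) then (k : ℝ) * ((j : ℝ) / V) else 0

/-- Total particle density `∑_k k λ_k`. -/
def totalDensity (V : ℝ) (n : Counts) : ℝ :=
  n.sum fun k j => (k : ℝ) * ((j : ℝ) / V)

/-- `∑_{k ≥ m} k² λ_k²`. -/
def counterTerm (V : ℝ) (m : ℕ) (n : Counts) : ℝ :=
  n.sum fun k j => if m ≤ (k : ℕ) then (k : ℝ) ^ 2 * ((j : ℝ) / V) ^ 2 else 0

/-- Hamiltonian of the spatial cycle HYL model. -/
def hamiltonian (α a b μ V : ℝ) (m : ℕ) (n : Counts) : ℝ :=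
  V * (-(μ - α) * totalDensity V n + a / 2 * totalDensity V n ^ 2 - b / 2 * counterTerm V m n)

/-- The Gibbs distribution `dP/dQ = e^{-βH} / E_Q[e^{-βH}]`. -/
def gibbsMeasure (d : ℕ) (β α a b μ V : ℝ) (m : ℕ) : Measure Counts :=
  (referenceMeasure d β α V).tilted fun n => -β * hamiltonian α a b μ V m n

/-! ## The thermodynamic limit -/

/-- A sequence of centred boxes `Λ_n` in `ℝ^d` (with side lengths `side n i`) with volumes tending
to infinity, together with cut-offs `m_n → ∞` such that `m_n / |Λ_n| → κ ∈ [0,∞]`. -/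
structure ThermoSeq (d : ℕ) (κ : ℝ≥0∞) where
  side : ℕ → Fin d → ℝ
  cutoff : ℕ → ℕ
  side_pos : ∀ n i, 0 < side n i
  tendsto_volume : Tendsto
    (fun n => (volume (Set.Icc (fun i => -(side n i) / 2) (fun i => side n i / 2))).toReal)
    atTop atTop
  tendsto_cutoff : Tendsto cutoff atTop atTop
  tendsto_ratio : Tendsto
    (fun n => (cutoff n : ℝ≥0∞) /
      volume (Set.Icc (fun i => -(side n i) / 2) (fun i => side n i / 2)))
    atTop (𝓝 κ)

/-- The volume `|Λ_n|`. -/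
def ThermoSeq.vol {d : ℕ} {κ : ℝ≥0∞} (S : ThermoSeq d κ) (n : ℕ) : ℝ :=
  (volume (Set.Icc (fun i => -(S.side n i) / 2) (fun i => S.side n i / 2))).toReal

/-- The Gibbs distribution in the `n`-th box. -/
def ThermoSeq.gibbs {d : ℕ} {κ : ℝ≥0∞} (S : ThermoSeq d κ) (β α a b μ : ℝ) (n : ℕ) :
    Measure Counts :=
  gibbsMeasure d β α a b μ (S.vol n) (S.cutoff n)

/-- `ϱ^{(κ)}(μ) = lim_Λ E_Λ[∑_{k ≥ m_Λ} k λ_k]` exists along `S` and equals `r`. -/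
def HasLongCycleDensity {d : ℕ} {κ : ℝ≥0∞} (S : ThermoSeq d κ) (β α a b μ r : ℝ) : Prop :=
  (∀ n, Integrable (densityFrom (S.vol n) (S.cutoff n)) (S.gibbs β α a b μ n)) ∧
  Tendsto (fun n => ∫ c, densityFrom (S.vol n) (S.cutoff n) c ∂(S.gibbs β α a b μ n))
    atTop (𝓝 r)

/-- `Δ^{(κ)}(μ) = lim_K lim_Λ E_Λ[D_K]` exists along `S` (the inner limit for every `K`) and
equals `r`. -/
def HasCondensateDensity {d : ℕ} {κ : ℝ≥0∞} (S : ThermoSeq d κ) (β α a b μ r : ℝ) : Prop :=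
  (∀ n K, Integrable (densityAbove (S.vol n) K) (S.gibbs β α a b μ n)) ∧
  ∃ D : ℕ → ℝ,
    (∀ K, Tendsto (fun n => ∫ c, densityAbove (S.vol n) K c ∂(S.gibbs β α a b μ n))
      atTop (𝓝 (D K))) ∧
    Tendsto D atTop (𝓝 r)

/-! ## The rate function and the transition chemical potentials -/

/-- The set `𝕂(κ) = ℝ_+ × ({0} ∪ [κ,∞))`. -/
def rateDomain (κ : ℝ≥0∞) : Set (ℝ × ℝ) :=
  {z | 0 ≤ z.1 ∧ 0 ≤ z.2 ∧ (z.2 = 0 ∨ κ ≤ ENNReal.ofReal z.2)}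

/-- `f₀(β,x) - μ(x+y) + (a/2)(x+y)² - (b/2)y²`. -/
def rateEnergy (d : ℕ) (β a b μ : ℝ) (z : ℝ × ℝ) : ℝ :=
  freeEnergy d β z.1 - μ * (z.1 + z.2) + a / 2 * (z.1 + z.2) ^ 2 - b / 2 * z.2 ^ 2

/-- The pressure `p^{(κ)} = sup_{(x,y) ∈ 𝕂(κ)} {μ(x+y) - (a/2)(x+y)² + (b/2)y² - f₀(β,x)}`. -/
def pressure (d : ℕ) (β a b μ : ℝ) (κ : ℝ≥0∞) : ℝ :=
  ⨆ z : rateDomain κ, -rateEnergy d β a b μ z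

open Classical in
/-- The rate function `I^{(κ)}` of the pair empirical particle density. -/
def rateFunction (d : ℕ) (β a b μ : ℝ) (κ : ℝ≥0∞) (z : ℝ × ℝ) : EReal :=
  if z ∈ rateDomain κ then ((rateEnergy d β a b μ z + pressure d β a b μ κ : ℝ) : EReal) else ⊤

/-- The zeroes of the rate function. -/
def rateZeroes (d : ℕ) (β a b μ : ℝ) (κ : ℝ≥0∞) : Set (ℝ × ℝ) :=
  {z | rateFunction d β a b μ κ z = 0}

/-- `ν` is the transition chemical potential `μ*_κ` (with `μ*_0 = μ*`): below `ν` all zeroes of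
the rate function have second component `0`, above `ν` all of them have positive second component
(and zeroes exist, so there is at most one such `ν`). -/
def IsTransitionPotential (d : ℕ) (β a b : ℝ) (κ : ℝ≥0∞) (ν : ℝ) : Prop :=
  (∀ μ < ν, (rateZeroes d β a b μ κ).Nonempty ∧ ∀ z ∈ rateZeroes d β a b μ κ, z.2 = 0) ∧
  (∀ μ > ν, (rateZeroes d β a b μ κ).Nonempty ∧ ∀ z ∈ rateZeroes d β a b μ κ, 0 < z.2)

open Classical in
/-- The function `s_β` on `(0,∞)`: `0` for `x ≥ ϱ_c`, and for `x < ϱ_c` the unique solution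
`s < 0` of `p₀'(β,s) = x` (the supremum is over a one-point set). -/
def sBeta (d : ℕ) (β x : ℝ) : ℝ :=
  if criticalDensity d β ≤ (x : EReal) then 0
  else sSup {s : ℝ | s < 0 ∧ deriv (idealPressure d β) s = x}

/-- `μ_t = inf_{s<0} {a p₀'(β,s) - ((a-b)/b) s}`. -/
def muT (d : ℕ) (β a b : ℝ) : ℝ :=
  ⨅ s : Set.Iio (0 : ℝ), (a * deriv (idealPressure d β) s - (a - b) / b * s)

/-- `x̃₂(μ)`, for `μ ≥ μ_t`: the minimal solution of `s_β(x) = -(b/(a-b)) (μ - a x)`. -/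
def xTwo (d : ℕ) (β a b μ : ℝ) : ℝ :=
  sInf {x : ℝ | 0 < x ∧ sBeta d β x = -(b / (a - b)) * (μ - a * x)}

/-- `μ_r = inf {s ≥ μ_t : x̃₂(s) ≤ (s - κ(a-b))/a}`. -/
def muR (d : ℕ) (β a b κ : ℝ) : ℝ :=
  sInf {s : ℝ | muT d β a b ≤ s ∧ xTwo d β a b s ≤ 1 / a * (s - κ * (a - b))}

end CycleHYL

end

noncomputable section

namespace CycleHYL

/-!
The probability that the densities of particles in short and long cycles are close to `z = (x, y)`
is `exp (-βV (I z + o(1)))`: the upper bound is a Chernoff bound for the short cycles, and for the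
lower bound the density `y` is put into a single long cycle. As `I` grows quadratically, the
expectation of an observable of at most linear growth is determined by the zeroes of `I`, the
ground states.

A cycle shorter than the cut-off carries no counter-term, so adding it to a configuration changes
the Gibbs weight by an explicit factor. Hence `E[k λ_k]` is, up to `o(1)`, the expected density of
such cycles in the ideal gas at the random chemical potential `μ - aρ`, where `ρ` is the total
density, and the density in cycles longer than `K` is the expectation of a function of `ρ`.

Minimizing the energy over `x` leaves a function of `y` with derivative `-s(μ - ay) - by`, where `s`
is concave, and strictly concave where it is negative. So there is at most one ground state with
`y > 0` and at most one with `y = 0`. For `κ = 0` the effective chemical potential of every ground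
state is conjugate to `x`; since a function on two points is affine, the densities above `K` and
above the cut-off are then asymptotically affine functions of each other, even at the transition.
-/

/-! ### Poisson weights -/

section PoissonWeight

variable {ι : Type*}

/-- The weight `∏ i, c i ^ n i / (n i)!` of a finitely supported family of counts. Up to the factor
`exp (-∑ i, c i)` it is the probability of `n` under independent Poisson variables with parameters
`c i`. -/
def poissonWeight (c : ι → ℝ) (n : ι →₀ ℕ) : ℝ :=
  n.prod fun i j => c i ^ j / (j.factorial : ℝ)

lemma poissonWeight_nonneg {c : ι → ℝ} (hc : ∀ i, 0 ≤ c i) (n : ι →₀ ℕ) : 0 ≤ poissonWeight c n :=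
  Finset.prod_nonneg fun i _ => div_nonneg (pow_nonneg (hc i) _) (by positivity)

lemma poissonWeight_pos {c : ι → ℝ} (hc : ∀ i, 0 < c i) (n : ι →₀ ℕ) : 0 < poissonWeight c n :=
  Finset.prod_pos fun i _ => div_pos (pow_pos (hc i) _) (by positivity)

lemma exists_subset_finsupp_range (T : Finset (ι →₀ ℕ)) :
    ∃ (S : Finset ι) (B : ℕ), T ⊆ S.finsupp fun _ => Finset.range B := by
  classical
  refine ⟨T.biUnion fun n => n.support, (T.sup fun n => n.support.sup n) + 1, fun n hn => ?_⟩
  refine Finset.mem_finsupp_iff.mpr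
    ⟨Finset.subset_biUnion_of_mem (fun n : ι →₀ ℕ => n.support) hn, fun i _ => ?_⟩
  rw [Finset.mem_range, Nat.lt_succ_iff]
  rcases eq_or_ne (n i) 0 with h | h
  · simp [h]
  · exact (Finset.le_sup (f := n) (Finsupp.mem_support_iff.mpr h)).trans
      (Finset.le_sup (f := fun n : ι →₀ ℕ => n.support.sup n) hn)

lemma sum_finsupp_poissonWeight (c : ι → ℝ) (S : Finset ι) (B : ℕ) :
    ∑ n ∈ S.finsupp fun _ => Finset.range B, poissonWeight c n =
      ∏ i ∈ S, ∑ j ∈ Finset.range B, c i ^ j / (j.factorial : ℝ) := by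
  classical
  calc ∑ n ∈ S.finsupp fun _ => Finset.range B, poissonWeight c n
      = ∑ n ∈ S.finsupp fun _ => Finset.range B, ∏ i ∈ S, c i ^ n i / ((n i).factorial : ℝ) :=
        Finset.sum_congr rfl fun n hn =>
          Finsupp.prod_of_support_subset n (Finset.mem_finsupp_iff.mp hn).1 _ (by simp)
    _ = ∏ i ∈ S, ∑ j ∈ Finset.range B, c i ^ j / (j.factorial : ℝ) := by
        rw [Finset.prod_sum, Finset.finsupp, Finset.sum_map]
        refine Finset.sum_congr (by congr!) fun p _ => ?_
        rw [← Finset.prod_attach]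
        refine Finset.prod_congr rfl fun i _ => ?_
        simp [Finsupp.indicator_of_mem i.2]

lemma sum_poissonWeight_le {c : ι → ℝ} (hc : ∀ i, 0 ≤ c i) (hs : Summable c)
    (T : Finset (ι →₀ ℕ)) : ∑ n ∈ T, poissonWeight c n ≤ Real.exp (∑' i, c i) := by
  obtain ⟨S, B, hT⟩ := exists_subset_finsupp_range T
  calc ∑ n ∈ T, poissonWeight c n
      ≤ ∑ n ∈ S.finsupp fun _ => Finset.range B, poissonWeight c n :=
        Finset.sum_le_sum_of_subset_of_nonneg hT fun n _ _ => poissonWeight_nonneg hc n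
    _ = ∏ i ∈ S, ∑ j ∈ Finset.range B, c i ^ j / (j.factorial : ℝ) :=
        sum_finsupp_poissonWeight c S B
    _ ≤ ∏ i ∈ S, Real.exp (c i) :=
        Finset.prod_le_prod
          (fun i _ => Finset.sum_nonneg fun j _ => div_nonneg (pow_nonneg (hc i) _) (by positivity))
          fun i _ => Real.sum_le_exp_of_nonneg (hc i) B
    _ = Real.exp (∑ i ∈ S, c i) := (Real.exp_sum _ _).symm
    _ ≤ Real.exp (∑' i, c i) := Real.exp_le_exp.mpr (hs.sum_le_tsum _ fun i _ => hc i)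

lemma poissonWeight_mul_exp (c h : ι → ℝ) (n : ι →₀ ℕ) :
    poissonWeight (fun i => c i * Real.exp (h i)) n =
      poissonWeight c n * Real.exp (n.sum fun i j => h i * j) := by
  unfold poissonWeight Finsupp.prod Finsupp.sum
  rw [Real.exp_sum, ← Finset.prod_mul_distrib]
  refine Finset.prod_congr rfl fun i _ => ?_
  simp only [mul_pow, ← Real.exp_nat_mul, mul_comm (h i)]
  ring

lemma poissonWeight_add_single (c : ι → ℝ) (n : ι →₀ ℕ) (i : ι) :
    poissonWeight c (n + Finsupp.single i 1) * (n i + 1 : ℕ) = c i * poissonWeight c n := by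
  classical
  have herase : (n + Finsupp.single i 1).erase i = n.erase i := by simp
  unfold poissonWeight
  rw [← Finsupp.mul_prod_erase' _ i _ (by simp), herase,
    ← Finsupp.mul_prod_erase' n i _ (by simp), Finsupp.add_apply, Finsupp.single_eq_same,
    Nat.factorial_succ, pow_succ]
  push_cast
  have : (n i : ℝ) + 1 ≠ 0 := by positivity
  field_simp

end PoissonWeight

/-! ### The Gibbs distribution -/

section CycleWeight

variable {d : ℕ} {β : ℝ}

lemma cycleWeight_pos (hβ : 0 < β) (k : ℕ+) : 0 < cycleWeight d β k := by
  have : (0 : ℝ) < (k : ℝ) := by exact_mod_cast k.pos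
  unfold cycleWeight
  positivity

lemma summable_cycleWeight (hd : 1 ≤ d) : Summable (cycleWeight d β) := by
  have hd' : (1 : ℝ) ≤ d := by exact_mod_cast hd
  have hsum : Summable fun n : ℕ => 1 / (n : ℝ) ^ (1 + (d : ℝ) / 2) :=
    Real.summable_one_div_nat_rpow.mpr (by linarith)
  refine ((hsum.comp_injective PNat.coe_injective).mul_left
    (1 / (4 * Real.pi * β) ^ ((d : ℝ) / 2))).congr fun k => ?_
  rw [Function.comp_apply, one_div_mul_one_div, cycleWeight]

lemma summable_cycleWeight_mul_exp (hd : 1 ≤ d) (hβ : 0 < β) {s : ℝ} (hs : s ≤ 0) :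
    Summable fun k : ℕ+ => cycleWeight d β k * Real.exp (β * s * k) := by
  refine Summable.of_nonneg_of_le (fun k => (mul_pos (cycleWeight_pos hβ k) (Real.exp_pos _)).le)
    (fun k => mul_le_of_le_one_right (cycleWeight_pos hβ k).le (Real.exp_le_one_iff.mpr ?_))
    (summable_cycleWeight (β := β) hd)
  exact mul_nonpos_of_nonpos_of_nonneg (mul_nonpos_of_nonneg_of_nonpos hβ.le hs) (by positivity)

end CycleWeight

/-- The density with respect to counting measure of the law of the cycle counts in the ideal gas. -/
def referenceWeight (d : ℕ) (β α V : ℝ) (n : Counts) : ℝ :=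
  Real.exp (-(V * totalWeight d β α)) *
    poissonWeight (fun k => V * cycleWeight d β k * Real.exp (β * α * k)) n

/-- The unnormalized density of the Gibbs distribution with respect to counting measure. It is free
of the reference parameter `α`, which drops out of the Gibbs distribution. -/
def gibbsWeight (d : ℕ) (β a b μ V : ℝ) (m : ℕ) (n : Counts) : ℝ :=
  poissonWeight (fun k => V * cycleWeight d β k) n *
    Real.exp (β * V * (μ * totalDensity V n - a / 2 * totalDensity V n ^ 2
      + b / 2 * counterTerm V m n))

/-- The partition function, normalized by counting measure; it differs from `∫ e^{-βH} dQ` by the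
factor `e^{V q̄^{(α)}}`. -/
def partitionFunction (d : ℕ) (β a b μ V : ℝ) (m : ℕ) : ℝ :=
  ∑' n, gibbsWeight d β a b μ V m n

section Expectation

variable {d : ℕ} {β α a b μ V : ℝ} {m : ℕ}

lemma referenceMeasure_eq_sum_dirac : referenceMeasure d β α V =
    Measure.sum fun n => ENNReal.ofReal (referenceWeight d β α V n) • Measure.dirac n :=
  rfl

lemma referenceWeight_nonneg (hβ : 0 < β) (hV : 0 < V) (n : Counts) :
    0 ≤ referenceWeight d β α V n :=
  mul_nonneg (Real.exp_pos _).le <| poissonWeight_nonneg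
    (fun k => (mul_pos (mul_pos hV (cycleWeight_pos hβ k)) (Real.exp_pos _)).le) n

lemma poissonWeight_cycleWeight_nonneg (hβ : 0 < β) (hV : 0 < V) (n : Counts) :
    0 ≤ poissonWeight (fun k => V * cycleWeight d β k) n :=
  poissonWeight_nonneg (fun k => (mul_pos hV (cycleWeight_pos hβ k)).le) n

lemma gibbsWeight_pos (hβ : 0 < β) (hV : 0 < V) (m : ℕ) (n : Counts) :
    0 < gibbsWeight d β a b μ V m n :=
  mul_pos (poissonWeight_pos (fun k => mul_pos hV (cycleWeight_pos hβ k)) n) (Real.exp_pos _)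

lemma referenceWeight_mul_exp_hamiltonian (hV : 0 < V) (n : Counts) :
    referenceWeight d β α V n * Real.exp (-β * hamiltonian α a b μ V m n) =
      Real.exp (-(V * totalWeight d β α)) * gibbsWeight d β a b μ V m n := by
  have hmass : (n.sum fun k j => β * α * (k : ℝ) * (j : ℝ)) = β * α * V * totalDensity V n := by
    simp only [totalDensity, Finsupp.sum, Finset.mul_sum]
    refine Finset.sum_congr rfl fun k _ => ?_
    field_simp
  rw [referenceWeight, poissonWeight_mul_exp, hmass, gibbsWeight, mul_assoc, mul_assoc,
    ← Real.exp_add, hamiltonian]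
  ring_nf

lemma integrable_exp_hamiltonian_smul (hβ : 0 < β) (hV : 0 < V) {g : Counts → ℝ}
    (hg : Summable fun n => gibbsWeight d β a b μ V m n * |g n|) :
    Integrable (fun n => Real.exp (-β * hamiltonian α a b μ V m n) • g n)
      (referenceMeasure d β α V) := by
  rw [referenceMeasure_eq_sum_dirac]
  refine integrable_sum_dirac (fun n => ENNReal.ofReal_ne_top) ?_
  refine (hg.mul_left (Real.exp (-(V * totalWeight d β α)))).congr fun n => ?_
  rw [ENNReal.toReal_ofReal (referenceWeight_nonneg hβ hV n), norm_smul, Real.norm_eq_abs,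
    Real.norm_eq_abs, Real.abs_exp, ← mul_assoc, ← mul_assoc,
    referenceWeight_mul_exp_hamiltonian hV]

lemma integral_exp_hamiltonian_smul (hβ : 0 < β) (hV : 0 < V) (g : Counts → ℝ) :
    ∫ n, Real.exp (-β * hamiltonian α a b μ V m n) • g n ∂(referenceMeasure d β α V) =
      Real.exp (-(V * totalWeight d β α)) * ∑' n, gibbsWeight d β a b μ V m n * g n := by
  rw [referenceMeasure_eq_sum_dirac, integral_sum_dirac (fun n => ENNReal.ofReal_ne_top),
    ← tsum_mul_left]
  refine tsum_congr fun n => ?_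
  rw [ENNReal.toReal_ofReal (referenceWeight_nonneg hβ hV n), smul_eq_mul, smul_eq_mul, ← mul_assoc,
    ← mul_assoc, referenceWeight_mul_exp_hamiltonian hV]

lemma integrable_gibbsMeasure (hβ : 0 < β) (hV : 0 < V)
    (hZ : Summable (gibbsWeight d β a b μ V m)) {g : Counts → ℝ}
    (hg : Summable fun n => gibbsWeight d β a b μ V m n * |g n|) :
    Integrable g (gibbsMeasure d β α a b μ V m) := by
  rw [gibbsMeasure, integrable_tilted_iff]
  · exact integrable_exp_hamiltonian_smul hβ hV hg
  · simpa using integrable_exp_hamiltonian_smul (α := α) hβ hV (g := fun _ => 1) (by simpa using hZ)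

lemma integral_gibbsMeasure (hβ : 0 < β) (hV : 0 < V) (g : Counts → ℝ) :
    ∫ n, g n ∂(gibbsMeasure d β α a b μ V m) =
      (∑' n, gibbsWeight d β a b μ V m n * g n) / partitionFunction d β a b μ V m := by
  have hZ : ∫ n, Real.exp (-β * hamiltonian α a b μ V m n) ∂(referenceMeasure d β α V) =
      Real.exp (-(V * totalWeight d β α)) * partitionFunction d β a b μ V m := by
    simpa [partitionFunction] using integral_exp_hamiltonian_smul (a := a) (b := b) (μ := μ)
      (m := m) hβ hV fun _ => 1
  simp only [gibbsMeasure, integral_tilted, hZ, div_eq_inv_mul, mul_smul, integral_smul,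
    integral_exp_hamiltonian_smul hβ hV]
  simp only [smul_eq_mul, mul_inv]
  field_simp

end Expectation

/-! ### Short and long cycles -/

/-- The number of particles in cycles of length less than `m`. -/
def shortMass (m : ℕ) (n : Counts) : ℕ :=
  n.sum fun k j => if (k : ℕ) < m then (k : ℕ) * j else 0

/-- The number of particles in cycles of length at least `m`. -/
def longMass (m : ℕ) (n : Counts) : ℕ :=
  n.sum fun k j => if m ≤ (k : ℕ) then (k : ℕ) * j else 0

/-- The pair empirical particle density: the densities of particles in cycles of length less than
`m` and at least `m`. The rate function governs its large deviations. -/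
def densityPair (V : ℝ) (m : ℕ) (n : Counts) : ℝ × ℝ :=
  (shortMass m n / V, longMass m n / V)

/-- The total weight `∑_{k ≥ m} q_k` of the long cycles. -/
def tailWeight (d : ℕ) (β : ℝ) (m : ℕ) : ℝ :=
  ∑' k : ℕ+, if m ≤ (k : ℕ) then cycleWeight d β k else 0

lemma totalDensity_eq_add (V : ℝ) (m : ℕ) (n : Counts) :
    totalDensity V n = (densityPair V m n).1 + (densityPair V m n).2 := by
  simp only [totalDensity, densityPair, shortMass, longMass, Finsupp.sum, ← add_div, ← Nat.cast_add,
    ← Finset.sum_add_distrib]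
  push_cast
  rw [Finset.sum_div]
  refine Finset.sum_congr rfl fun k _ => ?_
  rcases lt_or_ge (k : ℕ) m with h | h
  · simp [h, not_le.mpr h, mul_div_assoc]
  · simp [h, not_lt.mpr h, mul_div_assoc]

lemma densityFrom_eq_snd (V : ℝ) (m : ℕ) (n : Counts) :
    densityFrom V m n = (densityPair V m n).2 := by
  simp only [densityFrom, densityPair, longMass, Finsupp.sum]
  push_cast
  rw [Finset.sum_div]
  refine Finset.sum_congr rfl fun k _ => ?_
  split_ifs <;> simp [mul_div_assoc]

lemma densityPair_nonneg {V : ℝ} (hV : 0 < V) (m : ℕ) (n : Counts) :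
    0 ≤ (densityPair V m n).1 ∧ 0 ≤ (densityPair V m n).2 := by
  constructor <;> (unfold densityPair; positivity)

lemma totalDensity_nonneg {V : ℝ} (hV : 0 < V) (n : Counts) : 0 ≤ totalDensity V n := by
  rw [totalDensity_eq_add V 0]
  exact add_nonneg (densityPair_nonneg hV 0 n).1 (densityPair_nonneg hV 0 n).2

lemma longMass_eq_zero_or_le (m : ℕ) (n : Counts) : longMass m n = 0 ∨ m ≤ longMass m n := by
  by_cases h : ∃ k ∈ n.support, m ≤ (k : ℕ)
  · right
    obtain ⟨k, hk, hm⟩ := h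
    have hk' : 1 ≤ n k := Nat.one_le_iff_ne_zero.mpr (Finsupp.mem_support_iff.mp hk)
    calc m ≤ (k : ℕ) * n k := hm.trans (Nat.le_mul_of_pos_right _ hk')
      _ = if m ≤ (k : ℕ) then (k : ℕ) * n k else 0 := (if_pos hm).symm
      _ ≤ longMass m n :=
        Finset.single_le_sum (f := fun k : ℕ+ => if m ≤ (k : ℕ) then (k : ℕ) * n k else 0)
          (fun _ _ => Nat.zero_le _) hk
  · left
    push Not at h
    exact Finset.sum_eq_zero fun k hk => if_neg (h k hk).not_ge

lemma counterTerm_le_sq {V : ℝ} (hV : 0 < V) (m : ℕ) (n : Counts) :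
    counterTerm V m n ≤ (densityPair V m n).2 ^ 2 := by
  have hsq : counterTerm V m n = n.sum fun k j =>
      (if m ≤ (k : ℕ) then (k : ℝ) * ((j : ℝ) / V) else 0) ^ 2 := by
    simp only [counterTerm, Finsupp.sum]
    refine Finset.sum_congr rfl fun k _ => ?_
    split_ifs <;> ring
  rw [← densityFrom_eq_snd, hsq]
  refine Finset.sum_sq_le_sq_sum_of_nonneg fun k _ => ?_
  split_ifs <;> positivity

/-! ### Upper bounds on the Gibbs weight -/

section UpperBound

variable {d : ℕ} {β a b μ V : ℝ} {m M : ℕ}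

lemma summable_tailWeight (hd : 1 ≤ d) (hβ : 0 < β) (m : ℕ) :
    Summable fun k : ℕ+ => if m ≤ (k : ℕ) then cycleWeight d β k else 0 :=
  (summable_cycleWeight (β := β) hd).of_nonneg_of_le
    (fun k => by have := (cycleWeight_pos (d := d) hβ k).le; split_ifs <;> simp [this])
    (fun k => by have := (cycleWeight_pos (d := d) hβ k).le; split_ifs <;> simp [this])

lemma tendsto_tailWeight (hd : 1 ≤ d) (hβ : 0 < β) : Tendsto (tailWeight d β) atTop (𝓝 0) := by
  rw [← tsum_zero (α := ℝ) (β := ℕ+)]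
  refine tendsto_tsum_of_dominated_convergence (summable_cycleWeight (d := d) (β := β) hd)
    (fun k => ?_) (Eventually.of_forall fun m k => ?_)
  · refine tendsto_const_nhds.congr' ?_
    filter_upwards [eventually_gt_atTop (k : ℕ)] with m hm
    rw [if_neg hm.not_ge]
  · have := (cycleWeight_pos (d := d) hβ k).le
    split_ifs <;> simp [this, abs_of_nonneg]

lemma mul_idealPressure (hβ : β ≠ 0) (s : ℝ) : β * idealPressure d β s = totalWeight d β s := by
  unfold idealPressure
  field_simp

lemma tsum_tilted_cycleWeight_le (hd : 1 ≤ d) (hβ : 0 < β) (hV : 0 < V) (m : ℕ) {s : ℝ}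
    (hs : s ≤ 0) {c : ℕ+ → ℝ}
    (hc : c = fun k => V * cycleWeight d β k * Real.exp (if (k : ℕ) < m then β * s * k else 0)) :
    Summable c ∧ ∑' k, c k ≤ V * totalWeight d β s + V * tailWeight d β m := by
  have hc_nonneg : ∀ k, 0 ≤ c k := fun k => by
    have := cycleWeight_pos (d := d) hβ k
    rw [hc]; positivity
  have hc_le : ∀ k, c k ≤ V * (cycleWeight d β k * Real.exp (β * s * k)) +
      V * (if m ≤ (k : ℕ) then cycleWeight d β k else 0) := fun k => by
    have := cycleWeight_pos (d := d) hβ k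
    rcases lt_or_ge (k : ℕ) m with hk | hk
    · simp [hc, hk, hk.not_ge, mul_assoc]
    · have : 0 ≤ V * (cycleWeight d β k * Real.exp (β * s * k)) := by positivity
      simpa [hc, hk, hk.not_gt] using this
  have hshort := (summable_cycleWeight_mul_exp hd hβ hs).mul_left V
  have hlong := (summable_tailWeight hd hβ m).mul_left V
  have hsum := (hshort.add hlong).of_nonneg_of_le hc_nonneg hc_le
  refine ⟨hsum, (hsum.tsum_le_tsum hc_le (hshort.add hlong)).trans_eq ?_⟩
  rw [hshort.tsum_add hlong, tsum_mul_left, tsum_mul_left, totalWeight, tailWeight]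

/-- Chernoff bound: on the event the tilt by `e^{β s k}` of the short cycles is constant. -/
lemma sum_poissonWeight_le_exp_legendre (hd : 1 ≤ d) (hβ : 0 < β) (hV : 0 < V) {T : Finset Counts}
    (hT : ∀ n ∈ T, shortMass m n = M) {s : ℝ} (hs : s ≤ 0) :
    ∑ n ∈ T, poissonWeight (fun k => V * cycleWeight d β k) n ≤
      Real.exp (V * tailWeight d β m - β * V * (s * (M / V) - idealPressure d β s)) := by
  set h : ℕ+ → ℝ := fun k => if (k : ℕ) < m then β * s * k else 0
  obtain ⟨hsum, hle⟩ := tsum_tilted_cycleWeight_le (V := V) hd hβ hV m hs rfl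
  have htilt : ∀ n ∈ T, poissonWeight (fun k => V * cycleWeight d β k * Real.exp (h k)) n =
      poissonWeight (fun k => V * cycleWeight d β k) n * Real.exp (β * s * M) := fun n hn => by
    rw [poissonWeight_mul_exp, ← hT n hn, shortMass, Finsupp.sum, Finsupp.sum, Nat.cast_sum,
      Finset.mul_sum]
    congr 2
    refine Finset.sum_congr rfl fun k _ => ?_
    simp only [h]
    split_ifs <;> push_cast <;> ring
  have hbound : (∑ n ∈ T, poissonWeight (fun k => V * cycleWeight d β k) n) *
      Real.exp (β * s * M) ≤ Real.exp (V * totalWeight d β s + V * tailWeight d β m) := by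
    rw [Finset.sum_mul, ← Finset.sum_congr rfl htilt]
    refine (sum_poissonWeight_le (fun k => ?_) hsum T).trans (Real.exp_le_exp.mpr hle)
    have := cycleWeight_pos (d := d) hβ k
    positivity
  rw [← le_div_iff₀ (Real.exp_pos _), ← Real.exp_sub] at hbound
  refine hbound.trans_eq ?_
  rw [← mul_idealPressure hβ.ne']
  congr 1
  field_simp
  ring

lemma sum_poissonWeight_le_exp_freeEnergy (hd : 1 ≤ d) (hβ : 0 < β) (hV : 0 < V)
    {T : Finset Counts} (hT : ∀ n ∈ T, shortMass m n = M) :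
    ∑ n ∈ T, poissonWeight (fun k => V * cycleWeight d β k) n ≤
      Real.exp (V * tailWeight d β m - β * V * freeEnergy d β (M / V)) := by
  set S := ∑ n ∈ T, poissonWeight (fun k => V * cycleWeight d β k) n with hS
  have hS_nonneg : 0 ≤ S := Finset.sum_nonneg fun n _ => poissonWeight_cycleWeight_nonneg hβ hV n
  rcases hS_nonneg.eq_or_lt with hS_zero | hS_pos
  · rw [← hS_zero]; exact (Real.exp_pos _).le
  have hβV : 0 < β * V := mul_pos hβ hV
  have hsup : freeEnergy d β (M / V) ≤ (V * tailWeight d β m - Real.log S) / (β * V) := by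
    refine ciSup_le fun s => ?_
    have := sum_poissonWeight_le_exp_legendre hd hβ hV hT s.2
    rw [← hS, ← Real.log_le_iff_le_exp hS_pos] at this
    rw [le_div_iff₀ hβV]
    linarith
  rw [le_div_iff₀ hβV] at hsup
  rw [← Real.log_le_iff_le_exp hS_pos]
  linarith

lemma gibbsWeight_le (hβ : 0 < β) (hV : 0 < V) (hb : 0 ≤ b) (m : ℕ) (n : Counts) :
    gibbsWeight d β a b μ V m n ≤ poissonWeight (fun k => V * cycleWeight d β k) n *
      Real.exp (β * V * (freeEnergy d β (densityPair V m n).1 -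
        rateEnergy d β a b μ (densityPair V m n))) := by
  have := mul_le_mul_of_nonneg_left (counterTerm_le_sq hV m n) (div_nonneg hb zero_le_two)
  refine mul_le_mul_of_nonneg_left (Real.exp_le_exp.mpr ?_)
    (poissonWeight_cycleWeight_nonneg hβ hV n)
  refine mul_le_mul_of_nonneg_left ?_ (mul_pos hβ hV).le
  rw [totalDensity_eq_add V m, rateEnergy]
  linarith

lemma sum_gibbsWeight_le_of_densityPair_eq (hd : 1 ≤ d) (hβ : 0 < β) (hV : 0 < V) (hb : 0 ≤ b)
    {T : Finset Counts} {M L : ℕ} (hT : ∀ n ∈ T, shortMass m n = M ∧ longMass m n = L) :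
    ∑ n ∈ T, gibbsWeight d β a b μ V m n ≤
      Real.exp (V * tailWeight d β m - β * V * rateEnergy d β a b μ (M / V, L / V)) := by
  set z : ℝ × ℝ := (M / V, L / V)
  have hpair : ∀ n ∈ T, densityPair V m n = z := fun n hn => by
    rw [densityPair, (hT n hn).1, (hT n hn).2]
  calc ∑ n ∈ T, gibbsWeight d β a b μ V m n
      ≤ (∑ n ∈ T, poissonWeight (fun k => V * cycleWeight d β k) n) *
          Real.exp (β * V * (freeEnergy d β z.1 - rateEnergy d β a b μ z)) := by
        rw [Finset.sum_mul]
        exact Finset.sum_le_sum fun n hn => hpair n hn ▸ gibbsWeight_le hβ hV hb m n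
    _ ≤ Real.exp (V * tailWeight d β m - β * V * freeEnergy d β z.1) *
          Real.exp (β * V * (freeEnergy d β z.1 - rateEnergy d β a b μ z)) :=
        mul_le_mul_of_nonneg_right
          (sum_poissonWeight_le_exp_freeEnergy hd hβ hV fun n hn => (hT n hn).1) (Real.exp_pos _).le
    _ = Real.exp (V * tailWeight d β m - β * V * rateEnergy d β a b μ z) := by
        rw [← Real.exp_add]; ring_nf

lemma sum_le_of_geometric_fibers {α : Type*} {f : α → ℝ} (φ : α → ℕ × ℕ) {A r : ℝ} (hA : 0 ≤ A)
    (hr : 0 ≤ r) (hr1 : r < 1) {T : Finset α}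
    (hf : ∀ p, ∑ n ∈ T with φ n = p, f n ≤ A * (r ^ p.1 * r ^ p.2)) :
    ∑ n ∈ T, f n ≤ A * (1 - r)⁻¹ ^ 2 := by
  have hgeo := summable_geometric_of_lt_one hr hr1
  have hprod : Summable fun p : ℕ × ℕ => r ^ p.1 * r ^ p.2 :=
    hgeo.mul_of_nonneg hgeo (fun _ => by positivity) (fun _ => by positivity)
  calc ∑ n ∈ T, f n = ∑ p ∈ T.image φ, ∑ n ∈ T with φ n = p, f n :=
        (Finset.sum_fiberwise_of_maps_to (fun n hn => Finset.mem_image_of_mem φ hn) _).symm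
    _ ≤ ∑ p ∈ T.image φ, A * (r ^ p.1 * r ^ p.2) := Finset.sum_le_sum fun p _ => hf p
    _ = A * ∑ p ∈ T.image φ, r ^ p.1 * r ^ p.2 := (Finset.mul_sum _ _ _).symm
    _ ≤ A * ∑' p : ℕ × ℕ, r ^ p.1 * r ^ p.2 :=
        mul_le_mul_of_nonneg_left (hprod.sum_le_tsum _ fun p _ => by positivity) hA
    _ = A * (1 - r)⁻¹ ^ 2 := by
        rw [← hgeo.tsum_mul_tsum hgeo hprod, tsum_geometric_of_lt_one hr hr1, sq]

lemma le_inv_mul_exp {c : ℝ} (hc : 0 < c) (t : ℝ) : t ≤ c⁻¹ * Real.exp (c * t) := by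
  rw [inv_mul_eq_div, le_div_iff₀ hc, mul_comm]
  linarith [Real.add_one_le_exp (c * t)]

/-- Half of the energy margin `η (1 + x + y)` absorbs the factor `1 + x + y`, the other half makes
the bound geometric in `M` and `L`. -/
lemma sum_gibbsWeight_mul_le_of_densityPair_eq (hd : 1 ≤ d) (hβ : 0 < β) (hV : 0 < V) (hb : 0 ≤ b)
    {e η : ℝ} (hη : 0 < η) {T : Finset Counts} {M L : ℕ}
    (hfiber : ∀ n ∈ T, shortMass m n = M ∧ longMass m n = L)
    (hT : ∀ n ∈ T, e + η * (1 + totalDensity V n) ≤ rateEnergy d β a b μ (densityPair V m n)) :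
    ∑ n ∈ T, gibbsWeight d β a b μ V m n * (1 + totalDensity V n) ≤
      (β * V * η / 2)⁻¹ * Real.exp (V * (tailWeight d β m - β * (e + η / 2))) *
        (Real.exp (-(β * η / 2)) ^ M * Real.exp (-(β * η / 2)) ^ L) := by
  rcases T.eq_empty_or_nonempty with rfl | ⟨n₀, hn₀⟩
  · rw [Finset.sum_empty]; positivity
  set ρ : ℝ := M / V + L / V with hρ
  have hdensity : ∀ n ∈ T, totalDensity V n = ρ := fun n hn => by
    rw [totalDensity_eq_add V m, densityPair, (hfiber n hn).1, (hfiber n hn).2]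
  have hmargin : e + η * (1 + ρ) ≤ rateEnergy d β a b μ (M / V, L / V) := by
    have := hT n₀ hn₀
    rwa [hdensity n₀ hn₀, densityPair, (hfiber n₀ hn₀).1, (hfiber n₀ hn₀).2] at this
  calc ∑ n ∈ T, gibbsWeight d β a b μ V m n * (1 + totalDensity V n)
      = (∑ n ∈ T, gibbsWeight d β a b μ V m n) * (1 + ρ) := by
        rw [Finset.sum_mul]
        exact Finset.sum_congr rfl fun n hn => by rw [hdensity n hn]
    _ ≤ Real.exp (V * tailWeight d β m - β * V * (e + η * (1 + ρ))) *
          ((β * V * η / 2)⁻¹ * Real.exp (β * V * η / 2 * (1 + ρ))) := by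
        refine mul_le_mul ((sum_gibbsWeight_le_of_densityPair_eq hd hβ hV hb hfiber).trans
          (Real.exp_le_exp.mpr ?_)) (le_inv_mul_exp (by positivity) _) (by positivity)
          (Real.exp_pos _).le
        have := mul_le_mul_of_nonneg_left hmargin (mul_pos hβ hV).le
        linarith
    _ = (β * V * η / 2)⁻¹ * Real.exp (V * (tailWeight d β m - β * (e + η / 2))) *
          (Real.exp (-(β * η / 2)) ^ M * Real.exp (-(β * η / 2)) ^ L) := by
        rw [mul_left_comm, ← Real.exp_add, mul_assoc _ (Real.exp _), ← Real.exp_nat_mul,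
          ← Real.exp_nat_mul, ← Real.exp_add, ← Real.exp_add, hρ]
        congr 2
        field_simp
        ring

lemma sum_gibbsWeight_mul_le (hd : 1 ≤ d) (hβ : 0 < β) (hV : 0 < V) (hb : 0 ≤ b) {e η : ℝ}
    (hη : 0 < η) {T : Finset Counts}
    (hT : ∀ n ∈ T, e + η * (1 + totalDensity V n) ≤ rateEnergy d β a b μ (densityPair V m n)) :
    ∑ n ∈ T, gibbsWeight d β a b μ V m n * (1 + totalDensity V n) ≤
      (β * V * η / 2)⁻¹ * Real.exp (V * (tailWeight d β m - β * (e + η / 2))) *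
        (1 - Real.exp (-(β * η / 2)))⁻¹ ^ 2 := by
  have hdecay : 0 < β * η / 2 := by positivity
  refine sum_le_of_geometric_fibers (fun n => (shortMass m n, longMass m n)) (by positivity)
    (Real.exp_pos _).le (Real.exp_lt_one_iff.mpr (neg_lt_zero.mpr hdecay)) fun p => ?_
  exact sum_gibbsWeight_mul_le_of_densityPair_eq hd hβ hV hb hη
    (fun n hn => Prod.ext_iff.mp (Finset.mem_filter.mp hn).2)
    fun n hn => hT n (Finset.mem_filter.mp hn).1

end UpperBound

/-! ### Adding one cycle -/

section Mecke

variable {d : ℕ} {β a b μ V : ℝ} {m : ℕ}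

lemma totalDensity_add_single (V : ℝ) (n : Counts) (k : ℕ+) :
    totalDensity V (n + Finsupp.single k 1) = totalDensity V n + k / V := by
  unfold totalDensity
  rw [Finsupp.sum_add_index' (fun _ => by simp) fun _ _ _ => by push_cast; ring,
    Finsupp.sum_single_index (by simp)]
  push_cast
  ring

lemma counterTerm_add_single (V : ℝ) (n : Counts) {k : ℕ+} (hk : (k : ℕ) < m) :
    counterTerm V m (n + Finsupp.single k 1) = counterTerm V m n := by
  have herase : (n + Finsupp.single k 1).erase k = n.erase k := by simp
  unfold counterTerm
  rw [← Finsupp.add_sum_erase' (n + Finsupp.single k 1) k _ (by simp),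
    ← Finsupp.add_sum_erase' n k _ (by simp), herase]
  simp only [if_neg hk.not_ge]

lemma gibbsWeight_add_single (hV : V ≠ 0) (n : Counts) {k : ℕ+} (hk : (k : ℕ) < m) :
    gibbsWeight d β a b μ V m (n + Finsupp.single k 1) * (n k + 1 : ℕ) =
      V * cycleWeight d β k * (gibbsWeight d β a b μ V m n *
        Real.exp (β * k * (μ - a * totalDensity V n) - β * a * k ^ 2 / (2 * V))) := by
  have hexponent : β * V * (μ * (totalDensity V n + k / V) -
      a / 2 * (totalDensity V n + k / V) ^ 2 + b / 2 * counterTerm V m n) =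
      β * V * (μ * totalDensity V n - a / 2 * totalDensity V n ^ 2 + b / 2 * counterTerm V m n) +
        (β * k * (μ - a * totalDensity V n) - β * a * k ^ 2 / (2 * V)) := by
    field_simp
    ring
  rw [gibbsWeight, totalDensity_add_single, counterTerm_add_single V n hk, mul_right_comm,
    poissonWeight_add_single, hexponent, Real.exp_add, gibbsWeight]
  ring

lemma tsum_gibbsWeight_mul_count (hV : V ≠ 0) {k : ℕ+} (hk : (k : ℕ) < m) :
    ∑' n, gibbsWeight d β a b μ V m n * (n k : ℝ) =
      V * cycleWeight d β k * ∑' n, gibbsWeight d β a b μ V m n *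
        Real.exp (β * k * (μ - a * totalDensity V n) - β * a * k ^ 2 / (2 * V)) := by
  have hinj : Function.Injective fun n : Counts => n + Finsupp.single k 1 :=
    fun n n' h => add_right_cancel h
  have hsupp : (Function.support fun n => gibbsWeight d β a b μ V m n * (n k : ℝ)) ⊆
      Set.range fun n : Counts => n + Finsupp.single k 1 := by
    intro n hn
    have hk0 : n k ≠ 0 := by
      rintro h
      simp [h] at hn
    exact ⟨n - Finsupp.single k 1, tsub_add_cancel_of_le
      (Finsupp.single_le_iff.mpr (Nat.one_le_iff_ne_zero.mpr hk0))⟩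
  rw [← hinj.tsum_eq hsupp, ← tsum_mul_left]
  refine tsum_congr fun n => ?_
  rw [← gibbsWeight_add_single hV n hk, Finsupp.add_apply, Finsupp.single_eq_same]

end Mecke

/-! ### Conjugate pairs of the ideal gas -/

/-- The density `k q_k e^{βsk}` of particles in cycles of length `k` in the ideal gas at chemical
potential `s`. -/
def cycleDensity (d : ℕ) (β s : ℝ) (k : ℕ+) : ℝ :=
  k * cycleWeight d β k * Real.exp (β * s * k)

/-- `s` is a subgradient of the free energy `f₀` at `x`. For `s < 0` this says that `x` is the total
density of the ideal gas at chemical potential `s`. For `s = 0` it says that `x` is at least the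
critical density, which may be infinite: hence the condition on partial sums. -/
structure IsConjugate (d : ℕ) (β s x : ℝ) : Prop where
  nonpos : s ≤ 0
  sum_le : ∀ F : Finset ℕ+, ∑ k ∈ F, cycleDensity d β s k ≤ x
  hasSum : s < 0 → HasSum (cycleDensity d β s) x

section Conjugate

variable {d : ℕ} {β : ℝ}

lemma cycleDensity_pos (hβ : 0 < β) (s : ℝ) (k : ℕ+) : 0 < cycleDensity d β s k :=
  mul_pos (mul_pos (Nat.cast_pos.mpr k.pos) (cycleWeight_pos hβ k)) (Real.exp_pos _)

lemma cycleDensity_mono (hβ : 0 < β) (k : ℕ+) : Monotone fun s => cycleDensity d β s k := by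
  intro s s' h
  have := (cycleWeight_pos (d := d) hβ k).le
  simp only [cycleDensity]
  gcongr

lemma continuous_cycleDensity (k : ℕ+) : Continuous fun s => cycleDensity d β s k := by
  unfold cycleDensity
  fun_prop

lemma summable_cycleDensity (hd : 1 ≤ d) (hβ : 0 < β) {s : ℝ} (hs : s < 0) :
    Summable (cycleDensity d β s) := by
  have hc : 0 < -(β * s) := neg_pos.mpr (mul_neg_of_pos_of_neg hβ hs)
  refine Summable.of_nonneg_of_le (fun k => (cycleDensity_pos hβ s k).le) (fun k => ?_)
    ((summable_cycleWeight (β := β) hd).mul_left (-(β * s))⁻¹)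
  have hexp : (k : ℝ) * Real.exp (β * s * k) ≤ (-(β * s))⁻¹ := by
    have h := mul_le_mul_of_nonneg_right (le_inv_mul_exp hc k) (Real.exp_pos (β * s * k)).le
    rwa [mul_assoc (-(β * s))⁻¹, ← Real.exp_add, neg_mul, neg_add_cancel, Real.exp_zero,
      mul_one] at h
  calc cycleDensity d β s k = k * Real.exp (β * s * k) * cycleWeight d β k := by
        rw [cycleDensity, mul_right_comm]
    _ ≤ _ := mul_le_mul_of_nonneg_right hexp (cycleWeight_pos hβ k).le

lemma continuousOn_tsum_cycleDensity (hd : 1 ≤ d) (hβ : 0 < β) {s : ℝ} (hs : s < 0) :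
    ContinuousOn (fun r => ∑' k, cycleDensity d β r k) (Set.Iic s) :=
  continuousOn_tsum (fun k => (continuous_cycleDensity k).continuousOn)
    (summable_cycleDensity (d := d) hd hβ hs) fun k r hr => by
      rw [Real.norm_eq_abs, abs_of_pos (cycleDensity_pos hβ r k)]
      exact cycleDensity_mono hβ k hr

lemma idealPressure_nonneg (hβ : 0 < β) (s : ℝ) : 0 ≤ idealPressure d β s :=
  mul_nonneg (one_div_pos.mpr hβ).le
    (tsum_nonneg fun k => (mul_pos (cycleWeight_pos hβ k) (Real.exp_pos _)).le)

lemma le_freeEnergy (hβ : 0 < β) {s x : ℝ} (hs : s ≤ 0) (hx : 0 ≤ x) :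
    s * x - idealPressure d β s ≤ freeEnergy d β x := by
  refine le_ciSup (f := fun s : Set.Iic (0 : ℝ) => (s : ℝ) * x - idealPressure d β s)
    ⟨0, ?_⟩ (⟨s, hs⟩ : Set.Iic (0 : ℝ))
  rintro _ ⟨⟨r, hr⟩, rfl⟩
  exact sub_nonpos.mpr
    ((mul_nonpos_of_nonpos_of_nonneg hr hx).trans (idealPressure_nonneg hβ r))

lemma freeEnergy_zero_le (hβ : 0 < β) : freeEnergy d β 0 ≤ 0 :=
  ciSup_le fun s => by
    have := idealPressure_nonneg (d := d) hβ s
    linarith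

lemma mul_cycleDensity_le (hβ : 0 < β) (r s : ℝ) (k : ℕ+) :
    β * (r - s) * cycleDensity d β s k ≤
      cycleWeight d β k * Real.exp (β * r * k) - cycleWeight d β k * Real.exp (β * s * k) := by
  have hq := mul_pos (cycleWeight_pos (d := d) hβ k) (Real.exp_pos (β * s * k))
  have hexp := mul_le_mul_of_nonneg_left (Real.add_one_le_exp (β * (r - s) * k)) hq.le
  have hr : β * r * k = β * s * k + β * (r - s) * k := by ring
  rw [hr, Real.exp_add, cycleDensity]
  linarith

lemma IsConjugate.nonneg {s x : ℝ} (h : IsConjugate d β s x) : 0 ≤ x := by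
  simpa using h.sum_le ∅

lemma IsConjugate.tangent (hd : 1 ≤ d) (hβ : 0 < β) {s x : ℝ} (h : IsConjugate d β s x) {r : ℝ}
    (hr : r ≤ 0) : r * x - idealPressure d β r ≤ s * x - idealPressure d β s := by
  have hsum := (summable_cycleWeight_mul_exp hd hβ hr).hasSum.sub
    (summable_cycleWeight_mul_exp hd hβ h.nonpos).hasSum
  have htotal : β * (r - s) * x ≤ totalWeight d β r - totalWeight d β s := by
    rcases le_or_gt r s with hrs | hrs
    · refine ge_of_tendsto hsum (Eventually.of_forall fun F => ?_)
      calc β * (r - s) * x ≤ β * (r - s) * ∑ k ∈ F, cycleDensity d β s k :=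
            mul_le_mul_of_nonpos_left (h.sum_le F)
              (mul_nonpos_of_nonneg_of_nonpos hβ.le (sub_nonpos.mpr hrs))
        _ = ∑ k ∈ F, β * (r - s) * cycleDensity d β s k := Finset.mul_sum _ _ _
        _ ≤ _ := Finset.sum_le_sum fun k _ => mul_cycleDensity_le hβ r s k
    · exact hasSum_le (mul_cycleDensity_le hβ r s)
        ((h.hasSum (hrs.trans_le hr)).mul_left _) hsum
  rw [← mul_idealPressure hβ.ne', ← mul_idealPressure hβ.ne', ← mul_sub, mul_assoc] at htotal
  linarith [le_of_mul_le_mul_left htotal hβ]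

lemma IsConjugate.freeEnergy_eq (hd : 1 ≤ d) (hβ : 0 < β) {s x : ℝ} (h : IsConjugate d β s x) :
    freeEnergy d β x = s * x - idealPressure d β s :=
  le_antisymm (ciSup_le fun r => h.tangent hd hβ r.2) (le_freeEnergy hβ h.nonpos h.nonneg)

lemma IsConjugate.density_le (hβ : 0 < β) {s x s' x' : ℝ} (h : IsConjugate d β s x)
    (h' : IsConjugate d β s' x') (hs : s < s') : x ≤ x' :=
  le_of_tendsto (h.hasSum (hs.trans_le h'.nonpos)) (Eventually.of_forall fun F =>
    (Finset.sum_le_sum fun k _ => cycleDensity_mono hβ k hs.le).trans (h'.sum_le F))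

lemma isConjugate_tsum (hd : 1 ≤ d) (hβ : 0 < β) {s : ℝ} (hs : s < 0) :
    IsConjugate d β s (∑' k, cycleDensity d β s k) where
  nonpos := hs.le
  sum_le F :=
    (summable_cycleDensity hd hβ hs).sum_le_tsum F fun k _ => (cycleDensity_pos hβ s k).le
  hasSum _ := (summable_cycleDensity hd hβ hs).hasSum

lemma exists_lt_mul_tsum_cycleDensity_add (hd : 1 ≤ d) (hβ : 0 < β) {a : ℝ} (ha : 0 < a) {t : ℝ}
    {F : Finset ℕ+} (hF : t < a * ∑ k ∈ F, cycleDensity d β 0 k) :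
    ∃ s ∈ Set.Ioo (-1) 0, t < a * ∑' k, cycleDensity d β s k + s := by
  have hcont : Continuous fun s => a * ∑ k ∈ F, cycleDensity d β s k + s :=
    ((continuous_finsetSum F fun k _ => continuous_cycleDensity k).const_mul a).add continuous_id
  have hnear : ∀ᶠ s in 𝓝[<] (0 : ℝ), t < a * ∑ k ∈ F, cycleDensity d β s k + s :=
    ((hcont.tendsto 0).mono_left nhdsWithin_le_nhds).eventually_const_lt (by simpa using hF)
  obtain ⟨s, hst, hs⟩ := (hnear.and (Ioo_mem_nhdsLT (by norm_num : (-1 : ℝ) < 0))).exists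
  exact ⟨s, hs, hst.trans_le (by gcongr; exact (isConjugate_tsum hd hβ hs.2).sum_le F)⟩

lemma exists_mul_tsum_cycleDensity_add_le (hd : 1 ≤ d) (hβ : 0 < β) {a : ℝ} (ha : 0 < a) (t : ℝ) :
    ∃ s ≤ -1, a * ∑' k, cycleDensity d β s k + s ≤ t := by
  set s := min (-1) (t - a * ∑' k, cycleDensity d β (-1) k)
  have hs1 : s ≤ -1 := min_le_left _ _
  have hmono : ∑' k, cycleDensity d β s k ≤ ∑' k, cycleDensity d β (-1) k :=
    (summable_cycleDensity hd hβ (by linarith)).tsum_le_tsum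
      (fun k => cycleDensity_mono hβ k hs1) (summable_cycleDensity hd hβ (by norm_num))
  have hst : s ≤ t - a * ∑' k, cycleDensity d β (-1) k := min_le_right _ _
  exact ⟨s, hs1, by linarith [mul_le_mul_of_nonneg_left hmono ha.le]⟩

lemma exists_isConjugate (hd : 1 ≤ d) (hβ : 0 < β) {a : ℝ} (ha : 0 < a) (t : ℝ) :
    ∃ s, IsConjugate d β s ((t - s) / a) := by
  by_cases hcrit : ∀ F : Finset ℕ+, ∑ k ∈ F, cycleDensity d β 0 k ≤ t / a
  · exact ⟨0, le_rfl, by simpa using hcrit, fun h0 => absurd h0 (lt_irrefl _)⟩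
  push Not at hcrit
  obtain ⟨F, hF⟩ := hcrit
  obtain ⟨s₂, ⟨hs₂, hs₂0⟩, hts₂⟩ :=
    exists_lt_mul_tsum_cycleDensity_add hd hβ ha ((div_lt_iff₀' ha).mp hF)
  obtain ⟨s₁, hs₁, hts₁⟩ := exists_mul_tsum_cycleDensity_add_le (d := d) hd hβ ha t
  have hcont : ContinuousOn (fun s => a * ∑' k, cycleDensity d β s k + s) (Set.Icc s₁ s₂) :=
    (((continuousOn_tsum_cycleDensity hd hβ hs₂0).mono Set.Icc_subset_Iic_self).const_mul a).add
      continuousOn_id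
  obtain ⟨s, hs, hst⟩ := intermediate_value_Icc (hs₁.trans hs₂.le) hcont ⟨hts₁, hts₂.le⟩
  have hdensity : ∑' k, cycleDensity d β s k = (t - s) / a := by
    rw [eq_div_iff ha.ne']
    linarith
  exact ⟨s, hdensity ▸ isConjugate_tsum hd hβ (hs.2.trans_lt hs₂0)⟩

end Conjugate

/-! ### The mean-field gas -/

open Classical in
/-- The effective chemical potential `s ≤ 0` of the ideal gas with mean-field interaction
`(a/2) x²` at chemical potential `t`: the solution of `s = t - a x`, where `s` is conjugate to the
density `x`. -/
def effectivePotential (d : ℕ) (β a t : ℝ) : ℝ :=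
  if h : ∃ s, IsConjugate d β s ((t - s) / a) then h.choose else 0

/-- The particle density of the ideal gas with mean-field interaction at chemical potential `t`. -/
def meanFieldDensity (d : ℕ) (β a t : ℝ) : ℝ :=
  (t - effectivePotential d β a t) / a

/-- The pressure of the ideal gas with mean-field interaction at chemical potential `t`. -/
def meanFieldPressure (d : ℕ) (β a t : ℝ) : ℝ :=
  idealPressure d β (effectivePotential d β a t) + (t - effectivePotential d β a t) ^ 2 / (2 * a)

section MeanField

variable {d : ℕ} {β a : ℝ}

lemma isConjugate_effectivePotential (hd : 1 ≤ d) (hβ : 0 < β) (ha : 0 < a) (t : ℝ) :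
    IsConjugate d β (effectivePotential d β a t) (meanFieldDensity d β a t) := by
  have h := exists_isConjugate hd hβ ha t
  rw [meanFieldDensity, effectivePotential, dif_pos h]
  exact h.choose_spec

lemma effectivePotential_nonpos (hd : 1 ≤ d) (hβ : 0 < β) (ha : 0 < a) (t : ℝ) :
    effectivePotential d β a t ≤ 0 :=
  (isConjugate_effectivePotential hd hβ ha t).nonpos

lemma mul_meanFieldDensity (ha : a ≠ 0) (t : ℝ) :
    a * meanFieldDensity d β a t = t - effectivePotential d β a t :=
  mul_div_cancel₀ _ ha

lemma effectivePotential_mono (hd : 1 ≤ d) (hβ : 0 < β) (ha : 0 < a) :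
    Monotone (effectivePotential d β a) := by
  intro t t' h
  by_contra! hlt
  have hdensity := mul_le_mul_of_nonneg_left
    ((isConjugate_effectivePotential hd hβ ha t').density_le hβ
      (isConjugate_effectivePotential hd hβ ha t) hlt) ha.le
  rw [mul_meanFieldDensity ha.ne', mul_meanFieldDensity ha.ne'] at hdensity
  linarith

lemma meanFieldDensity_mono (hd : 1 ≤ d) (hβ : 0 < β) (ha : 0 < a) :
    Monotone (meanFieldDensity d β a) := by
  intro t t' h
  rcases (effectivePotential_mono hd hβ ha h).eq_or_lt with heq | hlt
  · unfold meanFieldDensity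
    rw [heq]
    gcongr
  · exact (isConjugate_effectivePotential hd hβ ha t).density_le hβ
      (isConjugate_effectivePotential hd hβ ha t') hlt

lemma meanFieldDensity_sub_le (hd : 1 ≤ d) (hβ : 0 < β) (ha : 0 < a) {t t' : ℝ} (h : t ≤ t') :
    meanFieldDensity d β a t' - meanFieldDensity d β a t ≤ (t' - t) / a := by
  have := effectivePotential_mono (d := d) hd hβ ha h
  unfold meanFieldDensity
  rw [← sub_div]
  exact div_le_div_of_nonneg_right (by linarith) ha.le

lemma abs_meanFieldDensity_sub_le (hd : 1 ≤ d) (hβ : 0 < β) (ha : 0 < a) (t t' : ℝ) :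
    |meanFieldDensity d β a t' - meanFieldDensity d β a t| ≤ |t' - t| / a := by
  wlog h : t ≤ t' generalizing t t'
  · rw [abs_sub_comm, abs_sub_comm t']
    exact this t' t (le_of_not_ge h)
  · rw [abs_of_nonneg (sub_nonneg.mpr (meanFieldDensity_mono hd hβ ha h)),
      abs_of_nonneg (sub_nonneg.mpr h)]
    exact meanFieldDensity_sub_le hd hβ ha h

lemma continuous_meanFieldDensity (hd : 1 ≤ d) (hβ : 0 < β) (ha : 0 < a) :
    Continuous (meanFieldDensity d β a) := by
  refine (LipschitzWith.of_dist_le_mul (K := (1 / a).toNNReal) fun t t' => ?_).continuous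
  rw [Real.dist_eq, Real.dist_eq, Real.coe_toNNReal _ (one_div_pos.mpr ha).le,
    one_div_mul_eq_div]
  exact abs_meanFieldDensity_sub_le hd hβ ha t' t

lemma effectivePotential_lt (hd : 1 ≤ d) (hβ : 0 < β) (ha : 0 < a) {t t' : ℝ} (h : t < t')
    (hs : effectivePotential d β a t < 0) :
    effectivePotential d β a t < effectivePotential d β a t' := by
  refine (effectivePotential_mono hd hβ ha h.le).lt_of_ne fun heq => ?_
  have hdensity := (isConjugate_effectivePotential (d := d) hd hβ ha t).hasSum hs
  have hdensity' := (isConjugate_effectivePotential (d := d) hd hβ ha t').hasSum (heq ▸ hs)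
  rw [← heq] at hdensity'
  have hmul := congrArg (a * ·) (hdensity.unique hdensity')
  simp only [mul_meanFieldDensity ha.ne'] at hmul
  linarith

lemma strictConvexOn_cycleDensity (hβ : 0 < β) (k : ℕ+) :
    StrictConvexOn ℝ Set.univ fun s => cycleDensity d β s k := by
  refine ⟨convex_univ, fun x _ y _ hxy p r hp hr hpr => ?_⟩
  have hk : (0 : ℝ) < k := Nat.cast_pos.mpr k.pos
  have hne : β * x * k ≠ β * y * k := fun h =>
    hxy (mul_left_cancel₀ hβ.ne' (mul_right_cancel₀ hk.ne' h))
  have hexp := strictConvexOn_exp.2 (Set.mem_univ (β * x * k)) (Set.mem_univ (β * y * k)) hne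
    hp hr hpr
  have harg : β * (p * x + r * y) * k = p * (β * x * k) + r * (β * y * k) := by ring
  simp only [smul_eq_mul, cycleDensity] at hexp ⊢
  rw [harg]
  linarith [mul_lt_mul_of_pos_left hexp (mul_pos hk (cycleWeight_pos (d := d) hβ k))]

lemma IsConjugate.density_lt_of_le_convexCombo (hβ : 0 < β) {s s₁ s₂ x x₁ x₂ p r : ℝ}
    (h : IsConjugate d β s x) (h₁ : IsConjugate d β s₁ x₁) (h₂ : IsConjugate d β s₂ x₂)
    (hne : s₁ ≠ s₂) (hp : 0 < p) (hr : 0 < r) (hpr : p + r = 1) (hs : s < 0)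
    (hle : s ≤ p * s₁ + r * s₂) : x < p * x₁ + r * x₂ := by
  set gap : ℕ+ → ℝ := fun k =>
    p * cycleDensity d β s₁ k + r * cycleDensity d β s₂ k - cycleDensity d β s k
  have hgap : ∀ k, 0 < gap k := fun k => sub_pos.mpr <| (cycleDensity_mono hβ k hle).trans_lt
    ((strictConvexOn_cycleDensity hβ k).2 (Set.mem_univ _) (Set.mem_univ _) hne hp hr hpr)
  suffices x ≤ p * x₁ + r * x₂ - gap 1 from this.trans_lt (sub_lt_self _ (hgap 1))
  refine le_of_tendsto (h.hasSum hs) ?_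
  filter_upwards [eventually_ge_atTop {1}] with F hF
  have hone : gap 1 ≤ ∑ k ∈ F, gap k :=
    Finset.single_le_sum (fun k _ => (hgap k).le) (hF (Finset.mem_singleton_self 1))
  rw [Finset.sum_sub_distrib, Finset.sum_add_distrib, ← Finset.mul_sum, ← Finset.mul_sum] at hone
  linarith [mul_le_mul_of_nonneg_left (h₁.sum_le F) hp.le,
    mul_le_mul_of_nonneg_left (h₂.sum_le F) hr.le]

lemma lt_effectivePotential_convexCombo (hd : 1 ≤ d) (hβ : 0 < β) (ha : 0 < a) {t₁ t₂ p r : ℝ}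
    (ht : t₁ ≠ t₂) (hp : 0 < p) (hr : 0 < r) (hpr : p + r = 1)
    (hs : effectivePotential d β a (p * t₁ + r * t₂) < 0) :
    p * effectivePotential d β a t₁ + r * effectivePotential d β a t₂ <
      effectivePotential d β a (p * t₁ + r * t₂) := by
  have hne : effectivePotential d β a t₁ ≠ effectivePotential d β a t₂ := by
    have hmin := effectivePotential_mono (d := d) hd hβ ha
      (Convex.min_le_combo t₁ t₂ hp.le hr.le hpr)
    rw [(effectivePotential_mono hd hβ ha).map_min] at hmin
    intro heq
    rw [heq, min_self] at hmin
    rcases ht.lt_or_gt with hlt | hlt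
    · exact (effectivePotential_lt hd hβ ha hlt (heq ▸ hmin.trans_lt hs)).ne heq
    · exact (effectivePotential_lt hd hβ ha hlt (hmin.trans_lt hs)).ne heq.symm
  by_contra! hle
  have hdensity := mul_lt_mul_of_pos_left
    ((isConjugate_effectivePotential hd hβ ha (p * t₁ + r * t₂)).density_lt_of_le_convexCombo hβ
      (isConjugate_effectivePotential hd hβ ha t₁) (isConjugate_effectivePotential hd hβ ha t₂)
      hne hp hr hpr hs hle) ha
  rw [mul_add, mul_left_comm a p, mul_left_comm a r, mul_meanFieldDensity ha.ne',
    mul_meanFieldDensity ha.ne', mul_meanFieldDensity ha.ne'] at hdensity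
  linarith

lemma neg_meanFieldPressure_le (hd : 1 ≤ d) (hβ : 0 < β) (ha : 0 < a) (t : ℝ) {x : ℝ}
    (hx : 0 ≤ x) :
    -meanFieldPressure d β a t + a / 2 * (x - meanFieldDensity d β a t) ^ 2 ≤
      freeEnergy d β x - t * x + a / 2 * x ^ 2 := by
  have hsquare : -meanFieldPressure d β a t + a / 2 * (x - meanFieldDensity d β a t) ^ 2 =
      effectivePotential d β a t * x - idealPressure d β (effectivePotential d β a t)
        - t * x + a / 2 * x ^ 2 := by
    unfold meanFieldPressure meanFieldDensity
    field_simp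
    ring
  linarith [le_freeEnergy (d := d) hβ (effectivePotential_nonpos (d := d) hd hβ ha t) hx]

lemma freeEnergy_meanFieldDensity (hd : 1 ≤ d) (hβ : 0 < β) (ha : 0 < a) (t : ℝ) :
    freeEnergy d β (meanFieldDensity d β a t) =
      -meanFieldPressure d β a t + t * meanFieldDensity d β a t
        - a / 2 * meanFieldDensity d β a t ^ 2 := by
  rw [(isConjugate_effectivePotential (d := d) hd hβ ha t).freeEnergy_eq hd hβ]
  unfold meanFieldPressure meanFieldDensity
  field_simp
  ring

lemma meanFieldPressure_subgradient (hd : 1 ≤ d) (hβ : 0 < β) (ha : 0 < a) (t t' : ℝ) :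
    meanFieldPressure d β a t + meanFieldDensity d β a t * (t' - t) ≤
      meanFieldPressure d β a t' := by
  have hle := neg_meanFieldPressure_le (d := d) hd hβ ha t'
    (isConjugate_effectivePotential (d := d) hd hβ ha t).nonneg
  rw [freeEnergy_meanFieldDensity hd hβ ha] at hle
  have : 0 ≤ a / 2 * (meanFieldDensity d β a t - meanFieldDensity d β a t') ^ 2 := by positivity
  linarith

lemma hasDerivAt_meanFieldPressure (hd : 1 ≤ d) (hβ : 0 < β) (ha : 0 < a) (t : ℝ) :
    HasDerivAt (meanFieldPressure d β a) (meanFieldDensity d β a t) t := by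
  have hO : (fun t' => meanFieldPressure d β a t' - meanFieldPressure d β a t -
      (t' - t) • meanFieldDensity d β a t) =O[𝓝 t] fun t' => (t' - t) ^ 2 := by
    refine IsBigO.of_bound (1 / a) (Eventually.of_forall fun t' => ?_)
    have hlower := meanFieldPressure_subgradient (d := d) hd hβ ha t t'
    have hupper := meanFieldPressure_subgradient (d := d) hd hβ ha t' t
    rw [smul_eq_mul, Real.norm_eq_abs, Real.norm_eq_abs, abs_of_nonneg (by linarith),
      abs_of_nonneg (sq_nonneg (t' - t))]
    calc _ ≤ (meanFieldDensity d β a t' - meanFieldDensity d β a t) * (t' - t) := by linarith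
      _ ≤ |meanFieldDensity d β a t' - meanFieldDensity d β a t| * |t' - t| := by
          rw [← abs_mul]
          exact le_abs_self _
      _ ≤ |t' - t| / a * |t' - t| := by
          gcongr
          exact abs_meanFieldDensity_sub_le hd hβ ha t t'
      _ = 1 / a * (t' - t) ^ 2 := by
          rw [← sq_abs (t' - t)]
          ring
  exact hasDerivAt_iff_isLittleO.mpr
    (hO.trans_isLittleO (by simpa using isLittleO_pow_sub_sub t (by norm_num : 1 < 2)))

end MeanField

/-! ### Minimizers of the rate energy -/

/-- The rate energy minimized over the density of short cycles, as a function of the density `y` of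
long cycles. -/
def reducedEnergy (d : ℕ) (β a b μ y : ℝ) : ℝ :=
  -meanFieldPressure d β a (μ - a * y) - μ * y + (a - b) / 2 * y ^ 2

/-- `z` minimizes the rate energy over the domain `𝕂(κ)`, that is, `z` is a zero of the rate
function `I^{(κ)}`. -/
structure IsGroundState (d : ℕ) (β a b μ : ℝ) (κ : ℝ≥0∞) (z : ℝ × ℝ) : Prop where
  mem : z ∈ rateDomain κ
  le : ∀ w ∈ rateDomain κ, rateEnergy d β a b μ z ≤ rateEnergy d β a b μ w

section GroundStates

variable {d : ℕ} {β a b μ : ℝ} {κ : ℝ≥0∞}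

lemma neg_idealPressure_zero_le (hβ : 0 < β) {x : ℝ} (hx : 0 ≤ x) :
    -idealPressure d β 0 ≤ freeEnergy d β x := by
  simpa using le_freeEnergy (d := d) hβ le_rfl hx

lemma coercive_rateEnergy (hβ : 0 < β) (hb : 0 ≤ b) {x y : ℝ} (hx : 0 ≤ x) (hy : 0 ≤ y) :
    -idealPressure d β 0 - μ * (x + y) + (a - b) / 2 * (x + y) ^ 2 ≤
      rateEnergy d β a b μ (x, y) := by
  have hfree := neg_idealPressure_zero_le (d := d) hβ hx
  have hsq : b / 2 * y ^ 2 ≤ b / 2 * (x + y) ^ 2 := by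
    gcongr
    exact le_add_of_nonneg_left hx
  simp only [rateEnergy]
  linarith

lemma linear_le_rateEnergy (hβ : 0 < β) (hb : 0 ≤ b) (hba : b < a) (C : ℝ) {x y : ℝ}
    (hx : 0 ≤ x) (hy : 0 ≤ y) :
    (-idealPressure d β 0 - C - (μ + C) ^ 2 / (2 * (a - b))) + C * (1 + (x + y)) ≤
      rateEnergy d β a b μ (x, y) := by
  refine le_trans ?_ (coercive_rateEnergy hβ hb hx hy)
  have hab : 0 < a - b := sub_pos.mpr hba
  have hsq_nonneg : 0 ≤ (a - b) / 2 * ((x + y) - (μ + C) / (a - b)) ^ 2 := by positivity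
  have hsq : (a - b) / 2 * ((x + y) - (μ + C) / (a - b)) ^ 2 =
      (a - b) / 2 * (x + y) ^ 2 - (μ + C) * (x + y) + (μ + C) ^ 2 / (2 * (a - b)) := by
    field_simp
    ring
  linarith

lemma reducedEnergy_add_le (hd : 1 ≤ d) (hβ : 0 < β) (ha : 0 < a) {z : ℝ × ℝ} (hz : 0 ≤ z.1) :
    reducedEnergy d β a b μ z.2 + a / 2 * (z.1 - meanFieldDensity d β a (μ - a * z.2)) ^ 2 ≤
      rateEnergy d β a b μ z := by
  have := neg_meanFieldPressure_le (d := d) hd hβ ha (μ - a * z.2) hz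
  simp only [rateEnergy, reducedEnergy]
  linarith

lemma reducedEnergy_le (hd : 1 ≤ d) (hβ : 0 < β) (ha : 0 < a) {z : ℝ × ℝ} (hz : 0 ≤ z.1) :
    reducedEnergy d β a b μ z.2 ≤ rateEnergy d β a b μ z :=
  (le_add_of_nonneg_right (by positivity)).trans (reducedEnergy_add_le hd hβ ha hz)

lemma rateEnergy_meanFieldDensity (hd : 1 ≤ d) (hβ : 0 < β) (ha : 0 < a) (y : ℝ) :
    rateEnergy d β a b μ (meanFieldDensity d β a (μ - a * y), y) = reducedEnergy d β a b μ y := by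
  simp only [rateEnergy, reducedEnergy, freeEnergy_meanFieldDensity hd hβ ha]
  ring

lemma meanFieldDensity_nonneg (hd : 1 ≤ d) (hβ : 0 < β) (ha : 0 < a) (t : ℝ) :
    0 ≤ meanFieldDensity d β a t :=
  (isConjugate_effectivePotential hd hβ ha t).nonneg

lemma hasDerivAt_reducedEnergy (hd : 1 ≤ d) (hβ : 0 < β) (ha : 0 < a) (y : ℝ) :
    HasDerivAt (reducedEnergy d β a b μ)
      (-effectivePotential d β a (μ - a * y) - b * y) y := by
  have hshift : HasDerivAt (fun y => μ - a * y) (-(a * 1)) y :=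
    ((hasDerivAt_id y).const_mul a).const_sub μ
  have hpressure := (hasDerivAt_meanFieldPressure (d := d) hd hβ ha (μ - a * y)).comp y hshift
  convert! (hpressure.neg.sub ((hasDerivAt_id y).const_mul μ)).add
    ((hasDerivAt_pow 2 y).const_mul ((a - b) / 2)) using 1
  have := mul_meanFieldDensity (d := d) (β := β) ha.ne' (μ - a * y)
  push_cast
  linarith

lemma continuous_reducedEnergy (hd : 1 ≤ d) (hβ : 0 < β) (ha : 0 < a) :
    Continuous (reducedEnergy d β a b μ) :=
  continuous_iff_continuousAt.mpr fun y => (hasDerivAt_reducedEnergy hd hβ ha y).continuousAt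

lemma IsGroundState.reducedEnergy_le (hd : 1 ≤ d) (hβ : 0 < β) (ha : 0 < a) {z : ℝ × ℝ}
    (h : IsGroundState d β a b μ κ z) {y : ℝ} (hy : 0 ≤ y) (hκ : y = 0 ∨ κ ≤ ENNReal.ofReal y) :
    reducedEnergy d β a b μ z.2 ≤ reducedEnergy d β a b μ y := by
  rw [← rateEnergy_meanFieldDensity hd hβ ha y]
  exact (CycleHYL.reducedEnergy_le hd hβ ha h.mem.1).trans
    (h.le _ ⟨meanFieldDensity_nonneg hd hβ ha _, hy, hκ⟩)

lemma IsGroundState.fst_eq (hd : 1 ≤ d) (hβ : 0 < β) (ha : 0 < a) {z : ℝ × ℝ}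
    (h : IsGroundState d β a b μ κ z) : z.1 = meanFieldDensity d β a (μ - a * z.2) := by
  have hle := (reducedEnergy_add_le hd hβ ha h.mem.1).trans
    (h.le (meanFieldDensity d β a (μ - a * z.2), z.2)
      ⟨meanFieldDensity_nonneg hd hβ ha _, h.mem.2⟩)
  rw [rateEnergy_meanFieldDensity hd hβ ha, add_le_iff_nonpos_right] at hle
  have hsq : (z.1 - meanFieldDensity d β a (μ - a * z.2)) ^ 2 ≤ 0 :=
    nonpos_of_mul_nonpos_right hle (half_pos ha)
  exact sub_eq_zero.mp (pow_eq_zero_iff two_ne_zero |>.mp (hsq.antisymm (sq_nonneg _)))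

lemma isGroundState_of_reducedEnergy_le (hd : 1 ≤ d) (hβ : 0 < β) (ha : 0 < a) {y : ℝ} (hy : 0 ≤ y)
    (hκ : y = 0 ∨ κ ≤ ENNReal.ofReal y)
    (h : ∀ y', 0 ≤ y' → (y' = 0 ∨ κ ≤ ENNReal.ofReal y') →
      reducedEnergy d β a b μ y ≤ reducedEnergy d β a b μ y') :
    IsGroundState d β a b μ κ (meanFieldDensity d β a (μ - a * y), y) := by
  refine ⟨⟨meanFieldDensity_nonneg hd hβ ha _, hy, hκ⟩, fun w hw => ?_⟩
  rw [rateEnergy_meanFieldDensity hd hβ ha]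
  exact (h w.2 hw.2.1 hw.2.2).trans (reducedEnergy_le hd hβ ha hw.1)

lemma exists_add_le_reducedEnergy (hd : 1 ≤ d) (hβ : 0 < β) (hb : 0 < b) (hba : b < a) (μ : ℝ) :
    ∃ e : ℝ, ∀ y, 0 ≤ y → e + y ≤ reducedEnergy d β a b μ y := by
  refine ⟨-idealPressure d β 0 - 1 - (μ + 1) ^ 2 / (2 * (a - b)), fun y hy => ?_⟩
  have hx := meanFieldDensity_nonneg (d := d) hd hβ (hb.trans hba) (μ - a * y)
  have := linear_le_rateEnergy (d := d) (μ := μ) hβ hb.le hba 1 hx hy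
  rw [rateEnergy_meanFieldDensity hd hβ (hb.trans hba)] at this
  linarith

lemma exists_isGroundState (hd : 1 ≤ d) (hβ : 0 < β) (hb : 0 < b) (hba : b < a) (μ : ℝ)
    (κ : ℝ≥0∞) : ∃ z, IsGroundState d β a b μ κ z := by
  have ha := hb.trans hba
  obtain ⟨e, he⟩ := exists_add_le_reducedEnergy (d := d) hd hβ hb hba μ
  set R := max 0 (reducedEnergy d β a b μ 0 - e)
  have hclosed : IsClosed {y : ℝ | y = 0 ∨ κ ≤ ENNReal.ofReal y} :=
    (isClosed_eq continuous_id continuous_const).union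
      (isClosed_le continuous_const ENNReal.continuous_ofReal)
  have hzero : (0 : ℝ) ∈ Set.Icc 0 R ∩ {y : ℝ | y = 0 ∨ κ ≤ ENNReal.ofReal y} :=
    ⟨⟨le_rfl, le_max_left _ _⟩, Or.inl rfl⟩
  obtain ⟨y, hy, hmin⟩ := (isCompact_Icc.inter_right hclosed).exists_isMinOn ⟨0, hzero⟩
    (continuous_reducedEnergy (d := d) (b := b) (μ := μ) hd hβ ha).continuousOn
  refine ⟨_, isGroundState_of_reducedEnergy_le hd hβ ha hy.1.1 hy.2 fun y' hy' hκ' => ?_⟩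
  rcases le_or_gt y' R with hyR | hyR
  · exact hmin ⟨⟨hy', hyR⟩, hκ'⟩
  · have hR : reducedEnergy d β a b μ 0 - e ≤ R := le_max_right _ _
    have hmin0 : reducedEnergy d β a b μ y ≤ reducedEnergy d β a b μ 0 := hmin hzero
    linarith [he y' hy']

lemma slope_pos_of_slope_eq_zero (hd : 1 ≤ d) (hβ : 0 < β) (ha : 0 < a) (hb : 0 < b)
    {x y w : ℝ} (hy : y ∈ Set.Ioo x w) (hy0 : 0 < y)
    (hyslope : -effectivePotential d β a (μ - a * y) - b * y = 0)
    (hwslope : -effectivePotential d β a (μ - a * w) - b * w = 0) :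
    0 < -effectivePotential d β a (μ - a * x) - b * x := by
  obtain ⟨p, r, hp, hr, hpr, rfl⟩ : y ∈ openSegment ℝ x w := by
    rwa [openSegment_eq_Ioo (hy.1.trans hy.2)]
  simp only [smul_eq_mul] at *
  have hshift : μ - a * (p * x + r * w) = p * (μ - a * x) + r * (μ - a * w) := by
    linear_combination (-μ) * hpr
  have hne : μ - a * x ≠ μ - a * w := fun h =>
    (hy.1.trans hy.2).ne (mul_left_cancel₀ ha.ne' (sub_right_injective h))
  have hneg : effectivePotential d β a (μ - a * (p * x + r * w)) < 0 := by
    linarith [mul_pos hb hy0]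
  rw [hshift] at hneg hyslope
  have hconcave := lt_effectivePotential_convexCombo (d := d) hd hβ ha hne hp hr hpr hneg
  refine pos_of_mul_pos_right ?_ hp.le
  linear_combination hconcave - hyslope + r * hwslope

lemma IsGroundState.snd_le_of_pos (hd : 1 ≤ d) (hβ : 0 < β) (hb : 0 < b) (ha : 0 < a)
    {z w : ℝ × ℝ} (hz : IsGroundState d β a b μ κ z) (hw : IsGroundState d β a b μ κ w)
    (hz0 : 0 < z.2) : w.2 ≤ z.2 := by
  by_contra! hzw
  have hcont := continuous_reducedEnergy (d := d) (b := b) (μ := μ) hd hβ ha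
  have hderiv := fun y => hasDerivAt_reducedEnergy (d := d) (b := b) (μ := μ) hd hβ ha y
  obtain ⟨x, hx, hxslope⟩ :=
    exists_hasDerivAt_eq_slope _ _ hz0 hcont.continuousOn fun y _ => hderiv y
  obtain ⟨y, hy, hyslope⟩ :=
    exists_hasDerivAt_eq_slope _ _ hzw hcont.continuousOn fun y _ => hderiv y
  have hx_nonpos : -effectivePotential d β a (μ - a * x) - b * x ≤ 0 := by
    rw [hxslope]
    exact div_nonpos_of_nonpos_of_nonneg
      (sub_nonpos.mpr (hz.reducedEnergy_le hd hβ ha le_rfl (Or.inl rfl))) (sub_pos.mpr hz0).le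
  have heq : reducedEnergy d β a b μ w.2 = reducedEnergy d β a b μ z.2 :=
    le_antisymm (hw.reducedEnergy_le hd hβ ha hz.mem.2.1 hz.mem.2.2)
      (hz.reducedEnergy_le hd hβ ha hw.mem.2.1 hw.mem.2.2)
  rw [heq, sub_self, zero_div] at hyslope
  have hmin : IsLocalMin (reducedEnergy d β a b μ) w.2 := by
    filter_upwards [lt_mem_nhds hzw] with y hy
    exact hw.reducedEnergy_le hd hβ ha (hz0.trans hy).le
      (Or.inr ((hz.mem.2.2.resolve_left hz0.ne').trans (ENNReal.ofReal_le_ofReal hy.le)))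
  exact hx_nonpos.not_gt <| slope_pos_of_slope_eq_zero hd hβ ha hb
    ⟨hx.2.trans hy.1, hy.2⟩ (hz0.trans hy.1) hyslope (hmin.hasDerivAt_eq_zero (hderiv w.2))

lemma IsGroundState.eq_of_pos (hd : 1 ≤ d) (hβ : 0 < β) (hb : 0 < b) (ha : 0 < a)
    {z w : ℝ × ℝ} (hz : IsGroundState d β a b μ κ z) (hw : IsGroundState d β a b μ κ w)
    (hz0 : 0 < z.2) (hw0 : 0 < w.2) : z = w := by
  have hsnd : z.2 = w.2 :=
    le_antisymm (hw.snd_le_of_pos hd hβ hb ha hz hw0) (hz.snd_le_of_pos hd hβ hb ha hw hz0)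
  exact Prod.ext (by rw [hz.fst_eq hd hβ ha, hw.fst_eq hd hβ ha, hsnd]) hsnd

lemma IsGroundState.eq_of_snd_eq_zero (hd : 1 ≤ d) (hβ : 0 < β) (ha : 0 < a)
    {z : ℝ × ℝ} (hz : IsGroundState d β a b μ κ z) (hz0 : z.2 = 0) :
    z = (meanFieldDensity d β a μ, 0) :=
  Prod.ext (by rw [hz.fst_eq hd hβ ha, hz0, mul_zero, sub_zero]) hz0

lemma zero_mem_rateDomain (κ : ℝ≥0∞) : (0 : ℝ × ℝ) ∈ rateDomain κ :=
  ⟨le_rfl, le_rfl, Or.inl rfl⟩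

lemma bddAbove_range_neg_rateEnergy (hβ : 0 < β) (hb : 0 ≤ b) (hba : b < a) :
    BddAbove (Set.range fun z : rateDomain κ => -rateEnergy d β a b μ z) := by
  refine ⟨-(-idealPressure d β 0 - 0 - (μ + 0) ^ 2 / (2 * (a - b))), ?_⟩
  rintro _ ⟨⟨⟨x, y⟩, hx, hy, -⟩, rfl⟩
  have := linear_le_rateEnergy (d := d) (μ := μ) hβ hb hba 0 hx hy
  dsimp only
  linarith

lemma mem_rateZeroes_iff (hβ : 0 < β) (hb : 0 ≤ b) (hba : b < a) {z : ℝ × ℝ} :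
    z ∈ rateZeroes d β a b μ κ ↔ IsGroundState d β a b μ κ z := by
  have hne : Nonempty (rateDomain κ) := ⟨⟨0, zero_mem_rateDomain κ⟩⟩
  have hle : ∀ w : rateDomain κ, -rateEnergy d β a b μ w ≤ pressure d β a b μ κ :=
    le_ciSup (bddAbove_range_neg_rateEnergy hβ hb hba)
  unfold rateZeroes rateFunction
  rw [Set.mem_ofPred_eq]
  split_ifs with hz
  · rw [EReal.coe_eq_zero]
    constructor
    · exact fun hzero => ⟨hz, fun w hw => by linarith [hle ⟨w, hw⟩]⟩
    · intro hground
      have hge : pressure d β a b μ κ ≤ -rateEnergy d β a b μ z :=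
        ciSup_le fun w => neg_le_neg (hground.le w w.2)
      linarith [hle ⟨z, hz⟩]
  · exact ⟨fun htop => absurd htop EReal.top_ne_zero, fun hground => absurd hground.mem hz⟩

end GroundStates

/-! ### The transition potential -/

/-- The pair `(0, μ / (a - b))` belongs to `𝕂(κ)`, and its energy, at most `-μ² / (2(a - b))`, lies
below the bound `-p₀(β,0) - μ²/(2a) - (b/2)(μ/a)²` for the energy of pairs whose second component is
at most `μ/a`. These are explicit parameters at which long cycles form. -/
structure IsCondensing (d : ℕ) (β a b μ : ℝ) (κ : ℝ≥0∞) : Prop where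
  pos : 0 < b
  lt : b < a
  potential_pos : 0 < μ
  ratio_le : κ ≤ ENNReal.ofReal (μ / (a - b))
  large : idealPressure d β 0 < μ ^ 2 * b ^ 2 / (2 * a ^ 2 * (a - b))

section Transition

variable {d : ℕ} {β a b μ μ' : ℝ} {κ : ℝ≥0∞} {z z' : ℝ × ℝ}

lemma rateEnergy_zero_le (hβ : 0 < β) (hab : a - b ≠ 0) :
    rateEnergy d β a b μ (0, μ / (a - b)) ≤ -(μ ^ 2 / (2 * (a - b))) := by
  have heq : rateEnergy d β a b μ (0, μ / (a - b)) =
      freeEnergy d β 0 - μ ^ 2 / (2 * (a - b)) := by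
    simp only [rateEnergy]
    field_simp
    ring
  linarith [freeEnergy_zero_le (d := d) hβ]

lemma IsGroundState.rateEnergy_le (hβ : 0 < β) (h : IsCondensing d β a b μ κ)
    (hz : IsGroundState d β a b μ κ z) :
    rateEnergy d β a b μ z ≤ -(μ ^ 2 / (2 * (a - b))) :=
  have hab := sub_pos.mpr h.lt
  (hz.le (0, μ / (a - b)) ⟨le_rfl, div_nonneg h.potential_pos.le hab.le, Or.inr h.ratio_le⟩).trans
    (rateEnergy_zero_le hβ hab.ne')

lemma sq_div_two_mul_sub_eq (ha : a ≠ 0) (hab : a - b ≠ 0) :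
    μ ^ 2 / (2 * (a - b)) = μ ^ 2 / (2 * a) + b / 2 * (μ / a) ^ 2 +
      μ ^ 2 * b ^ 2 / (2 * a ^ 2 * (a - b)) := by
  field_simp
  ring

lemma IsGroundState.le_snd (hβ : 0 < β) (h : IsCondensing d β a b μ κ)
    (hz : IsGroundState d β a b μ κ z) : μ ≤ a * z.2 := by
  have hb := h.pos
  have ha := hb.trans h.lt
  by_contra! hlt
  have hle := hz.rateEnergy_le hβ h
  have hsq : a / 2 * (z.1 + z.2 - μ / a) ^ 2 =
      a / 2 * (z.1 + z.2) ^ 2 - μ * (z.1 + z.2) + μ ^ 2 / (2 * a) := by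
    field_simp
    ring
  have hsq_nonneg : 0 ≤ a / 2 * (z.1 + z.2 - μ / a) ^ 2 := by positivity
  have hsnd : b / 2 * z.2 ^ 2 ≤ b / 2 * (μ / a) ^ 2 := by
    have hdiv : z.2 ≤ μ / a := by rw [le_div_iff₀ ha]; linarith
    have := hz.mem.2.1
    gcongr
  rw [sq_div_two_mul_sub_eq ha.ne' (sub_pos.mpr h.lt).ne'] at hle
  simp only [rateEnergy] at hle
  linarith [neg_idealPressure_zero_le (d := d) hβ hz.mem.1, h.large]

lemma IsGroundState.snd_pos (hβ : 0 < β) (h : IsCondensing d β a b μ κ)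
    (hz : IsGroundState d β a b μ κ z) : 0 < z.2 :=
  pos_of_mul_pos_right (h.potential_pos.trans_le (hz.le_snd hβ h)) (h.pos.trans h.lt).le

lemma IsGroundState.abs_snd_sub_le (hβ : 0 < β) (h : IsCondensing d β a b μ κ)
    (hz : IsGroundState d β a b μ κ z) :
    |z.2 - μ / (a - b)| ≤ √(2 * idealPressure d β 0 / (a - b)) := by
  have ha := h.pos.trans h.lt
  have hab : 0 < a - b := sub_pos.mpr h.lt
  have hle := hz.rateEnergy_le hβ h
  have hcross : 0 ≤ z.1 * (a * z.2 - μ) :=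
    mul_nonneg hz.mem.1 (sub_nonneg.mpr (hz.le_snd hβ h))
  have hfst : 0 ≤ a / 2 * z.1 ^ 2 := by positivity
  have hsq : (a - b) / 2 * (z.2 - μ / (a - b)) ^ 2 =
      (a - b) / 2 * z.2 ^ 2 - μ * z.2 + μ ^ 2 / (2 * (a - b)) := by
    field_simp
    ring
  simp only [rateEnergy] at hle
  refine Real.abs_le_sqrt ?_
  rw [le_div_iff₀ hab]
  linarith [neg_idealPressure_zero_le (d := d) hβ hz.mem.1]

lemma eventually_isCondensing_atTop (hb : 0 < b) (hba : b < a) (hκ : κ ≠ ⊤) :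
    ∀ᶠ μ : ℝ in atTop, IsCondensing d β a b μ κ := by
  have ha := hb.trans hba
  have hab : 0 < a - b := sub_pos.mpr hba
  have hlarge : Tendsto (fun μ : ℝ => μ ^ 2 * (b ^ 2 / (2 * a ^ 2 * (a - b)))) atTop atTop :=
    (tendsto_pow_atTop two_ne_zero).atTop_mul_const (by positivity)
  filter_upwards [eventually_gt_atTop 0, eventually_ge_atTop (κ.toReal * (a - b)),
    hlarge.eventually_gt_atTop (idealPressure d β 0)] with μ hμ hμκ hμlarge
  refine ⟨hb, hba, hμ, ?_, by rwa [mul_div_assoc]⟩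
  rw [← ENNReal.ofReal_toReal hκ]
  exact ENNReal.ofReal_le_ofReal ((le_div_iff₀ hab).mpr hμκ)

lemma reducedEnergy_lt_of_effectivePotential_eq_zero (hd : 1 ≤ d) (hβ : 0 < β) (hb : 0 < b)
    (ha : 0 < a) {y : ℝ} (hy : 0 < y) (h : effectivePotential d β a (μ - a * y) = 0) :
    reducedEnergy d β a b μ y < reducedEnergy d β a b μ 0 := by
  have hzero : effectivePotential d β a μ = 0 := by
    refine le_antisymm (effectivePotential_nonpos hd hβ ha _) ?_
    rw [← h]
    exact effectivePotential_mono hd hβ ha (sub_le_self _ (by positivity))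
  have heq : reducedEnergy d β a b μ 0 - reducedEnergy d β a b μ y = b / 2 * y ^ 2 := by
    unfold reducedEnergy meanFieldPressure
    rw [mul_zero, sub_zero, h, hzero]
    field_simp
    ring
  exact sub_pos.mp (heq ▸ by positivity)

lemma hasDerivAt_reducedEnergy_zero_sub (hd : 1 ≤ d) (hβ : 0 < β) (ha : 0 < a) (y μ : ℝ) :
    HasDerivAt (fun μ => reducedEnergy d β a b μ 0 - reducedEnergy d β a b μ y)
      ((effectivePotential d β a μ - effectivePotential d β a (μ - a * y)) / a) μ := by
  have hshift := (hasDerivAt_meanFieldPressure (d := d) hd hβ ha (μ - a * y)).comp μ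
    ((hasDerivAt_id μ).sub_const (a * y))
  convert! (((hasDerivAt_meanFieldPressure (d := d) hd hβ ha μ).neg.add hshift).add
    ((hasDerivAt_id μ).mul_const y)).sub_const ((a - b) / 2 * y ^ 2) using 1
  · ext μ
    simp [reducedEnergy]
    ring
  · simp only [meanFieldDensity, one_mul]
    field_simp
    ring

lemma monotone_reducedEnergy_zero_sub (hd : 1 ≤ d) (hβ : 0 < β) (ha : 0 < a) {y : ℝ} (hy : 0 ≤ y) :
    Monotone fun μ => reducedEnergy d β a b μ 0 - reducedEnergy d β a b μ y := by
  have hderiv := hasDerivAt_reducedEnergy_zero_sub (d := d) (b := b) hd hβ ha y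
  refine monotone_of_deriv_nonneg (fun μ => (hderiv μ).differentiableAt) fun μ => ?_
  rw [(hderiv μ).deriv]
  exact div_nonneg (sub_nonneg.mpr (effectivePotential_mono hd hβ ha
    (sub_le_self _ (by positivity)))) ha.le

lemma reducedEnergy_zero_lt_of_lt (hd : 1 ≤ d) (hβ : 0 < β) (hb : 0 < b) (ha : 0 < a) {y : ℝ}
    (hμ : μ' < μ) (hy : 0 < y) (h : reducedEnergy d β a b μ 0 ≤ reducedEnergy d β a b μ y) :
    reducedEnergy d β a b μ' 0 < reducedEnergy d β a b μ' y := by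
  have hderiv := hasDerivAt_reducedEnergy_zero_sub (d := d) (b := b) hd hβ ha y
  obtain ⟨τ, hτ, hslope⟩ := exists_hasDerivAt_eq_slope _ _ hμ
    (fun τ _ => (hderiv τ).continuousAt.continuousWithinAt) fun τ _ => hderiv τ
  have hneg : effectivePotential d β a (τ - a * y) < 0 := by
    refine (effectivePotential_nonpos hd hβ ha _).lt_of_ne fun hzero => ?_
    have hlt := reducedEnergy_lt_of_effectivePotential_eq_zero hd hβ hb ha hy hzero
    have hmono := monotone_reducedEnergy_zero_sub (d := d) (b := b) hd hβ ha hy.le hτ.2.le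
    dsimp only at hmono
    linarith
  have hlt := effectivePotential_lt (d := d) hd hβ ha (sub_lt_self τ (mul_pos ha hy)) hneg
  have hpos := div_pos (sub_pos.mpr hlt) ha
  rw [hslope, div_pos_iff_of_pos_right (sub_pos.mpr hμ)] at hpos
  linarith

lemma reducedEnergy_zero_lt_of_nonpos (hd : 1 ≤ d) (hβ : 0 < β) (hb : 0 ≤ b) (hba : b < a)
    (hμ : μ ≤ 0) {y : ℝ} (hy : 0 < y) :
    reducedEnergy d β a b μ 0 < reducedEnergy d β a b μ y := by
  have ha := hb.trans_lt hba
  refine strictMonoOn_of_deriv_pos (convex_Ici (0 : ℝ))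
    (continuous_reducedEnergy hd hβ ha).continuousOn (fun x hx => ?_) Set.self_mem_Ici hy.le hy
  rw [interior_Ici, Set.mem_Ioi] at hx
  rw [(hasDerivAt_reducedEnergy hd hβ ha x).deriv]
  have hdensity := mul_nonneg ha.le (meanFieldDensity_nonneg (d := d) hd hβ ha (μ - a * x))
  rw [mul_meanFieldDensity ha.ne'] at hdensity
  linarith [mul_lt_mul_of_pos_right hba hx]

lemma IsGroundState.snd_eq_zero_of_nonpos (hd : 1 ≤ d) (hβ : 0 < β) (hb : 0 ≤ b) (hba : b < a)
    (hμ : μ ≤ 0) (hz : IsGroundState d β a b μ κ z) : z.2 = 0 := by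
  by_contra hne
  exact (hz.reducedEnergy_le hd hβ (hb.trans_lt hba) le_rfl (Or.inl rfl)).not_gt
    (reducedEnergy_zero_lt_of_nonpos hd hβ hb hba hμ (hz.mem.2.1.lt_of_ne' hne))

lemma IsGroundState.snd_eq_zero_of_lt (hd : 1 ≤ d) (hβ : 0 < β) (hb : 0 < b) (ha : 0 < a)
    (hμ : μ' < μ) (hz : IsGroundState d β a b μ κ z) (hz0 : z.2 = 0)
    (hz' : IsGroundState d β a b μ' κ z') : z'.2 = 0 := by
  by_contra hne
  have hle := hz.reducedEnergy_le hd hβ ha hz'.mem.2.1 hz'.mem.2.2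
  rw [hz0] at hle
  exact (hz'.reducedEnergy_le hd hβ ha le_rfl (Or.inl rfl)).not_gt
    (reducedEnergy_zero_lt_of_lt hd hβ hb ha hμ (hz'.mem.2.1.lt_of_ne' hne) hle)

theorem exists_isTransitionPotential (hd : 1 ≤ d) (hβ : 0 < β) (hb : 0 < b) (hba : b < a)
    (hκ : κ ≠ ⊤) : ∃ ν, IsTransitionPotential d β a b κ ν := by
  have ha := hb.trans hba
  set A : Set ℝ := {μ | ∃ z, IsGroundState d β a b μ κ z ∧ z.2 = 0}
  have hA : A.Nonempty := by
    obtain ⟨z, hz⟩ := exists_isGroundState (d := d) hd hβ hb hba 0 κ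
    exact ⟨0, z, hz, hz.snd_eq_zero_of_nonpos hd hβ hb.le hba le_rfl⟩
  have hA_bdd : BddAbove A := by
    obtain ⟨μ, hμ⟩ := (eventually_isCondensing_atTop (d := d) (β := β) hb hba hκ).exists
    obtain ⟨z, hz⟩ := exists_isGroundState (d := d) hd hβ hb hba μ κ
    refine ⟨μ, fun ν ⟨w, hw, hw0⟩ => le_of_not_gt fun hlt => (hz.snd_pos hβ hμ).ne' ?_⟩
    exact hw.snd_eq_zero_of_lt hd hβ hb ha hlt hw0 hz
  have hzeroes : ∀ μ, (rateZeroes d β a b μ κ).Nonempty := fun μ =>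
    (exists_isGroundState hd hβ hb hba μ κ).imp fun _ => (mem_rateZeroes_iff hβ hb.le hba).mpr
  refine ⟨sSup A, fun μ hμ => ⟨hzeroes μ, fun z hz => ?_⟩, fun μ hμ => ⟨hzeroes μ, fun z hz => ?_⟩⟩
  · obtain ⟨ν, ⟨w, hw, hw0⟩, hlt⟩ := exists_lt_of_lt_csSup hA hμ
    exact hw.snd_eq_zero_of_lt hd hβ hb ha hlt hw0 ((mem_rateZeroes_iff hβ hb.le hba).mp hz)
  · rw [mem_rateZeroes_iff hβ hb.le hba] at hz
    exact hz.mem.2.1.lt_of_ne fun h0 => hμ.not_ge (le_csSup hA_bdd ⟨z, hz, h0.symm⟩)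

end Transition

/-! ### Saturation of the short cycles -/

/-- The cycle lengths `1, …, K`. -/
def cyclesUpTo (K : ℕ) : Finset ℕ+ :=
  Finset.Iio K.succPNat

lemma mem_cyclesUpTo {K : ℕ} {k : ℕ+} : k ∈ cyclesUpTo K ↔ (k : ℕ) ≤ K := by
  rw [cyclesUpTo, Finset.mem_Iio, ← PNat.coe_lt_coe, Nat.succPNat_coe, Nat.lt_succ_iff]

lemma tendsto_cyclesUpTo : Tendsto cyclesUpTo atTop atTop := by
  refine tendsto_atTop_finset_of_monotone (fun K K' h k hk => ?_) fun k => ⟨k, ?_⟩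
  · exact mem_cyclesUpTo.mpr ((mem_cyclesUpTo.mp hk).trans h)
  · exact mem_cyclesUpTo.mpr le_rfl

section Saturation

variable {d : ℕ} {β a b μ : ℝ} {κ : ℝ≥0∞} {z : ℝ × ℝ}

lemma IsGroundState.effectivePotential_neg (hd : 1 ≤ d) (hβ : 0 < β) (hb : 0 < b) (ha : 0 < a)
    (hz : IsGroundState d β a b μ κ z) (hz0 : 0 < z.2) :
    effectivePotential d β a (μ - a * z.2) < 0 := by
  refine (effectivePotential_nonpos hd hβ ha _).lt_of_ne fun hzero => ?_
  have hderiv := hasDerivAt_reducedEnergy (d := d) (b := b) (μ := μ) hd hβ ha z.2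
  rw [hzero, neg_zero, zero_sub] at hderiv
  have hslope := ((hasDerivWithinAt_iff_tendsto_slope' (Set.self_notMem_Ioi)).mp
    (hderiv.hasDerivWithinAt (s := Set.Ioi z.2))).eventually_lt_const
    (neg_neg_of_pos (mul_pos hb hz0))
  obtain ⟨y, hy, hlt⟩ := (hslope.and self_mem_nhdsWithin).exists
  rw [slope_def_field, div_lt_iff₀ (sub_pos.mpr hlt), zero_mul, sub_neg] at hy
  exact hy.not_ge (hz.reducedEnergy_le hd hβ ha (hz0.trans hlt).le
    (Or.inr ((hz.mem.2.2.resolve_left hz0.ne').trans (ENNReal.ofReal_le_ofReal hlt.le))))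

lemma IsGroundState.sub_mul_add_eq (hd : 1 ≤ d) (hβ : 0 < β) (ha : 0 < a)
    (hz : IsGroundState d β a b μ κ z) :
    μ - a * (z.1 + z.2) = effectivePotential d β a (μ - a * z.2) := by
  rw [hz.fst_eq hd hβ ha, mul_add, mul_meanFieldDensity ha.ne']
  ring

lemma IsGroundState.hasSum_of_pos (hd : 1 ≤ d) (hβ : 0 < β) (hb : 0 < b) (ha : 0 < a)
    (hz : IsGroundState d β a b μ κ z) (hz0 : 0 < z.2) :
    HasSum (cycleDensity d β (μ - a * (z.1 + z.2))) z.1 := by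
  rw [hz.sub_mul_add_eq hd hβ ha, hz.fst_eq hd hβ ha]
  exact (isConjugate_effectivePotential hd hβ ha _).hasSum
    (hz.effectivePotential_neg hd hβ hb ha hz0)

lemma hasSum_meanFieldDensity (hd : 1 ≤ d) (hβ : 0 < β) (ha : 0 < a)
    (h : ∀ t < μ, effectivePotential d β a t < 0) :
    HasSum (cycleDensity d β (effectivePotential d β a μ)) (meanFieldDensity d β a μ) := by
  refine hasSum_of_isLUB_of_nonneg _ (fun k => (cycleDensity_pos hβ _ k).le) ⟨?_, fun B hB => ?_⟩
  · rintro _ ⟨F, rfl⟩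
    exact (isConjugate_effectivePotential hd hβ ha μ).sum_le F
  · refine le_of_tendsto ((continuous_meanFieldDensity (d := d) hd hβ ha).tendsto μ |>.mono_left
      (nhdsWithin_le_nhds (s := Set.Iio μ))) ?_
    filter_upwards [self_mem_nhdsWithin] with t ht
    refine le_of_tendsto' ((isConjugate_effectivePotential hd hβ ha t).hasSum (h t ht)) fun F => ?_
    exact (Finset.sum_le_sum fun k _ =>
      cycleDensity_mono hβ k (effectivePotential_mono hd hβ ha (le_of_lt ht))).trans (hB ⟨F, rfl⟩)

lemma IsGroundState.hasSum_of_unrestricted (hd : 1 ≤ d) (hβ : 0 < β) (hb : 0 < b) (ha : 0 < a)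
    (hz : IsGroundState d β a b μ 0 z) :
    HasSum (cycleDensity d β (μ - a * (z.1 + z.2))) z.1 := by
  rcases hz.mem.2.1.eq_or_lt with hz0 | hz0
  · rw [hz.sub_mul_add_eq hd hβ ha, hz.fst_eq hd hβ ha, ← hz0, mul_zero, sub_zero]
    refine hasSum_meanFieldDensity hd hβ ha fun t ht => ?_
    refine (effectivePotential_nonpos hd hβ ha t).lt_of_ne fun hzero => ?_
    obtain ⟨y, hy, rfl⟩ : ∃ y, 0 < y ∧ t = μ - a * y :=
      ⟨(μ - t) / a, div_pos (sub_pos.mpr ht) ha, by field_simp; ring⟩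
    have hle := hz.reducedEnergy_le hd hβ ha hy.le (Or.inr zero_le)
    rw [← hz0] at hle
    exact hle.not_gt (reducedEnergy_lt_of_effectivePotential_eq_zero hd hβ hb ha hy hzero)
  · exact hz.hasSum_of_pos hd hβ hb ha hz0

lemma cycleDensity_zero (d : ℕ) (β : ℝ) (k : ℕ+) :
    cycleDensity d β 0 k =
      1 / (4 * Real.pi * β) ^ ((d : ℝ) / 2) * (1 / (k : ℝ) ^ ((d : ℝ) / 2)) := by
  have hk : (0 : ℝ) < k := Nat.cast_pos.mpr k.pos
  have hpow : (k : ℝ) ^ ((d : ℝ) / 2) ≠ 0 := (Real.rpow_pos_of_pos hk _).ne'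
  unfold cycleDensity cycleWeight
  rw [Real.rpow_add hk, Real.rpow_one]
  simp only [mul_zero, zero_mul, Real.exp_zero, mul_one]
  field_simp

lemma summable_cycleDensity_zero_iff (hβ : 0 < β) :
    Summable (cycleDensity d β 0) ↔ 3 ≤ d := by
  have hC : 1 / (4 * Real.pi * β) ^ ((d : ℝ) / 2) ≠ 0 := by positivity
  rw [summable_congr (cycleDensity_zero d β), summable_mul_left_iff hC,
    summable_pnat_iff_summable_nat (f := fun k : ℕ => 1 / (k : ℝ) ^ ((d : ℝ) / 2)),
    Real.summable_one_div_nat_rpow, one_lt_div two_pos, Nat.ofNat_lt_cast, Nat.succ_le_iff]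

lemma tsum_cycleDensity_zero (d : ℕ) (β : ℝ) : ∑' k, cycleDensity d β 0 k =
    1 / (4 * Real.pi * β) ^ ((d : ℝ) / 2) * ∑' k : ℕ+, 1 / (k : ℝ) ^ ((d : ℝ) / 2) := by
  rw [← tsum_mul_left]
  exact tsum_congr (cycleDensity_zero d β)

lemma meanFieldExcess_of_le (h : 3 ≤ d → μ / a ≤ ∑' k, cycleDensity d β 0 k) :
    meanFieldExcess d β a μ = 0 := by
  unfold meanFieldExcess criticalDensity
  split_ifs with hd
  · rw [← tsum_cycleDensity_zero, ← EReal.coe_sub,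
      max_eq_right (EReal.coe_nonpos.mpr (sub_nonpos.mpr (h hd))), EReal.toReal_zero]
  · simp

lemma meanFieldExcess_of_ge (hd : 3 ≤ d) (h : ∑' k, cycleDensity d β 0 k ≤ μ / a) :
    meanFieldExcess d β a μ = μ / a - ∑' k, cycleDensity d β 0 k := by
  unfold meanFieldExcess criticalDensity
  rw [if_pos hd, ← tsum_cycleDensity_zero, ← EReal.coe_sub,
    max_eq_left (EReal.coe_nonneg.mpr (sub_nonneg.mpr h)), EReal.toReal_coe]

lemma tendsto_meanFieldExcess (hd : 1 ≤ d) (hβ : 0 < β) (ha : 0 < a) (μ : ℝ) :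
    Tendsto (fun K => meanFieldDensity d β a μ -
      ∑ k ∈ cyclesUpTo K, cycleDensity d β (effectivePotential d β a μ) k) atTop
      (𝓝 (meanFieldExcess d β a μ)) := by
  have hconj := isConjugate_effectivePotential (d := d) hd hβ ha μ
  rcases hconj.nonpos.lt_or_eq with hs | hs
  · have hsum := hconj.hasSum hs
    have hexcess : meanFieldExcess d β a μ = 0 := by
      refine meanFieldExcess_of_le fun h3 => ?_
      have hzero : Summable (cycleDensity d β 0) := (summable_cycleDensity_zero_iff hβ).mpr h3
      calc μ / a ≤ meanFieldDensity d β a μ := div_le_div_of_nonneg_right (by linarith) ha.le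
        _ = ∑' k, cycleDensity d β (effectivePotential d β a μ) k := hsum.tsum_eq.symm
        _ ≤ _ := hsum.summable.tsum_le_tsum (fun k => cycleDensity_mono hβ k hs.le) hzero
    rw [hexcess, ← sub_self (meanFieldDensity d β a μ)]
    exact tendsto_const_nhds.sub (hsum.comp tendsto_cyclesUpTo)
  · have hdensity : meanFieldDensity d β a μ = μ / a := by rw [meanFieldDensity, hs, sub_zero]
    have hle := hconj.sum_le
    rw [hs, hdensity] at *
    have hsum : Summable (cycleDensity d β 0) :=
      summable_of_sum_le (fun k => (cycleDensity_pos hβ 0 k).le) hle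
    rw [meanFieldExcess_of_ge ((summable_cycleDensity_zero_iff hβ).mp hsum)
      (hsum.tsum_le_of_sum_le hle)]
    exact tendsto_const_nhds.sub (hsum.hasSum.comp tendsto_cyclesUpTo)

end Saturation

namespace ThermoSeq

variable {d : ℕ} {κ : ℝ≥0∞} (S : ThermoSeq d κ)

lemma volume_eq (n : ℕ) :
    volume (Set.Icc (fun i => -(S.side n i) / 2) (fun i => S.side n i / 2)) =
      ENNReal.ofReal (S.vol n) := by
  rw [vol, ENNReal.ofReal_toReal]
  rw [Real.volume_Icc_pi]
  exact ENNReal.prod_ne_top fun i _ => ENNReal.ofReal_ne_top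

lemma vol_pos (n : ℕ) : 0 < S.vol n := by
  rw [vol, Real.volume_Icc_pi, ENNReal.toReal_prod]
  refine Finset.prod_pos fun i _ => ?_
  rw [← sub_div, sub_neg_eq_add, ENNReal.toReal_ofReal (by linarith [S.side_pos n i])]
  linarith [S.side_pos n i]

lemma tendsto_vol : Tendsto S.vol atTop atTop :=
  S.tendsto_volume

lemma tendsto_ofReal_ratio :
    Tendsto (fun n => ENNReal.ofReal (S.cutoff n / S.vol n)) atTop (𝓝 κ) := by
  refine S.tendsto_ratio.congr fun n => ?_
  rw [S.volume_eq, ENNReal.ofReal_div_of_pos (S.vol_pos n), ENNReal.ofReal_natCast]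

lemma tendsto_toReal_ratio (hκ : κ ≠ ⊤) :
    Tendsto (fun n => (S.cutoff n / S.vol n : ℝ)) atTop (𝓝 κ.toReal) := by
  refine ((ENNReal.tendsto_toReal hκ).comp S.tendsto_ofReal_ratio).congr fun n => ?_
  exact ENNReal.toReal_ofReal (div_nonneg (Nat.cast_nonneg _) (S.vol_pos n).le)

end ThermoSeq

/-! ### Lower bounds for the partition function -/

section LowerBound

variable {d : ℕ} {β a b μ V : ℝ}

lemma summable_gibbsWeight_mul (hd : 1 ≤ d) (hβ : 0 < β) (hV : 0 < V) (hb : 0 ≤ b) (hba : b < a)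
    (μ : ℝ) (m : ℕ) :
    Summable fun n => gibbsWeight d β a b μ V m n * (1 + totalDensity V n) := by
  refine summable_of_sum_le (fun n => mul_nonneg (gibbsWeight_pos hβ hV m n).le
    (add_nonneg zero_le_one (totalDensity_nonneg hV n)))
    (fun T => sum_gibbsWeight_mul_le (m := m)
      (e := -idealPressure d β 0 - 1 - (μ + 1) ^ 2 / (2 * (a - b))) hd hβ hV hb one_pos
      fun n _ => ?_)
  rw [totalDensity_eq_add V m]
  have hpair := densityPair_nonneg hV m n
  exact linear_le_rateEnergy hβ hb hba 1 hpair.1 hpair.2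

lemma summable_gibbsWeight (hd : 1 ≤ d) (hβ : 0 < β) (hV : 0 < V) (hb : 0 ≤ b) (hba : b < a)
    (μ : ℝ) (m : ℕ) : Summable (gibbsWeight d β a b μ V m) :=
  (summable_gibbsWeight_mul hd hβ hV hb hba μ m).of_nonneg_of_le
    (fun n => (gibbsWeight_pos hβ hV m n).le)
    fun n => le_mul_of_one_le_right (gibbsWeight_pos hβ hV m n).le
      (le_add_of_nonneg_right (totalDensity_nonneg hV n))

lemma gibbsWeight_le_partitionFunction (hd : 1 ≤ d) (hβ : 0 < β) (hV : 0 < V) (hb : 0 ≤ b)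
    (hba : b < a) (m : ℕ) (n : Counts) :
    gibbsWeight d β a b μ V m n ≤ partitionFunction d β a b μ V m :=
  (summable_gibbsWeight hd hβ hV hb hba μ m).le_tsum n fun n' _ => (gibbsWeight_pos hβ hV m n').le

lemma partitionFunction_pos (hd : 1 ≤ d) (hβ : 0 < β) (hV : 0 < V) (hb : 0 ≤ b) (hba : b < a)
    (μ : ℝ) (m : ℕ) : 0 < partitionFunction d β a b μ V m :=
  (gibbsWeight_pos hβ hV m 0).trans_le (gibbsWeight_le_partitionFunction hd hβ hV hb hba m 0)

lemma log_factorial_le {n : ℕ} (hn : n ≠ 0) :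
    Real.log n.factorial ≤ n * Real.log n - n + (Real.log n + 1) := by
  obtain ⟨j, rfl⟩ := Nat.exists_eq_succ_of_ne_zero hn
  have hanti : Real.log (Stirling.stirlingSeq j.succ) ≤ Real.log (Stirling.stirlingSeq 1) :=
    Stirling.log_stirlingSeq'_antitone (Nat.zero_le j)
  have hj : (0 : ℝ) < j.succ := by positivity
  have hlog : 0 ≤ Real.log j.succ := Real.log_natCast_nonneg _
  rw [Stirling.log_stirlingSeq_formula, Stirling.stirlingSeq_one,
    Real.log_div (Real.exp_pos _).ne' (by positivity), Real.log_exp, Real.log_sqrt (by norm_num),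
    Real.log_mul (by norm_num) hj.ne', Real.log_div hj.ne' (Real.exp_pos _).ne',
    Real.log_exp] at hanti
  linarith

lemma le_log_pow_div_factorial {x : ℝ} (hx : x ≠ 0) {n : ℕ} (hn : n ≠ 0) :
    n * Real.log (x / n) + n - (Real.log n + 1) ≤ Real.log (x ^ n / n.factorial) := by
  rw [Real.log_div hx (by exact_mod_cast hn), Real.log_div (pow_ne_zero _ hx)
    (by exact_mod_cast n.factorial_ne_zero), Real.log_pow]
  linarith [log_factorial_le hn]

lemma eventually_exp_le_pow_div_factorial {q c ε : ℝ} (hq : 0 < q) (hc : 0 < c) (hε : 0 < ε) :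
    ∀ᶠ V : ℝ in atTop, Real.exp (V * (c * Real.log (q / c) + c - ε)) ≤
      (V * q) ^ ⌊c * V⌋₊ / (⌊c * V⌋₊.factorial : ℝ) := by
  have hratio : Tendsto (fun V : ℝ => (⌊c * V⌋₊ : ℝ) / V) atTop (𝓝 c) :=
    tendsto_nat_floor_mul_div_atTop hc.le
  have hfloor : Tendsto (fun V : ℝ => ⌊c * V⌋₊) atTop atTop :=
    tendsto_nat_floor_atTop.comp (tendsto_id.const_mul_atTop hc)
  have hlog : Tendsto (fun V : ℝ => Real.log ⌊c * V⌋₊ / ⌊c * V⌋₊) atTop (𝓝 0) :=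
    Real.isLittleO_log_id_atTop.tendsto_div_nhds_zero.comp
      (tendsto_natCast_atTop_atTop.comp hfloor)
  have hlim : Tendsto (fun V : ℝ => (⌊c * V⌋₊ : ℝ) / V * Real.log (q / ((⌊c * V⌋₊ : ℝ) / V)) +
      (⌊c * V⌋₊ : ℝ) / V - (Real.log ⌊c * V⌋₊ / ⌊c * V⌋₊ * ((⌊c * V⌋₊ : ℝ) / V) + V⁻¹)) atTop
      (𝓝 (c * Real.log (q / c) + c - (0 * c + 0))) :=
    ((hratio.mul ((tendsto_const_nhds.div hratio hc.ne').log (div_pos hq hc).ne')).add hratio).sub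
      ((hlog.mul hratio).add tendsto_inv_atTop_zero)
  filter_upwards [hlim.eventually_const_lt
    (show c * Real.log (q / c) + c - ε < c * Real.log (q / c) + c - (0 * c + 0) by linarith),
    eventually_gt_atTop 0, hfloor.eventually_ne_atTop 0] with V hV hV0 hn
  generalize ⌊c * V⌋₊ = n at hV hn ⊢
  have hn0 : (n : ℝ) ≠ 0 := Nat.cast_ne_zero.mpr hn
  rw [← Real.le_log_iff_exp_le (by positivity)]
  refine (mul_le_mul_of_nonneg_left hV.le hV0.le).trans (le_trans (le_of_eq ?_)
    (le_log_pow_div_factorial (mul_pos hV0 hq).ne' hn))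
  rw [show q / ((n : ℝ) / V) = V * q / n by field_simp]
  field_simp

/-- The weight of a cycle length decays only polynomially, so that a single cycle of macroscopic
length costs nothing on the exponential scale. -/
lemma eventually_exp_le_cycleWeight (hβ : 0 < β) {ι : Type*} {F : Filter ι} {V : ι → ℝ}
    (hV : Tendsto V F atTop) {k : ι → ℕ+} {C : ℝ} (hk : ∀ᶠ i in F, (k i : ℝ) ≤ C * V i)
    {ε : ℝ} (hε : 0 < ε) :
    ∀ᶠ i in F, Real.exp (-(V i * ε)) ≤ V i * cycleWeight d β (k i) := by
  set p : ℝ := 1 + (d : ℝ) / 2 with hp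
  set c : ℝ := (4 * Real.pi * β) ^ ((d : ℝ) / 2) with hc
  have hexp := (tendsto_exp_mul_div_rpow_atTop p ε hε).comp hV
  filter_upwards [hexp.eventually_ge_atTop (c * (max C 0) ^ p), hk, hV.eventually_ge_atTop 1]
    with i hi hki hVi
  have hV0 : 0 < V i := zero_lt_one.trans_le hVi
  have hk0 : (0 : ℝ) < k i := by exact_mod_cast (k i).pos
  rw [Function.comp_apply, le_div_iff₀ (Real.rpow_pos_of_pos hV0 _), mul_assoc,
    ← Real.mul_rpow (le_max_right _ _) hV0.le] at hi
  have hpow : c * (k i : ℝ) ^ p ≤ Real.exp (ε * V i) := by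
    refine le_trans ?_ hi
    gcongr
    exact hki.trans (by gcongr; exact le_max_left _ _)
  rw [cycleWeight, Real.exp_neg, mul_comm (V i) ε, ← hp, ← hc, mul_one_div, inv_eq_one_div]
  exact div_le_div₀ hV0.le hVi (by positivity) hpow

/-- The configuration with `f k` cycles of each length `k ∈ F` and, for `l ∉ F`, one further cycle
of length `l`. These configurations, with `l` of the order of the volume, realise the lower bound
for the partition function. -/
def cycleConfig (F : Finset ℕ+) (f : ℕ+ → ℕ) (l : ℕ+) : Counts :=
  Finsupp.indicator F (fun k _ => f k) + Finsupp.single l 1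

lemma disjoint_support_cycleConfig {F : Finset ℕ+} (f : ℕ+ → ℕ) {l : ℕ+} (hl : l ∉ F) :
    Disjoint (Finsupp.indicator F fun k _ => f k).support (Finsupp.single l 1).support :=
  (Finset.disjoint_singleton_right.mpr hl).mono (Finsupp.support_indicator_subset _ _)
    Finsupp.support_single_subset

lemma cycleConfig_self {F : Finset ℕ+} (f : ℕ+ → ℕ) {l : ℕ+} (hl : l ∉ F) :
    cycleConfig F f l l = 1 := by
  rw [cycleConfig, Finsupp.add_apply, Finsupp.indicator_of_notMem hl, Finsupp.single_eq_same]

lemma totalDensity_cycleConfig {F : Finset ℕ+} (f : ℕ+ → ℕ) {l : ℕ+} (hl : l ∉ F) (V : ℝ) :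
    totalDensity V (cycleConfig F f l) = ∑ k ∈ F, (k : ℝ) * ((f k : ℝ) / V) + (l : ℝ) / V := by
  rw [totalDensity, cycleConfig, Finsupp.sum_add_index_of_disjoint
    (disjoint_support_cycleConfig f hl), Finsupp.sum_indicator_index f (by simp),
    Finsupp.sum_single_index (by simp), Nat.cast_one, mul_one_div]

lemma poissonWeight_cycleConfig (c : ℕ+ → ℝ) {F : Finset ℕ+} (f : ℕ+ → ℕ) {l : ℕ+} (hl : l ∉ F) :
    poissonWeight c (cycleConfig F f l) = (∏ k ∈ F, c k ^ f k / ((f k).factorial : ℝ)) * c l := by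
  rw [poissonWeight, cycleConfig, Finsupp.prod_add_index_of_disjoint
    (disjoint_support_cycleConfig f hl), Finsupp.prod_indicator_index f (by simp),
    Finsupp.prod_single_index (by simp)]
  simp

lemma counterTerm_nonneg (V : ℝ) (m : ℕ) (n : Counts) : 0 ≤ counterTerm V m n :=
  Finset.sum_nonneg fun k _ => by dsimp only; split_ifs <;> positivity

lemma sq_le_counterTerm (V : ℝ) {m : ℕ} (n : Counts) {l : ℕ+} (hm : m ≤ l) :
    ((l : ℝ) * (n l / V)) ^ 2 ≤ counterTerm V m n := by
  by_cases hl : l ∈ n.support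
  · refine le_trans (le_of_eq ?_) (Finset.single_le_sum
      (fun k _ => by dsimp only; split_ifs <;> positivity) hl)
    dsimp only
    rw [if_pos hm, mul_pow]
  · simpa [Finsupp.notMem_support_iff.mp hl] using counterTerm_nonneg V m n

variable {V : ℕ → ℝ}

lemma eventually_exp_le_poissonWeight_cycleConfig (hβ : 0 < β) (hV : Tendsto V atTop atTop)
    {F : Finset ℕ+} {c : ℕ+ → ℝ} (hc : ∀ k, 0 < c k) {l : ℕ → ℕ+} (hl : ∀ i, l i ∉ F) {z : ℝ}
    (hz : Tendsto (fun i => (l i : ℝ) / V i) atTop (𝓝 z)) {δ : ℝ} (hδ : 0 < δ) :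
    ∀ᶠ i in atTop, Real.exp (V i *
        (∑ k ∈ F, (c k * Real.log (cycleWeight d β k / c k) + c k) - δ)) ≤
      poissonWeight (fun k => V i * cycleWeight d β k)
        (cycleConfig F (fun k => ⌊c k * V i⌋₊) (l i)) := by
  set ε : ℝ := δ / (F.card + 1) with hε
  have hε0 : 0 < ε := by positivity
  have hshort : ∀ᶠ i in atTop, ∀ k ∈ F,
      Real.exp (V i * (c k * Real.log (cycleWeight d β k / c k) + c k - ε)) ≤
        (V i * cycleWeight d β k) ^ ⌊c k * V i⌋₊ / (⌊c k * V i⌋₊.factorial : ℝ) :=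
    (Filter.eventually_all_finset F).mpr fun k _ =>
      hV.eventually (eventually_exp_le_pow_div_factorial (cycleWeight_pos hβ k) (hc k) hε0)
  have hlong : ∀ᶠ i in atTop, Real.exp (-(V i * ε)) ≤ V i * cycleWeight d β (l i) := by
    refine eventually_exp_le_cycleWeight hβ hV (C := z + 1) ?_ hε0
    filter_upwards [hz.eventually_le_const (lt_add_one z), hV.eventually_gt_atTop 0] with i hi hVi
    rwa [div_le_iff₀ hVi] at hi
  filter_upwards [hshort, hlong] with i hshort_i hlong_i
  rw [poissonWeight_cycleConfig _ _ (hl i)]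
  refine le_trans (le_of_eq ?_) (mul_le_mul
    (Finset.prod_le_prod (fun k _ => (Real.exp_pos _).le) hshort_i) hlong_i (Real.exp_pos _).le
    (Finset.prod_nonneg fun k hk => (Real.exp_pos _).le.trans (hshort_i k hk)))
  rw [← Real.exp_sum, ← Real.exp_add, ← Finset.mul_sum, Finset.sum_sub_distrib, Finset.sum_const,
    nsmul_eq_mul, ← mul_neg, ← mul_add, sub_add, sub_neg_eq_add, ← add_one_mul, hε,
    mul_div_cancel₀ _ (by positivity)]

lemma tendsto_totalDensity_cycleConfig (hV : Tendsto V atTop atTop) {F : Finset ℕ+} {c : ℕ+ → ℝ}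
    (hc : ∀ k, 0 ≤ c k) {l : ℕ → ℕ+} (hl : ∀ i, l i ∉ F) {z : ℝ}
    (hz : Tendsto (fun i => (l i : ℝ) / V i) atTop (𝓝 z)) :
    Tendsto (fun i => totalDensity (V i) (cycleConfig F (fun k => ⌊c k * V i⌋₊) (l i))) atTop
      (𝓝 (∑ k ∈ F, k * c k + z)) := by
  simp only [fun i => totalDensity_cycleConfig (fun k => ⌊c k * V i⌋₊) (hl i) (V i)]
  exact (tendsto_finsetSum _ fun k _ =>
    ((tendsto_nat_floor_mul_div_atTop (hc k)).comp hV).const_mul _).add hz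

lemma exists_tendsto_le_counterTerm {m : ℕ → ℕ} {n : ℕ → Counts} {l : ℕ → ℕ+} {y z : ℝ}
    (hn : ∀ i, n i (l i) = 1) (hl : Tendsto (fun i => (l i : ℝ) / V i) atTop (𝓝 y))
    (hz : 0 ≤ z) (hzy : z ≤ y) (hcut : z = 0 ∨ ∀ i, m i ≤ l i) :
    ∃ (u : ℕ → ℝ) (r : ℝ), Tendsto u atTop (𝓝 r) ∧
      (∀ i, u i ≤ counterTerm (V i) (m i) (n i)) ∧ z ^ 2 ≤ r := by
  rcases hcut with hz0 | hcut
  · exact ⟨0, 0, tendsto_const_nhds, fun i => counterTerm_nonneg _ _ _, by simp [hz0]⟩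
  · refine ⟨_, _, hl.pow 2, fun i => ?_, pow_le_pow_left₀ hz hzy 2⟩
    refine le_trans (le_of_eq ?_) (sq_le_counterTerm _ _ (hcut i))
    rw [hn, Nat.cast_one, mul_one_div]

lemma eventually_exp_le_partitionFunction (hd : 1 ≤ d) (hβ : 0 < β) (hb : 0 ≤ b) (hba : b < a)
    (μ : ℝ) (hV : Tendsto V atTop atTop) {m : ℕ → ℕ} {n : ℕ → Counts} {p ρ r : ℝ}
    (hp : ∀ᶠ i in atTop, Real.exp (V i * p) ≤
      poissonWeight (fun k => V i * cycleWeight d β k) (n i))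
    (hρ : Tendsto (fun i => totalDensity (V i) (n i)) atTop (𝓝 ρ)) {u : ℕ → ℝ}
    (hu : Tendsto u atTop (𝓝 r)) (hun : ∀ i, u i ≤ counterTerm (V i) (m i) (n i))
    {δ : ℝ} (hδ : 0 < δ) :
    ∀ᶠ i in atTop,
      Real.exp (V i * (p + β * (μ * ρ - a / 2 * ρ ^ 2 + b / 2 * r) - δ)) ≤
        partitionFunction d β a b μ (V i) (m i) := by
  have henergy := (((hρ.const_mul μ).sub ((hρ.pow 2).const_mul (a / 2))).add
    (hu.const_mul (b / 2))).const_mul β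
  filter_upwards [hp, henergy.eventually_const_le (sub_lt_self _ hδ), hV.eventually_gt_atTop 0]
    with i hpi hi hVi
  refine le_trans ?_ (gibbsWeight_le_partitionFunction hd hβ hVi hb hba (m i) (n i))
  refine le_trans ?_ (mul_le_mul_of_nonneg_right hpi (Real.exp_pos _).le)
  have hcounter : b / 2 * u i ≤ b / 2 * counterTerm (V i) (m i) (n i) := by
    gcongr
    exact hun i
  rw [← Real.exp_add, Real.exp_le_exp, mul_comm β (V i), mul_assoc, ← mul_add, add_sub_assoc]
  gcongr
  exact hi.trans (by gcongr)

end LowerBound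

section GroundStateBound

variable {d : ℕ} {β a b μ : ℝ} {κ : ℝ≥0∞}

lemma IsConjugate.hasSum_entropy (hd : 1 ≤ d) (hβ : 0 < β) {s x : ℝ} (h : IsConjugate d β s x) :
    HasSum (fun k => cycleWeight d β k * Real.exp (β * s * k) - β * s * cycleDensity d β s k)
      (-(β * freeEnergy d β x)) := by
  have hweight : HasSum (fun k : ℕ+ => cycleWeight d β k * Real.exp (β * s * k))
      (β * idealPressure d β s) := by
    rw [mul_idealPressure hβ.ne']
    exact (summable_cycleWeight_mul_exp hd hβ h.nonpos).hasSum
  have hdensity : HasSum (fun k => β * s * cycleDensity d β s k) (β * s * x) := by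
    rcases h.nonpos.eq_or_lt with hs | hs
    · simp [hs]
    · exact (h.hasSum hs).mul_left _
  rw [show -(β * freeEnergy d β x) = β * idealPressure d β s - β * s * x by
    rw [h.freeEnergy_eq hd hβ]; ring]
  exact hweight.sub hdensity

lemma tendsto_toPNat_max_ceil_div {V : ℕ → ℝ} (hV : Tendsto V atTop atTop) {u : ℕ → ℕ}
    (hu : ∀ i, 0 < u i) {r z : ℝ} (hur : Tendsto (fun i => (u i : ℝ) / V i) atTop (𝓝 r))
    (hrz : r ≤ z) (hz : 0 ≤ z) :
    Tendsto (fun i => (((max (u i) ⌈z * V i⌉₊).toPNat' : ℕ+) : ℝ) / V i) atTop (𝓝 z) := by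
  have hmax := hur.max ((tendsto_nat_ceil_mul_div_atTop hz).comp hV)
  rw [max_eq_right hrz] at hmax
  refine hmax.congr' ?_
  filter_upwards [hV.eventually_gt_atTop 0] with i hi
  have hpos : 0 < max (u i) ⌈z * V i⌉₊ := lt_max_of_lt_left (hu i)
  rw [Nat.toPNat'_coe, if_pos hpos, Nat.cast_max, Function.comp_apply, max_div_div_right hi.le]

lemma ThermoSeq.exists_cycleLength (S : ThermoSeq d κ) (N : ℕ) {y z : ℝ} (hy : 0 ≤ y)
    (hκ : y = 0 ∨ κ ≤ ENNReal.ofReal y) (hyz : y ≤ z) :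
    ∃ l : ℕ → ℕ+, (∀ i, N < l i) ∧ (y = 0 ∨ ∀ i, S.cutoff i ≤ l i) ∧
      Tendsto (fun i => (l i : ℝ) / S.vol i) atTop (𝓝 z) := by
  have hN : Tendsto (fun i => ((N + 1 : ℕ) : ℝ) / S.vol i) atTop (𝓝 0) :=
    tendsto_const_nhds.div_atTop S.tendsto_vol
  suffices h : ∃ (u : ℕ → ℕ) (r : ℝ), (∀ i, N < u i) ∧ (y = 0 ∨ ∀ i, S.cutoff i ≤ u i) ∧
      Tendsto (fun i => (u i : ℝ) / S.vol i) atTop (𝓝 r) ∧ r ≤ z by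
    obtain ⟨u, r, hNu, hcut, hur, hrz⟩ := h
    have hle : ∀ i, u i ≤ ((max (u i) ⌈z * S.vol i⌉₊).toPNat' : ℕ) := fun i => by
      rw [Nat.toPNat'_coe, if_pos (lt_max_of_lt_left (Nat.zero_lt_of_lt (hNu i)))]
      exact le_max_left _ _
    exact ⟨_, fun i => (hNu i).trans_le (hle i), hcut.imp_right fun h i => (h i).trans (hle i),
      tendsto_toPNat_max_ceil_div S.tendsto_vol (fun i => Nat.zero_lt_of_lt (hNu i)) hur hrz
        (hy.trans hyz)⟩
  rcases hκ with hy0 | hκ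
  · exact ⟨fun _ => N + 1, 0, fun _ => N.lt_succ_self, Or.inl hy0, hN, hy.trans hyz⟩
  · refine ⟨fun i => max (N + 1) (S.cutoff i), max 0 κ.toReal,
      fun i => lt_max_of_lt_left N.lt_succ_self, Or.inr fun i => le_max_right _ _, ?_,
      max_le (hy.trans hyz) ((ENNReal.toReal_le_of_le_ofReal hy hκ).trans hyz)⟩
    refine (hN.max (S.tendsto_toReal_ratio (ne_top_of_le_ne_top ENNReal.ofReal_ne_top hκ))).congr
      fun i => ?_
    rw [Nat.cast_max, max_div_div_right (S.vol_pos i).le]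

/-- Fill the lengths of a finite set at the densities conjugate to `z.1`, and put the remaining
mass `z.1 + z.2 - ∑ ≥ z.2` into one cycle, which lies above the cut-off if `z.2 > 0`. -/
lemma ThermoSeq.eventually_le_partitionFunction (hd : 1 ≤ d) (hβ : 0 < β) (hb : 0 ≤ b)
    (hba : b < a) (μ : ℝ) {z : ℝ × ℝ} (hz : z ∈ rateDomain κ) {s : ℝ}
    (hs : IsConjugate d β s z.1) (S : ThermoSeq d κ) {δ : ℝ} (hδ : 0 < δ) :
    ∀ᶠ i in atTop, Real.exp (-(β * S.vol i * (rateEnergy d β a b μ z + δ))) ≤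
      partitionFunction d β a b μ (S.vol i) (S.cutoff i) := by
  have hε : 0 < β * δ / 3 := by positivity
  obtain ⟨F, hF⟩ := ((hs.hasSum_entropy hd hβ).eventually_const_lt (sub_lt_self _ hε)).exists
  set c : ℕ+ → ℝ := fun k => cycleWeight d β k * Real.exp (β * s * k) with hc
  have hc0 : ∀ k, 0 < c k := fun k => mul_pos (cycleWeight_pos hβ k) (Real.exp_pos _)
  have hkc : ∀ k : ℕ+, (k : ℝ) * c k = cycleDensity d β s k := fun k => (mul_assoc _ _ _).symm
  have hentropy : ∀ k, c k * Real.log (cycleWeight d β k / c k) + c k =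
      c k - β * s * cycleDensity d β s k := fun k => by
    rw [hc, div_mul_cancel_left₀ (cycleWeight_pos hβ k).ne', ← Real.exp_neg, Real.log_exp, ← hkc]
    ring
  set y : ℝ := z.1 + z.2 - ∑ k ∈ F, cycleDensity d β s k with hy
  have hzy : z.2 ≤ y := by linarith [hs.sum_le F]
  obtain ⟨l, hFl, hcut, hl⟩ := S.exists_cycleLength (F.sup fun k => (k : ℕ)) hz.2.1 hz.2.2 hzy
  have hnotMem : ∀ i, l i ∉ F := fun i hi =>
    (hFl i).not_ge (Finset.le_sup (f := fun k : ℕ+ => (k : ℕ)) hi)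
  have hρ := tendsto_totalDensity_cycleConfig S.tendsto_vol (fun k => (hc0 k).le) hnotMem hl
  simp only [hkc, hy, add_sub_cancel] at hρ
  obtain ⟨u, r, hu, hun, hr⟩ := exists_tendsto_le_counterTerm
    (fun i => cycleConfig_self (fun k => ⌊c k * S.vol i⌋₊) (hnotMem i)) hl hz.2.1 hzy hcut
  filter_upwards [eventually_exp_le_partitionFunction hd hβ hb hba μ S.tendsto_vol
    (eventually_exp_le_poissonWeight_cycleConfig hβ S.tendsto_vol hc0 hnotMem hl hε) hρ hu hun hε]
    with i hi
  refine le_trans (Real.exp_le_exp.mpr ?_) hi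
  have hmain : -(β * (rateEnergy d β a b μ z + δ)) ≤
      ∑ k ∈ F, (c k * Real.log (cycleWeight d β k / c k) + c k) - β * δ / 3 +
        β * (μ * (z.1 + z.2) - a / 2 * (z.1 + z.2) ^ 2 + b / 2 * r) - β * δ / 3 := by
    have hcounter : β * (b / 2 * z.2 ^ 2) ≤ β * (b / 2 * r) := by gcongr
    simp only [hentropy, rateEnergy]
    linarith
  calc -(β * S.vol i * (rateEnergy d β a b μ z + δ))
      = S.vol i * -(β * (rateEnergy d β a b μ z + δ)) := by ring
    _ ≤ _ := mul_le_mul_of_nonneg_left hmain (S.vol_pos i).le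

end GroundStateBound

/-! ### Concentration on the ground states -/

section Concentration

variable {d : ℕ} {β a b μ V : ℝ} {κ : ℝ≥0∞}

lemma rateEnergy_le_of_tendsto (hβ : 0 < β) {ι : Type*} {F : Filter ι} [F.NeBot] {u : ι → ℝ × ℝ}
    {z : ℝ × ℝ} (hu : Tendsto u F (𝓝 z)) (hu0 : ∀ i, 0 ≤ (u i).1) {e : ι → ℝ} {E : ℝ}
    (he : Tendsto e F (𝓝 E)) (hle : ∀ i, rateEnergy d β a b μ (u i) ≤ e i) :
    rateEnergy d β a b μ z ≤ E := by
  have hfst : Tendsto (fun i => (u i).1) F (𝓝 z.1) := hu.fst_nhds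
  have hsnd : Tendsto (fun i => (u i).2) F (𝓝 z.2) := hu.snd_nhds
  suffices hf : freeEnergy d β z.1 ≤
      E + μ * (z.1 + z.2) - a / 2 * (z.1 + z.2) ^ 2 + b / 2 * z.2 ^ 2 by
    rw [rateEnergy]
    linarith
  have hright := ((he.add ((hfst.add hsnd).const_mul μ)).sub
    (((hfst.add hsnd).pow 2).const_mul (a / 2))).add ((hsnd.pow 2).const_mul (b / 2))
  refine ciSup_le fun s => le_of_tendsto_of_tendsto
    ((hfst.const_mul (s : ℝ)).sub_const (idealPressure d β s)) hright
    (Eventually.of_forall fun i => ?_)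
  have hdual := le_freeEnergy (d := d) hβ s.2 (hu0 i)
  have hlei := hle i
  rw [rateEnergy] at hlei
  dsimp only
  linarith

lemma mem_rateDomain_of_tendsto {ι : Type*} {F : Filter ι} [F.NeBot] {κ' : ι → ℝ≥0∞}
    (hκ : Tendsto κ' F (𝓝 κ)) {u : ι → ℝ × ℝ} {z : ℝ × ℝ} (hu : Tendsto u F (𝓝 z))
    (hmem : ∀ i, u i ∈ rateDomain (κ' i)) : z ∈ rateDomain κ := by
  refine ⟨ge_of_tendsto' hu.fst_nhds fun i => (hmem i).1,
    ge_of_tendsto' hu.snd_nhds fun i => (hmem i).2.1, ?_⟩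
  by_cases hfreq : ∃ᶠ i in F, (u i).2 = 0
  · exact Or.inl (isClosed_singleton.mem_of_frequently_of_tendsto hfreq hu.snd_nhds)
  · rw [not_frequently] at hfreq
    refine Or.inr (le_of_tendsto_of_tendsto hκ
      ((ENNReal.continuous_ofReal.tendsto _).comp hu.snd_nhds) ?_)
    filter_upwards [hfreq] with i hi
    exact (hmem i).2.2.resolve_left hi

lemma add_le_of_rateEnergy_le (hβ : 0 < β) (hb : 0 ≤ b) (hba : b < a) {z : ℝ × ℝ} (hz : 0 ≤ z)
    {e η : ℝ} (hη : η ≤ 1)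
    (h : rateEnergy d β a b μ z ≤ e + η * (1 + (z.1 + z.2))) :
    1 + (z.1 + z.2) ≤ e - (-idealPressure d β 0 - 2 - (μ + 2) ^ 2 / (2 * (a - b))) := by
  have hlinear := linear_le_rateEnergy (d := d) (μ := μ) hβ hb hba 2 hz.1 hz.2
  have hmass : η * (1 + (z.1 + z.2)) ≤ 1 * (1 + (z.1 + z.2)) :=
    mul_le_mul_of_nonneg_right hη (add_nonneg zero_le_one (add_nonneg hz.1 hz.2))
  linarith

lemma IsGroundState.eventually_energy_gap (hβ : 0 < β) (hb : 0 ≤ b) (hba : b < a) {z₀ : ℝ × ℝ}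
    (hz₀ : IsGroundState d β a b μ κ z₀) {A : Set (ℝ × ℝ)} (hA : IsClosed A)
    (hAκ : ∀ z ∈ A, ¬IsGroundState d β a b μ κ z) :
    ∀ᶠ p in 𝓝[>] (0 : ℝ) ×ˢ 𝓝 κ, ∀ z ∈ rateDomain p.2 ∩ A,
      rateEnergy d β a b μ z₀ + p.1 * (1 + (z.1 + z.2)) ≤ rateEnergy d β a b μ z := by
  have hη : ∀ᶠ p in 𝓝[>] (0 : ℝ) ×ˢ 𝓝 κ, p.1 ∈ Set.Ioc (0 : ℝ) 1 :=
    tendsto_fst.eventually (Ioc_mem_nhdsGT zero_lt_one)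
  by_contra hcon
  obtain ⟨p, hp, hfail⟩ := exists_seq_forall_of_frequently
    ((not_eventually.mp hcon).and_eventually hη)
  choose hex hp0 hp1 using hfail
  push Not at hex
  choose u hu hlt using hex
  set B : ℝ := rateEnergy d β a b μ z₀ -
    (-idealPressure d β 0 - 2 - (μ + 2) ^ 2 / (2 * (a - b)))
  have hbound : ∀ j, 1 + ((u j).1 + (u j).2) ≤ B := fun j =>
    add_le_of_rateEnergy_le hβ hb hba ⟨(hu j).1.1, (hu j).1.2.1⟩ (hp1 j) (hlt j).le
  obtain ⟨z, -, φ, hφ, hlim⟩ := (isCompact_Icc (a := (0 : ℝ × ℝ)) (b := (B, B))).tendsto_subseq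
    fun j => ⟨⟨(hu j).1.1, (hu j).1.2.1⟩,
      ⟨by linarith [hbound j, (hu j).1.2.1], by linarith [hbound j, (hu j).1.1]⟩⟩
  have hpφ := hp.comp hφ.tendsto_atTop
  have hmem : z ∈ rateDomain κ :=
    mem_rateDomain_of_tendsto (tendsto_snd.comp hpφ) hlim fun j => (hu (φ j)).1
  have henergy : rateEnergy d β a b μ z ≤ rateEnergy d β a b μ z₀ := by
    have hzero : Tendsto (fun j => rateEnergy d β a b μ z₀ + (p (φ j)).1 * B) atTop
        (𝓝 (rateEnergy d β a b μ z₀ + 0 * B)) :=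
      (((tendsto_fst.comp hpφ).mono_right nhdsWithin_le_nhds).mul_const B).const_add _
    rw [zero_mul, add_zero] at hzero
    refine rateEnergy_le_of_tendsto hβ hlim (fun j => (hu (φ j)).1.1) hzero fun j =>
      (hlt (φ j)).le.trans ?_
    gcongr
    exacts [(hp0 _).le, hbound _]
  exact hAκ z (hA.mem_of_tendsto hlim (Eventually.of_forall fun j => (hu (φ j)).2))
    ⟨hmem, fun w hw => henergy.trans (hz₀.le w hw)⟩

lemma densityPair_mem_rateDomain (hV : 0 < V) (m : ℕ) (n : Counts) :
    densityPair V m n ∈ rateDomain (ENNReal.ofReal (m / V)) := by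
  refine ⟨(densityPair_nonneg hV m n).1, (densityPair_nonneg hV m n).2,
    (longMass_eq_zero_or_le m n).imp (fun h => by simp [densityPair, h]) fun h => ?_⟩
  exact ENNReal.ofReal_le_ofReal (by simp only [densityPair]; gcongr)

lemma summable_gibbsWeight_mul_abs (hd : 1 ≤ d) (hβ : 0 < β) (hV : 0 < V) (hb : 0 ≤ b)
    (hba : b < a) (μ : ℝ) (m : ℕ) {f : Counts → ℝ} {C : ℝ}
    (hf : ∀ n, |f n| ≤ C * (1 + totalDensity V n)) :
    Summable fun n => gibbsWeight d β a b μ V m n * |f n| :=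
  ((summable_gibbsWeight_mul hd hβ hV hb hba μ m).mul_left C).of_nonneg_of_le
    (fun n => mul_nonneg (gibbsWeight_pos hβ hV m n).le (abs_nonneg _))
    fun n => (mul_le_mul_of_nonneg_left (hf n) (gibbsWeight_pos hβ hV m n).le).trans_eq
      (mul_left_comm _ _ _)

lemma integrable_gibbsMeasure_of_abs_le (hd : 1 ≤ d) (hβ : 0 < β) (hV : 0 < V) (hb : 0 ≤ b)
    (hba : b < a) (α μ : ℝ) (m : ℕ) {f : Counts → ℝ} {C : ℝ}
    (hf : ∀ n, |f n| ≤ C * (1 + totalDensity V n)) :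
    Integrable f (gibbsMeasure d β α a b μ V m) :=
  integrable_gibbsMeasure hβ hV (summable_gibbsWeight hd hβ hV hb hba μ m)
    (summable_gibbsWeight_mul_abs hd hβ hV hb hba μ m hf)

lemma isProbabilityMeasure_gibbsMeasure (hd : 1 ≤ d) (hβ : 0 < β) (hV : 0 < V) (hb : 0 ≤ b)
    (hba : b < a) (α μ : ℝ) (m : ℕ) : IsProbabilityMeasure (gibbsMeasure d β α a b μ V m) := by
  have hmass : ∫ _, (1 : ℝ) ∂(gibbsMeasure d β α a b μ V m) = 1 := by
    rw [integral_gibbsMeasure hβ hV, tsum_mul_right, ← partitionFunction,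
      mul_div_cancel_left₀ _ (partitionFunction_pos hd hβ hV hb hba μ m).ne']
  rw [integral_const, smul_eq_mul, mul_one] at hmass
  exact isProbabilityMeasure_iff_real.mpr hmass

lemma integral_indicator_gibbsMeasure_le (hd : 1 ≤ d) (hβ : 0 < β) (hV : 0 < V) (hb : 0 ≤ b)
    (hba : b < a) (α : ℝ) {m : ℕ} {T : Set Counts} {e η : ℝ} (hη : 0 < η)
    (hT : ∀ n ∈ T, e + η * (1 + totalDensity V n) ≤ rateEnergy d β a b μ (densityPair V m n))
    (htail : tailWeight d β m ≤ β * η / 4)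
    (hZ : Real.exp (-(β * V * (e + η / 4))) ≤ partitionFunction d β a b μ V m) :
    ∫ n, T.indicator (fun n => 1 + totalDensity V n) n ∂(gibbsMeasure d β α a b μ V m) ≤
      (β * V * η / 2)⁻¹ * (1 - Real.exp (-(β * η / 2)))⁻¹ ^ 2 := by
  classical
  have hZ0 := (Real.exp_pos _).trans_le hZ
  rw [integral_gibbsMeasure hβ hV, div_le_iff₀ hZ0]
  simp only [← Set.indicator_mul_right]
  refine (((summable_gibbsWeight_mul hd hβ hV hb hba μ m).indicator T).tsum_le_of_sum_le
    fun F => ?_).trans ?_ (b := (β * V * η / 2)⁻¹ *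
      Real.exp (V * (tailWeight d β m - β * (e + η / 2))) * (1 - Real.exp (-(β * η / 2)))⁻¹ ^ 2)
  · rw [Finset.sum_indicator_eq_sum_filter]
    exact sum_gibbsWeight_mul_le hd hβ hV hb hη fun n hn => hT n (Finset.mem_filter.mp hn).2
  · rw [mul_right_comm]
    gcongr
    refine (Real.exp_le_exp.mpr ?_).trans hZ
    have := mul_le_mul_of_nonneg_left htail hV.le
    linarith

lemma IsGroundState.isConjugate (hd : 1 ≤ d) (hβ : 0 < β) (ha : 0 < a) {z : ℝ × ℝ}
    (hz : IsGroundState d β a b μ κ z) :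
    IsConjugate d β (effectivePotential d β a (μ - a * z.2)) z.1 := by
  rw [hz.fst_eq hd hβ ha]
  exact isConjugate_effectivePotential hd hβ ha _

namespace ThermoSeq

lemma tendsto_integral_indicator_gibbs (hd : 1 ≤ d) (hβ : 0 < β) (hb : 0 < b) (hba : b < a)
    (α : ℝ) (S : ThermoSeq d κ) {A : Set (ℝ × ℝ)} (hA : IsClosed A)
    (hAκ : ∀ z ∈ A, ¬IsGroundState d β a b μ κ z) :
    Tendsto (fun i => ∫ n, (densityPair (S.vol i) (S.cutoff i) ⁻¹' A).indicator
      (fun n => 1 + totalDensity (S.vol i) n) n ∂(S.gibbs β α a b μ i)) atTop (𝓝 0) := by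
  obtain ⟨z₀, hz₀⟩ := exists_isGroundState (d := d) hd hβ hb hba μ κ
  obtain ⟨η, hgap, hη : 0 < η⟩ :=
    ((hz₀.eventually_energy_gap hβ hb.le hba hA hAκ).curry.and self_mem_nhdsWithin).exists
  have htail := ((tendsto_tailWeight (d := d) hd hβ).comp S.tendsto_cutoff).eventually_le_const
    (by positivity : 0 < β * η / 4)
  have hlower := S.eventually_le_partitionFunction hd hβ hb.le hba μ hz₀.mem
    (hz₀.isConjugate hd hβ (hb.trans hba)) (by positivity : 0 < η / 4)
  have hbound : Tendsto (fun i => (β * S.vol i * η / 2)⁻¹ *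
      (1 - Real.exp (-(β * η / 2)))⁻¹ ^ 2) atTop
      (𝓝 (0 * (1 - Real.exp (-(β * η / 2)))⁻¹ ^ 2)) :=
    (((S.tendsto_vol.const_mul_atTop hβ).atTop_mul_const hη).atTop_div_const
      two_pos).inv_tendsto_atTop.mul_const _
  rw [zero_mul] at hbound
  refine squeeze_zero' (Eventually.of_forall fun i => integral_nonneg fun n =>
    Set.indicator_nonneg (fun n _ => add_nonneg zero_le_one
      (totalDensity_nonneg (S.vol_pos i) n)) n) ?_ hbound
  filter_upwards [S.tendsto_ofReal_ratio.eventually hgap, htail, hlower] with i hgapi htaili hloweri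
  refine integral_indicator_gibbsMeasure_le hd hβ (S.vol_pos i) hb.le hba α hη
    (fun n hn => ?_) htaili hloweri
  rw [totalDensity_eq_add (S.vol i) (S.cutoff i)]
  exact hgapi _ ⟨densityPair_mem_rateDomain (S.vol_pos i) _ n, hn⟩

theorem tendsto_integral_gibbs_zero (hd : 1 ≤ d) (hβ : 0 < β) (hb : 0 < b) (hba : b < a) (α : ℝ)
    (S : ThermoSeq d κ) {g : ℝ × ℝ → ℝ} (hg : Continuous g) {C : ℝ}
    (hgC : ∀ x y, 0 ≤ x → 0 ≤ y → |g (x, y)| ≤ C * (1 + (x + y)))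
    (hg0 : ∀ z, IsGroundState d β a b μ κ z → g z = 0) :
    Tendsto (fun i => ∫ n, g (densityPair (S.vol i) (S.cutoff i) n) ∂(S.gibbs β α a b μ i)) atTop
      (𝓝 0) := by
  have hgrowth : ∀ i n, |g (densityPair (S.vol i) (S.cutoff i) n)| ≤
      C * (1 + totalDensity (S.vol i) n) := fun i n => by
    have hpair := densityPair_nonneg (S.vol_pos i) (S.cutoff i) n
    rw [totalDensity_eq_add (S.vol i) (S.cutoff i)]
    exact hgC _ _ hpair.1 hpair.2
  rw [Metric.tendsto_nhds]
  intro ε hε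
  have hfar := (S.tendsto_integral_indicator_gibbs (μ := μ) (A := {z | ε / 2 ≤ |g z|}) hd hβ hb
    hba α (isClosed_le continuous_const hg.abs)
    fun z hz hground => (half_pos hε).not_ge (by simpa [hg0 z hground] using hz)).const_mul C
  rw [mul_zero] at hfar
  filter_upwards [hfar.eventually_lt_const (half_pos hε)] with i hi
  set P := S.gibbs β α a b μ i
  set T := densityPair (S.vol i) (S.cutoff i) ⁻¹' {z | ε / 2 ≤ |g z|}
  have hint : Integrable (T.indicator fun n => 1 + totalDensity (S.vol i) n) P := by
    refine (integrable_gibbsMeasure_of_abs_le hd hβ (S.vol_pos i) hb.le hba α μ _ (C := 1)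
      fun n => ?_).indicator (MeasurableSet.of_discrete)
    rw [one_mul, abs_of_nonneg (add_nonneg zero_le_one (totalDensity_nonneg (S.vol_pos i) n))]
  have : IsProbabilityMeasure P :=
    isProbabilityMeasure_gibbsMeasure hd hβ (S.vol_pos i) hb.le hba α μ _
  rw [Real.dist_eq, sub_zero, ← Real.norm_eq_abs]
  calc ‖∫ n, g (densityPair (S.vol i) (S.cutoff i) n) ∂P‖
      ≤ ∫ n, (ε / 2 + C * T.indicator (fun n => 1 + totalDensity (S.vol i) n) n) ∂P := by
        refine norm_integral_le_of_norm_le ((integrable_const _).add (hint.const_mul C))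
          (Eventually.of_forall fun n => ?_)
        by_cases hn : n ∈ T
        · rw [Set.indicator_of_mem hn]
          exact (hgrowth i n).trans (le_add_of_nonneg_left (half_pos hε).le)
        · rw [Set.indicator_of_notMem hn, mul_zero, add_zero]
          exact (not_le.mp hn).le
    _ = ε / 2 + C * ∫ n, T.indicator (fun n => 1 + totalDensity (S.vol i) n) n ∂P := by
        rw [integral_add (integrable_const _) (hint.const_mul C), integral_const_mul,
          integral_const, probReal_univ, one_smul]
    _ < ε := by linarith

end ThermoSeq

end Concentration

/-! ### Condensate densities -/

lemma exists_iterated_limit_iff {ι ι' : Type*} {l : Filter ι} {l' : Filter ι'} [l.NeBot] [l'.NeBot]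
    {u : ι' → ι → ℝ} {v : ι → ℝ} {A B : ι' → ℝ} (hA : Tendsto A l' (𝓝 0))
    (hB : Tendsto B l' (𝓝 1)) (h : ∀ j, Tendsto (fun i => u j i - (A j + B j * v i)) l (𝓝 0))
    (r : ℝ) :
    (∃ D : ι' → ℝ, (∀ j, Tendsto (u j) l (𝓝 (D j))) ∧ Tendsto D l' (𝓝 r)) ↔
      Tendsto v l (𝓝 r) := by
  constructor
  · rintro ⟨D, hD, hDr⟩
    have hBv (j : ι') : Tendsto (fun i => B j * v i) l (𝓝 (D j - A j)) := by
      have hdiff := ((hD j).sub (h j)).sub_const (A j)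
      rw [sub_zero] at hdiff
      exact hdiff.congr fun i => by ring
    obtain ⟨j₀, hj₀⟩ := (hB.eventually_ne one_ne_zero).exists
    have hv : Tendsto v l (𝓝 ((D j₀ - A j₀) / B j₀)) :=
      ((hBv j₀).div_const (B j₀)).congr fun i => mul_div_cancel_left₀ _ hj₀
    have hDv : Tendsto (fun j => A j + (D j - A j)) l' (𝓝 (0 + 1 * ((D j₀ - A j₀) / B j₀))) :=
      (hA.add (hB.mul_const _)).congr fun j => by
        rw [tendsto_nhds_unique (hBv j) (hv.const_mul (B j))]
    simp only [add_sub_cancel, zero_add, one_mul] at hDv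
    rwa [tendsto_nhds_unique hDr hDv]
  · intro hr
    refine ⟨fun j => A j + B j * r, fun j => ?_, ?_⟩
    · have hsum := (h j).add ((hr.const_mul (B j)).const_add (A j))
      rw [zero_add] at hsum
      exact hsum.congr fun i => sub_add_cancel _ _
    · simpa using hA.add (hB.mul_const r)

section Observables

variable {d : ℕ} {β a b μ V : ℝ} {κ : ℝ≥0∞}

lemma densityAbove_nonneg (hV : 0 < V) (K : ℕ) (n : Counts) : 0 ≤ densityAbove V K n :=
  Finset.sum_nonneg fun k _ => by dsimp only; split_ifs <;> positivity

lemma densityAbove_add_sum (V : ℝ) (K : ℕ) (n : Counts) :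
    densityAbove V K n + ∑ k ∈ cyclesUpTo K, (k : ℝ) * (n k / V) = totalDensity V n := by
  have hfilter : (n.support ∪ cyclesUpTo K).filter (fun k : ℕ+ => K < (k : ℕ)) =
      (n.support ∪ cyclesUpTo K) \ cyclesUpTo K := by
    ext k
    simp only [Finset.mem_filter, Finset.mem_sdiff, mem_cyclesUpTo, not_le]
  rw [densityAbove, totalDensity,
    Finsupp.sum_of_support_subset n Finset.subset_union_left _ (by simp),
    Finsupp.sum_of_support_subset n (s := n.support ∪ cyclesUpTo K) Finset.subset_union_left _
      (by simp), ← Finset.sum_filter, hfilter, Finset.sum_sdiff Finset.subset_union_right]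

lemma densityAbove_le (hV : 0 < V) (K : ℕ) (n : Counts) :
    densityAbove V K n ≤ totalDensity V n := by
  rw [← densityAbove_add_sum V K]
  exact le_add_of_nonneg_right (Finset.sum_nonneg fun k _ => by positivity)

lemma mul_count_div_le (hV : 0 < V) (n : Counts) (k : ℕ+) :
    (k : ℝ) * (n k / V) ≤ totalDensity V n := by
  rw [← densityAbove_add_sum V k]
  exact (Finset.single_le_sum (f := fun k : ℕ+ => (k : ℝ) * (n k / V)) (fun _ _ => by positivity)
    (mem_cyclesUpTo.mpr le_rfl)).trans (le_add_of_nonneg_left (densityAbove_nonneg hV _ n))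

lemma integrable_gibbsMeasure_of_nonneg_of_le (hd : 1 ≤ d) (hβ : 0 < β) (hV : 0 < V) (hb : 0 ≤ b)
    (hba : b < a) (α μ : ℝ) (m : ℕ) {f : Counts → ℝ} (hf0 : ∀ n, 0 ≤ f n)
    (hf : ∀ n, f n ≤ totalDensity V n) : Integrable f (gibbsMeasure d β α a b μ V m) :=
  integrable_gibbsMeasure_of_abs_le (C := 1) hd hβ hV hb hba α μ m fun n => by
    rw [abs_of_nonneg (hf0 n), one_mul]
    exact (hf n).trans (le_add_of_nonneg_left zero_le_one)

lemma cycleDensity_sub_mul_le (hβ : 0 < β) (ha : 0 ≤ a) (μ : ℝ) (k : ℕ+) {ρ : ℝ} (hρ : 0 ≤ ρ) :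
    cycleDensity d β (μ - a * ρ) k ≤ cycleDensity d β μ k :=
  cycleDensity_mono hβ k (sub_le_self μ (mul_nonneg ha hρ))

lemma norm_cycleDensity_totalDensity_le (hβ : 0 < β) (ha : 0 ≤ a) (hV : 0 < V) (μ : ℝ) (k : ℕ+)
    (n : Counts) : ‖cycleDensity d β (μ - a * totalDensity V n) k‖ ≤ cycleDensity d β μ k := by
  rw [Real.norm_of_nonneg (cycleDensity_pos hβ _ k).le]
  exact cycleDensity_sub_mul_le hβ ha μ k (totalDensity_nonneg hV n)

lemma integrable_cycleDensity_totalDensity (hd : 1 ≤ d) (hβ : 0 < β) (hV : 0 < V) (hb : 0 ≤ b)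
    (hba : b < a) (α μ : ℝ) (m : ℕ) (k : ℕ+) :
    Integrable (fun n => cycleDensity d β (μ - a * totalDensity V n) k)
      (gibbsMeasure d β α a b μ V m) :=
  have := isProbabilityMeasure_gibbsMeasure hd hβ hV hb hba α μ m
  .of_bound .of_discrete _ (Eventually.of_forall
    (norm_cycleDensity_totalDensity_le hβ (hb.trans hba.le) hV μ k))

lemma integral_mul_count_div (hβ : 0 < β) (hV : 0 < V) (α μ : ℝ) {m : ℕ} {k : ℕ+}
    (hk : (k : ℕ) < m) :
    ∫ n, (k : ℝ) * (n k / V) ∂(gibbsMeasure d β α a b μ V m) =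
      Real.exp (-(β * a * k ^ 2 / (2 * V))) *
        ∫ n, cycleDensity d β (μ - a * totalDensity V n) k ∂(gibbsMeasure d β α a b μ V m) := by
  have hexp (n : Counts) : gibbsWeight d β a b μ V m n * Real.exp
      (β * k * (μ - a * totalDensity V n) - β * a * k ^ 2 / (2 * V)) =
      gibbsWeight d β a b μ V m n * Real.exp (β * (μ - a * totalDensity V n) * k) *
        Real.exp (-(β * a * k ^ 2 / (2 * V))) := by
    rw [mul_assoc _ (Real.exp _), ← Real.exp_add]
    ring_nf
  rw [integral_const_mul, integral_div]
  simp only [cycleDensity, integral_const_mul]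
  rw [integral_gibbsMeasure hβ hV, integral_gibbsMeasure hβ hV,
    tsum_gibbsWeight_mul_count hV.ne' hk, tsum_congr hexp, tsum_mul_right]
  field_simp

/-- The density in cycles longer than `K` at total density `ρ`, provided that the cycles of length
`k ≤ K` have the densities of the ideal gas at the effective chemical potential `μ - aρ`. -/
def excessDensity (d : ℕ) (β a μ : ℝ) (K : ℕ) (ρ : ℝ) : ℝ :=
  ρ - ∑ k ∈ cyclesUpTo K, cycleDensity d β (μ - a * ρ) k

lemma continuous_excessDensity (K : ℕ) : Continuous (excessDensity d β a μ K) := by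
  unfold excessDensity cycleDensity
  fun_prop

lemma abs_excessDensity_le (hβ : 0 < β) (ha : 0 ≤ a) (K : ℕ) {ρ : ℝ} (hρ : 0 ≤ ρ) :
    |excessDensity d β a μ K ρ| ≤ ρ + ∑ k ∈ cyclesUpTo K, cycleDensity d β μ k := by
  refine (abs_sub _ _).trans ?_
  rw [abs_of_nonneg hρ, abs_of_nonneg (Finset.sum_nonneg fun k _ => (cycleDensity_pos hβ _ k).le)]
  gcongr with k
  exact cycleDensity_sub_mul_le hβ ha μ k hρ

lemma abs_excessDensity_sub_affine_le (hβ : 0 < β) (ha : 0 ≤ a) (K : ℕ) (A B : ℝ) {x y : ℝ}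
    (hx : 0 ≤ x) (hy : 0 ≤ y) : |excessDensity d β a μ K (x + y) - (A + B * y)| ≤
      (1 + ∑ k ∈ cyclesUpTo K, cycleDensity d β μ k + |A| + |B|) * (1 + (x + y)) := by
  have hQ : 0 ≤ ∑ k ∈ cyclesUpTo K, cycleDensity d β μ k :=
    Finset.sum_nonneg fun k _ => (cycleDensity_pos hβ _ k).le
  set Q := ∑ k ∈ cyclesUpTo K, cycleDensity d β μ k
  calc |excessDensity d β a μ K (x + y) - (A + B * y)|
      ≤ (x + y + Q) + (|A| + |B| * y) := by
        refine (abs_sub _ _).trans (add_le_add (abs_excessDensity_le hβ ha K (add_nonneg hx hy))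
          ((abs_add_le _ _).trans_eq ?_))
        rw [abs_mul, abs_of_nonneg hy]
    _ ≤ (1 + Q + |A| + |B|) * (1 + (x + y)) := by
        nlinarith [mul_nonneg hQ (add_nonneg hx hy), mul_nonneg (abs_nonneg A)
          (add_nonneg hx hy), mul_nonneg (abs_nonneg B) hx, abs_nonneg B]

lemma tendsto_excessDensity_of_hasSum {x y : ℝ}
    (h : HasSum (cycleDensity d β (μ - a * (x + y))) x) :
    Tendsto (fun K => excessDensity d β a μ K (x + y)) atTop (𝓝 y) := by
  simpa [excessDensity] using (h.comp tendsto_cyclesUpTo).const_sub (x + y)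

lemma integrable_excessDensity (hd : 1 ≤ d) (hβ : 0 < β) (hV : 0 < V) (hb : 0 ≤ b)
    (hba : b < a) (α μ : ℝ) (m K : ℕ) :
    Integrable (fun n => excessDensity d β a μ K (totalDensity V n))
      (gibbsMeasure d β α a b μ V m) :=
  (integrable_gibbsMeasure_of_nonneg_of_le hd hβ hV hb hba α μ m (totalDensity_nonneg hV)
    fun _ => le_rfl).sub (integrable_finsetSum _ fun k _ =>
      integrable_cycleDensity_totalDensity hd hβ hV hb hba α μ m k)

lemma integral_densityAbove_sub (hd : 1 ≤ d) (hβ : 0 < β) (hV : 0 < V) (hb : 0 ≤ b)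
    (hba : b < a) (α μ : ℝ) {m K : ℕ} (hK : K < m) :
    ∫ n, densityAbove V K n ∂(gibbsMeasure d β α a b μ V m) -
        ∫ n, excessDensity d β a μ K (totalDensity V n) ∂(gibbsMeasure d β α a b μ V m) =
      ∑ k ∈ cyclesUpTo K, (1 - Real.exp (-(β * a * k ^ 2 / (2 * V)))) *
        ∫ n, cycleDensity d β (μ - a * totalDensity V n) k ∂(gibbsMeasure d β α a b μ V m) := by
  set P := gibbsMeasure d β α a b μ V m
  have htotal : Integrable (totalDensity V) P :=
    integrable_gibbsMeasure_of_nonneg_of_le hd hβ hV hb hba α μ m (totalDensity_nonneg hV)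
      fun _ => le_rfl
  have hcount (k : ℕ+) : Integrable (fun n => (k : ℝ) * (n k / V)) P :=
    integrable_gibbsMeasure_of_nonneg_of_le hd hβ hV hb hba α μ m (fun n => by positivity)
      fun n => mul_count_div_le hV n k
  have hcycle (k : ℕ+) := integrable_cycleDensity_totalDensity hd hβ hV hb hba α μ m k
  have hsplit (n : Counts) : densityAbove V K n =
      totalDensity V n - ∑ k ∈ cyclesUpTo K, (k : ℝ) * (n k / V) :=
    eq_sub_of_add_eq (densityAbove_add_sum V K n)
  simp only [hsplit, excessDensity]
  rw [integral_sub htotal (integrable_finsetSum _ fun k _ => hcount k),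
    integral_sub htotal (integrable_finsetSum _ fun k _ => hcycle k), sub_sub_sub_cancel_left,
    integral_finsetSum _ fun k _ => hcount k, integral_finsetSum _ fun k _ => hcycle k,
    ← Finset.sum_sub_distrib]
  refine Finset.sum_congr rfl fun k hk => ?_
  rw [integral_mul_count_div hβ hV α μ ((mem_cyclesUpTo.mp hk).trans_lt hK), sub_mul, one_mul]

namespace ThermoSeq

lemma tendsto_integral_densityAbove_sub (hd : 1 ≤ d) (hβ : 0 < β) (hb : 0 ≤ b) (hba : b < a)
    (α μ : ℝ) (S : ThermoSeq d κ) (K : ℕ) :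
    Tendsto (fun i => ∫ n, densityAbove (S.vol i) K n ∂(S.gibbs β α a b μ i) -
      ∫ n, excessDensity d β a μ K (totalDensity (S.vol i) n) ∂(S.gibbs β α a b μ i)) atTop
      (𝓝 0) := by
  have hcorrection (k : ℕ+) : Tendsto (fun i => (1 - Real.exp (-(β * a * k ^ 2 / (2 * S.vol i)))) *
      ∫ n, cycleDensity d β (μ - a * totalDensity (S.vol i) n) k ∂(S.gibbs β α a b μ i)) atTop
      (𝓝 0) := by
    have hexponent : Tendsto (fun i => β * a * (k : ℝ) ^ 2 / (2 * S.vol i)) atTop (𝓝 0) :=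
      tendsto_const_nhds.div_atTop (S.tendsto_vol.const_mul_atTop two_pos)
    have hfactor := ((Real.continuous_exp.tendsto _).comp hexponent.neg).const_sub 1
    rw [neg_zero, Real.exp_zero, sub_self] at hfactor
    refine (bdd_le_mul_tendsto_zero' (cycleDensity d β μ k) (Eventually.of_forall fun i => ?_)
      hfactor).congr fun i => mul_comm _ _
    have : IsProbabilityMeasure (S.gibbs β α a b μ i) :=
      isProbabilityMeasure_gibbsMeasure hd hβ (S.vol_pos i) hb hba α μ _
    simpa using norm_integral_le_of_norm_le_const (μ := S.gibbs β α a b μ i)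
      (Eventually.of_forall
        (norm_cycleDensity_totalDensity_le (d := d) hβ (hb.trans hba.le) (S.vol_pos i) μ k))
  have hsum := tendsto_finsetSum (cyclesUpTo K) fun k _ => hcorrection k
  rw [Finset.sum_const_zero] at hsum
  refine hsum.congr' ?_
  filter_upwards [S.tendsto_cutoff.eventually_gt_atTop K] with i hi
  exact (integral_densityAbove_sub hd hβ (S.vol_pos i) hb hba α μ hi).symm

lemma integrable_densityFrom (hd : 1 ≤ d) (hβ : 0 < β) (hb : 0 ≤ b) (hba : b < a) (α μ : ℝ)
    (S : ThermoSeq d κ) (i : ℕ) :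
    Integrable (densityFrom (S.vol i) (S.cutoff i)) (S.gibbs β α a b μ i) := by
  have hpair := densityPair_nonneg (S.vol_pos i) (S.cutoff i)
  refine integrable_gibbsMeasure_of_nonneg_of_le hd hβ (S.vol_pos i) hb hba α μ _ (fun n => ?_)
    fun n => ?_
  · rw [densityFrom_eq_snd]
    exact (hpair n).2
  · rw [densityFrom_eq_snd, totalDensity_eq_add (S.vol i) (S.cutoff i)]
    exact le_add_of_nonneg_left (hpair n).1

lemma integral_excessDensity_sub_affine (hd : 1 ≤ d) (hβ : 0 < β) (hb : 0 ≤ b) (hba : b < a)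
    (α : ℝ) (S : ThermoSeq d κ) (i K : ℕ) (A B : ℝ) :
    ∫ n, (excessDensity d β a μ K (totalDensity (S.vol i) n) -
      (A + B * densityFrom (S.vol i) (S.cutoff i) n)) ∂(S.gibbs β α a b μ i) =
      ∫ n, excessDensity d β a μ K (totalDensity (S.vol i) n) ∂(S.gibbs β α a b μ i) -
        (A + B * ∫ n, densityFrom (S.vol i) (S.cutoff i) n ∂(S.gibbs β α a b μ i)) := by
  have : IsProbabilityMeasure (S.gibbs β α a b μ i) :=
    isProbabilityMeasure_gibbsMeasure hd hβ (S.vol_pos i) hb hba α μ _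
  have hexcess : Integrable (fun n => excessDensity d β a μ K (totalDensity (S.vol i) n))
      (S.gibbs β α a b μ i) := integrable_excessDensity hd hβ (S.vol_pos i) hb hba α μ _ K
  have hfrom := (S.integrable_densityFrom hd hβ hb hba α μ i).const_mul B
  have haffine : Integrable (fun n => A + B * densityFrom (S.vol i) (S.cutoff i) n)
      (S.gibbs β α a b μ i) := (integrable_const A).add hfrom
  rw [integral_sub hexcess haffine, integral_add (integrable_const A) hfrom, integral_const_mul,
    integral_const, probReal_univ, one_smul]

lemma integrable_densityAbove (hd : 1 ≤ d) (hβ : 0 < β) (hb : 0 ≤ b) (hba : b < a) (α μ : ℝ)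
    (S : ThermoSeq d κ) (i K : ℕ) : Integrable (densityAbove (S.vol i) K) (S.gibbs β α a b μ i) :=
  integrable_gibbsMeasure_of_nonneg_of_le hd hβ (S.vol_pos i) hb hba α μ _
    (densityAbove_nonneg (S.vol_pos i) K) (densityAbove_le (S.vol_pos i) K)

lemma tendsto_integral_densityAbove_sub_affine (hd : 1 ≤ d) (hβ : 0 < β) (hb : 0 < b)
    (hba : b < a) (α : ℝ) (S : ThermoSeq d κ) (K : ℕ) (A B : ℝ)
    (h : ∀ z, IsGroundState d β a b μ κ z → excessDensity d β a μ K (z.1 + z.2) = A + B * z.2) :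
    Tendsto (fun i => ∫ n, densityAbove (S.vol i) K n ∂(S.gibbs β α a b μ i) -
      (A + B * ∫ n, densityFrom (S.vol i) (S.cutoff i) n ∂(S.gibbs β α a b μ i))) atTop (𝓝 0) := by
  have hlimit := (S.tendsto_integral_densityAbove_sub hd hβ hb.le hba α μ K).add
    (S.tendsto_integral_gibbs_zero (μ := μ)
      (g := fun z => excessDensity d β a μ K (z.1 + z.2) - (A + B * z.2)) hd hβ hb hba α
      (((continuous_excessDensity K).comp (by fun_prop)).sub (by fun_prop))
      (fun x y hx hy => abs_excessDensity_sub_affine_le hβ (hb.trans hba).le K A B hx hy)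
      fun z hz => sub_eq_zero.mpr (h z hz))
  rw [add_zero] at hlimit
  refine hlimit.congr fun i => ?_
  have hlinear := S.integral_excessDensity_sub_affine (μ := μ) hd hβ hb.le hba α i K A B
  simp only [totalDensity_eq_add (S.vol i) (S.cutoff i), densityFrom_eq_snd] at hlinear ⊢
  rw [hlinear]
  ring

lemma hasLongCycleDensity_of_forall_eq (hd : 1 ≤ d) (hβ : 0 < β) (hb : 0 < b) (hba : b < a)
    (α : ℝ) {y₀ : ℝ} (h : ∀ z, IsGroundState d β a b μ κ z → z.2 = y₀) (S : ThermoSeq d κ) :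
    HasLongCycleDensity S β α a b μ y₀ := by
  have hgrowth (x y : ℝ) (hx : 0 ≤ x) (hy : 0 ≤ y) : |y - y₀| ≤ (1 + |y₀|) * (1 + (x + y)) := by
    have hbound := abs_sub y y₀
    rw [abs_of_nonneg hy] at hbound
    nlinarith [mul_nonneg (abs_nonneg y₀) (add_nonneg hx hy)]
  refine ⟨S.integrable_densityFrom hd hβ hb.le hba α μ, tendsto_sub_nhds_zero_iff.mp ?_⟩
  refine (S.tendsto_integral_gibbs_zero (g := fun z => z.2 - y₀) hd hβ hb hba α (by fun_prop)
    hgrowth fun z hz => sub_eq_zero.mpr (h z hz)).congr fun i => ?_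
  have : IsProbabilityMeasure (S.gibbs β α a b μ i) :=
    isProbabilityMeasure_gibbsMeasure hd hβ (S.vol_pos i) hb.le hba α μ _
  simp only [← densityFrom_eq_snd]
  rw [integral_sub (S.integrable_densityFrom hd hβ hb.le hba α μ i) (integrable_const _),
    integral_const, probReal_univ, one_smul]

lemma hasCondensateDensity_of_forall_eq (hd : 1 ≤ d) (hβ : 0 < β) (hb : 0 < b) (hba : b < a)
    (α : ℝ) {ρ r : ℝ} (h : ∀ z, IsGroundState d β a b μ κ z → z.1 + z.2 = ρ)
    (hr : Tendsto (fun K => excessDensity d β a μ K ρ) atTop (𝓝 r)) (S : ThermoSeq d κ) :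
    HasCondensateDensity S β α a b μ r := by
  refine ⟨S.integrable_densityAbove hd hβ hb.le hba α μ, _, fun K => ?_, hr⟩
  have hlimit := S.tendsto_integral_densityAbove_sub_affine hd hβ hb hba α K
    (excessDensity d β a μ K ρ) 0 fun z hz => by rw [h z hz, zero_mul, add_zero]
  simpa only [zero_mul, add_zero, tendsto_sub_nhds_zero_iff] using hlimit

end ThermoSeq

lemma IsGroundState.tendsto_excessDensity (hd : 1 ≤ d) (hβ : 0 < β) (hb : 0 < b) (ha : 0 < a)
    {z : ℝ × ℝ} (hz : IsGroundState d β a b μ 0 z) :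
    Tendsto (fun K => excessDensity d β a μ K (z.1 + z.2)) atTop (𝓝 z.2) :=
  tendsto_excessDensity_of_hasSum (hz.hasSum_of_unrestricted hd hβ hb ha)

lemma exists_affine_excessDensity_of_pos {z₀ z₁ : ℝ × ℝ} (hd : 1 ≤ d) (hβ : 0 < β) (hb : 0 < b)
    (ha : 0 < a) (hz₀ : IsGroundState d β a b μ 0 z₀) (hz₁ : IsGroundState d β a b μ 0 z₁)
    (h0 : z₀.2 = 0) (h1 : 0 < z₁.2) :
    ∃ A B : ℕ → ℝ, Tendsto A atTop (𝓝 0) ∧ Tendsto B atTop (𝓝 1) ∧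
      ∀ K z, IsGroundState d β a b μ 0 z →
        excessDensity d β a μ K (z.1 + z.2) = A K + B K * z.2 := by
  have hlim₀ := hz₀.tendsto_excessDensity hd hβ hb ha
  have hslope := ((hz₁.tendsto_excessDensity hd hβ hb ha).sub hlim₀).div_const z₁.2
  rw [h0, sub_zero, div_self h1.ne'] at hslope
  refine ⟨_, _, h0 ▸ hlim₀, hslope, fun K z hz => ?_⟩
  rcases hz.mem.2.1.eq_or_lt with h | h
  · rw [(hz.eq_of_snd_eq_zero hd hβ ha h.symm).trans (hz₀.eq_of_snd_eq_zero hd hβ ha h0).symm, h0]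
    ring
  · rw [hz.eq_of_pos hd hβ hb ha hz₁ h h1]
    field_simp
    ring

lemma exists_affine_excessDensity (hd : 1 ≤ d) (hβ : 0 < β) (hb : 0 < b) (hba : b < a) (μ : ℝ) :
    ∃ A B : ℕ → ℝ, Tendsto A atTop (𝓝 0) ∧ Tendsto B atTop (𝓝 1) ∧
      ∀ K z, IsGroundState d β a b μ 0 z →
        excessDensity d β a μ K (z.1 + z.2) = A K + B K * z.2 := by
  have ha := hb.trans hba
  obtain ⟨z, hz⟩ := exists_isGroundState (d := d) hd hβ hb hba μ 0
  by_cases huniq : ∀ w, IsGroundState d β a b μ 0 w → w = z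
  · refine ⟨fun K => excessDensity d β a μ K (z.1 + z.2) - z.2, fun _ => 1, ?_,
      tendsto_const_nhds, fun K w hw => by rw [huniq w hw]; ring⟩
    simpa using (hz.tendsto_excessDensity hd hβ hb ha).sub_const z.2
  · push Not at huniq
    obtain ⟨w, hw, hne⟩ := huniq
    rcases hz.mem.2.1.eq_or_lt with hz0 | hz0 <;> rcases hw.mem.2.1.eq_or_lt with hw0 | hw0
    · exact absurd ((hw.eq_of_snd_eq_zero hd hβ ha hw0.symm).trans
        (hz.eq_of_snd_eq_zero hd hβ ha hz0.symm).symm) hne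
    · exact exists_affine_excessDensity_of_pos hd hβ hb ha hz hw hz0.symm hw0
    · exact exists_affine_excessDensity_of_pos hd hβ hb ha hw hz hw0.symm hz0
    · exact absurd (hw.eq_of_pos hd hβ hb ha hz hw0 hz0) hne

theorem hasCondensateDensity_iff_hasLongCycleDensity (hd : 1 ≤ d) (hβ : 0 < β) (hb : 0 < b)
    (hba : b < a) (α μ : ℝ) (S : ThermoSeq d 0) (r : ℝ) :
    HasCondensateDensity S β α a b μ r ↔ HasLongCycleDensity S β α a b μ r := by
  obtain ⟨A, B, hA, hB, hAB⟩ := exists_affine_excessDensity (d := d) hd hβ hb hba μ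
  have hlimits := exists_iterated_limit_iff hA hB (fun K =>
    S.tendsto_integral_densityAbove_sub_affine hd hβ hb hba α K (A K) (B K) (hAB K)) r
  exact and_congr (iff_of_true (S.integrable_densityAbove hd hβ hb.le hba α μ)
    (S.integrable_densityFrom hd hβ hb.le hba α μ)) hlimits

end Observables

/-! ### Phases -/

section Phases

variable {d : ℕ} {β a b μ ν : ℝ} {κ : ℝ≥0∞}

lemma hasCondensateDensity_meanFieldExcess (hd : 1 ≤ d) (hβ : 0 < β) (hb : 0 < b) (hba : b < a)
    (α : ℝ) (h : ∀ z, IsGroundState d β a b μ κ z → z.2 = 0) (S : ThermoSeq d κ) :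
    HasCondensateDensity S β α a b μ (meanFieldExcess d β a μ) := by
  have ha := hb.trans hba
  refine S.hasCondensateDensity_of_forall_eq (ρ := meanFieldDensity d β a μ) hd hβ hb hba α
    (fun z hz => by rw [hz.eq_of_snd_eq_zero hd hβ ha (h z hz), add_zero]) ?_
  simpa only [excessDensity, mul_meanFieldDensity ha.ne', sub_sub_cancel] using
    tendsto_meanFieldExcess (d := d) hd hβ ha μ

lemma IsGroundState.hasCondensateDensity_snd {z₀ : ℝ × ℝ} (hd : 1 ≤ d) (hβ : 0 < β) (hb : 0 < b)
    (hba : b < a) (α : ℝ) (h : ∀ z, IsGroundState d β a b μ κ z → 0 < z.2)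
    (hz₀ : IsGroundState d β a b μ κ z₀) (S : ThermoSeq d κ) :
    HasCondensateDensity S β α a b μ z₀.2 ∧ HasLongCycleDensity S β α a b μ z₀.2 := by
  have ha := hb.trans hba
  have huniq (z : ℝ × ℝ) (hz : IsGroundState d β a b μ κ z) : z = z₀ :=
    hz.eq_of_pos hd hβ hb ha hz₀ (h z hz) (h z₀ hz₀)
  exact ⟨S.hasCondensateDensity_of_forall_eq hd hβ hb hba α (fun z hz => by rw [huniq z hz])
      (tendsto_excessDensity_of_hasSum (hz₀.hasSum_of_pos hd hβ hb ha (h z₀ hz₀))),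
    S.hasLongCycleDensity_of_forall_eq hd hβ hb hba α fun z hz => by rw [huniq z hz]⟩

theorem IsTransitionPotential.hasCondensateDensity_of_lt (hd : 1 ≤ d) (hβ : 0 < β) (hb : 0 < b)
    (hba : b < a) (α : ℝ) (h : IsTransitionPotential d β a b κ ν) (hμ : μ < ν)
    (S : ThermoSeq d κ) : HasCondensateDensity S β α a b μ (meanFieldExcess d β a μ) :=
  hasCondensateDensity_meanFieldExcess hd hβ hb hba α
    (fun z hz => (h.1 μ hμ).2 z ((mem_rateZeroes_iff hβ hb.le hba).mpr hz)) S

theorem IsTransitionPotential.exists_densities_of_gt (hd : 1 ≤ d) (hβ : 0 < β) (hb : 0 < b)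
    (hba : b < a) (α : ℝ) (h : IsTransitionPotential d β a b κ ν) (hμ : ν < μ) :
    ∃ r : ℝ, ∀ S : ThermoSeq d κ,
      HasCondensateDensity S β α a b μ r ∧ HasLongCycleDensity S β α a b μ r := by
  obtain ⟨z₀, hz₀⟩ := exists_isGroundState (d := d) hd hβ hb hba μ κ
  exact ⟨z₀.2, hz₀.hasCondensateDensity_snd hd hβ hb hba α
    fun z hz => (h.2 μ hμ).2 z ((mem_rateZeroes_iff hβ hb.le hba).mpr hz)⟩

theorem IsTransitionPotential.exists_densities_of_ne (hd : 1 ≤ d) (hβ : 0 < β) (hb : 0 < b)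
    (hba : b < a) (α : ℝ) (h : IsTransitionPotential d β a b 0 ν) (hμ : μ ≠ ν) :
    ∃ r : ℝ, ∀ S : ThermoSeq d 0,
      HasCondensateDensity S β α a b μ r ∧ HasLongCycleDensity S β α a b μ r := by
  rcases hμ.lt_or_gt with hlt | hgt
  · refine ⟨meanFieldExcess d β a μ, fun S => ?_⟩
    have hcond := h.hasCondensateDensity_of_lt hd hβ hb hba α hlt S
    exact ⟨hcond, (hasCondensateDensity_iff_hasLongCycleDensity hd hβ hb hba α μ S _).mp hcond⟩
  · exact h.exists_densities_of_gt hd hβ hb hba α hgt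

theorem hasCondensateDensity_top (hd : 1 ≤ d) (hβ : 0 < β) (hb : 0 < b) (hba : b < a) (α μ : ℝ)
    (S : ThermoSeq d ⊤) : HasCondensateDensity S β α a b μ (meanFieldExcess d β a μ) :=
  hasCondensateDensity_meanFieldExcess hd hβ hb hba α
    (fun _ hz => hz.mem.2.2.resolve_right fun h => ENNReal.ofReal_ne_top (top_le_iff.mp h)) S

lemma hasCondensateDensity_zero_of_nonpos (hd : 1 ≤ d) (hβ : 0 < β) (hb : 0 < b) (hba : b < a)
    (α : ℝ) (hμ : μ ≤ 0) (S : ThermoSeq d κ) : HasCondensateDensity S β α a b μ 0 := by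
  have hexcess : meanFieldExcess d β a μ = 0 := meanFieldExcess_of_le fun _ =>
    (div_nonpos_of_nonpos_of_nonneg hμ (hb.trans hba).le).trans
      (tsum_nonneg fun k => (cycleDensity_pos hβ 0 k).le)
  rw [← hexcess]
  exact hasCondensateDensity_meanFieldExcess hd hβ hb hba α
    (fun z hz => hz.snd_eq_zero_of_nonpos hd hβ hb.le hba hμ) S

lemma IsGroundState.norm_snd_sub_le {z : ℝ × ℝ} (hβ : 0 < β) (h : IsCondensing d β a b μ κ)
    (hz : IsGroundState d β a b μ κ z) :
    ‖z.2 - μ / (a - b)‖ ≤ √(2 * idealPressure d β 0 * (a - b)) / μ * ‖μ / (a - b)‖ := by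
  have hab : 0 < a - b := sub_pos.mpr h.lt
  have hμ := h.potential_pos
  have hscale : 2 * idealPressure d β 0 * (a - b) =
      2 * idealPressure d β 0 / (a - b) * (a - b) ^ 2 := by field_simp
  refine (hz.abs_snd_sub_le hβ h).trans_eq ?_
  rw [hscale, Real.sqrt_mul' _ (sq_nonneg _), Real.sqrt_sq hab.le,
    Real.norm_of_nonneg (div_pos hμ hab).le]
  field_simp

lemma exists_hasCondensateDensity_isEquivalent {ι : Type*} {l : Filter ι} {B M : ι → ℝ} (hd : 1 ≤ d)
    (hβ : 0 < β) (α : ℝ) (h : ∀ᶠ i in l, IsCondensing d β a (B i) (M i) κ)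
    (hlim : Tendsto (fun i => √(2 * idealPressure d β 0 * (a - B i)) / M i) l (𝓝 0)) :
    ∃ Δ : ι → ℝ,
      (∀ᶠ i in l, ∀ S : ThermoSeq d κ, HasCondensateDensity S β α a (B i) (M i) (Δ i)) ∧
      Δ ~[l] fun i => M i / (a - B i) := by
  have hground (i : ι) : ∃ z, IsCondensing d β a (B i) (M i) κ →
      IsGroundState d β a (B i) (M i) κ z := by
    by_cases hi : IsCondensing d β a (B i) (M i) κ
    · exact (exists_isGroundState hd hβ hi.pos hi.lt _ κ).imp fun _ hz _ => hz
    · exact ⟨0, fun h => absurd h hi⟩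
  choose z hz using hground
  refine ⟨fun i => (z i).2, h.mono fun i hi S => ?_, IsLittleO.of_bound fun c hc => ?_⟩
  · exact ((hz i hi).hasCondensateDensity_snd hd hβ hi.pos hi.lt α
      (fun w hw => hw.snd_pos hβ hi) S).1
  · filter_upwards [h, hlim.eventually_lt_const hc] with i hi hlt
    exact ((hz i hi).norm_snd_sub_le hβ hi).trans
      (mul_le_mul_of_nonneg_right hlt.le (norm_nonneg _))

lemma tendsto_inv_sub_nhdsLT (a : ℝ) : Tendsto (fun b => (a - b)⁻¹) (𝓝[<] a) atTop := by
  refine tendsto_inv_nhdsGT_zero.comp (tendsto_nhdsWithin_iff.mpr ⟨?_, ?_⟩)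
  · have hsub : Tendsto (fun b => a - b) (𝓝 a) (𝓝 (a - a)) := tendsto_const_nhds.sub tendsto_id
    rw [sub_self] at hsub
    exact hsub.mono_left nhdsWithin_le_nhds
  · filter_upwards [self_mem_nhdsWithin] with b hb
    exact sub_pos.mpr (Set.mem_Iio.mp hb)

lemma eventually_isCondensing_nhdsLT (ha : 0 < a) (hμ : 0 < μ) (hκ : κ ≠ ⊤) :
    ∀ᶠ b in 𝓝[<] a, IsCondensing d β a b μ κ := by
  have hratio : Tendsto (fun b => μ * (a - b)⁻¹) (𝓝[<] a) atTop :=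
    (tendsto_inv_sub_nhdsLT a).const_mul_atTop hμ
  have hcoeff : Tendsto (fun b : ℝ => μ ^ 2 * b ^ 2 / (2 * a ^ 2)) (𝓝[<] a)
      (𝓝 (μ ^ 2 * a ^ 2 / (2 * a ^ 2))) :=
    (Continuous.tendsto (by fun_prop) a).mono_left nhdsWithin_le_nhds
  have hlarge := hcoeff.pos_mul_atTop (by positivity) (tendsto_inv_sub_nhdsLT a)
  filter_upwards [hratio.eventually_ge_atTop κ.toReal,
    hlarge.eventually_gt_atTop (idealPressure d β 0), Ioo_mem_nhdsLT ha] with b hκb hpb hb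
  refine ⟨hb.1, hb.2, hμ, ?_, ?_⟩
  · rw [← ENNReal.ofReal_toReal hκ, div_eq_mul_inv]
    exact ENNReal.ofReal_le_ofReal hκb
  · rwa [← div_eq_mul_inv, div_div] at hpb

theorem exists_hasCondensateDensity_isEquivalent_nhdsLT (hd : 1 ≤ d) (hβ : 0 < β) (α : ℝ)
    (ha : 0 < a) (μ : ℝ) (hκ : κ ≠ ⊤) :
    ∃ Δ : ℝ → ℝ,
      (∀ᶠ b in 𝓝[<] a, ∀ S : ThermoSeq d κ, HasCondensateDensity S β α a b μ (Δ b)) ∧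
      Δ ~[𝓝[<] a] fun b => max (μ / (a - b)) 0 := by
  rcases lt_or_ge 0 μ with hμ | hμ
  · have hlim : Tendsto (fun b => √(2 * idealPressure d β 0 * (a - b)) / μ) (𝓝[<] a) (𝓝 0) := by
      have hcont : Continuous fun b => √(2 * idealPressure d β 0 * (a - b)) / μ := by fun_prop
      simpa using (hcont.tendsto a).mono_left (nhdsWithin_le_nhds (s := Set.Iio a))
    obtain ⟨Δ, hΔ, hequiv⟩ := exists_hasCondensateDensity_isEquivalent hd hβ α
      (eventually_isCondensing_nhdsLT (d := d) (β := β) ha hμ hκ) hlim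
    refine ⟨Δ, hΔ, hequiv.congr_right ?_⟩
    filter_upwards [self_mem_nhdsWithin] with b hb
    exact (max_eq_left (div_pos hμ (sub_pos.mpr (Set.mem_Iio.mp hb))).le).symm
  · refine ⟨fun _ => 0, ?_, IsEquivalent.refl.congr_right ?_⟩
    · filter_upwards [Ioo_mem_nhdsLT ha] with b hb
      exact hasCondensateDensity_zero_of_nonpos hd hβ hb.1 hb.2 α hμ
    · filter_upwards [self_mem_nhdsWithin] with b hb
      exact (max_eq_right (div_nonpos_of_nonpos_of_nonneg hμ
        (sub_pos.mpr (Set.mem_Iio.mp hb)).le)).symm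

theorem exists_hasCondensateDensity_isEquivalent_atTop (hd : 1 ≤ d) (hβ : 0 < β) (α : ℝ)
    (hb : 0 < b) (hba : b < a) (hκ : κ ≠ ⊤) :
    ∃ Δ : ℝ → ℝ,
      (∀ᶠ μ in atTop, ∀ S : ThermoSeq d κ, HasCondensateDensity S β α a b μ (Δ μ)) ∧
      Δ ~[atTop] fun μ => μ / (a - b) :=
  exists_hasCondensateDensity_isEquivalent hd hβ α (eventually_isCondensing_atTop hb hba hκ)
    (tendsto_const_nhds.div_atTop tendsto_id)

end Phases

end CycleHYL

end

theorem mainTheorem3 (d : ℕ) (hd : 1 ≤ d) (β α : ℝ) (hβ : 0 < β) (hα : α < 0) :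
    -- (a)
    (∀ a b : ℝ, 0 < b → b < a →
      -- κ = 0
      ((∀ (μ : ℝ) (S : CycleHYL.ThermoSeq d 0) (r : ℝ),
          CycleHYL.HasCondensateDensity S β α a b μ r ↔
            CycleHYL.HasLongCycleDensity S β α a b μ r) ∧
        ∃ ν : ℝ, CycleHYL.IsTransitionPotential d β a b 0 ν ∧
          ∀ μ : ℝ, μ ≠ ν → ∃ r : ℝ, ∀ S : CycleHYL.ThermoSeq d 0,
            CycleHYL.HasCondensateDensity S β α a b μ r ∧
              CycleHYL.HasLongCycleDensity S β α a b μ r) ∧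
      -- κ = ∞
      (∀ (μ : ℝ) (S : CycleHYL.ThermoSeq d ⊤),
        CycleHYL.HasCondensateDensity S β α a b μ (CycleHYL.meanFieldExcess d β a μ)) ∧
      -- κ ∈ (0, ∞)
      (∀ κ : ℝ, 0 < κ →
        ∃ ν : ℝ, CycleHYL.IsTransitionPotential d β a b (ENNReal.ofReal κ) ν ∧
          ∃ νhat ∈ Set.Icc ν (max ν (CycleHYL.muR d β a b κ)),
            (∀ μ < νhat, ∀ S : CycleHYL.ThermoSeq d (ENNReal.ofReal κ),
              CycleHYL.HasCondensateDensity S β α a b μ (CycleHYL.meanFieldExcess d β a μ)) ∧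
            (∀ μ > νhat, ∃ r : ℝ, ∀ S : CycleHYL.ThermoSeq d (ENNReal.ofReal κ),
              CycleHYL.HasCondensateDensity S β α a b μ r ∧
                CycleHYL.HasLongCycleDensity S β α a b μ r))) ∧
    -- (b)
    (∀ a μ κ : ℝ, 0 < a → 0 ≤ κ →
      ∃ Δ : ℝ → ℝ,
        (∀ᶠ b in 𝓝[<] a, ∀ S : CycleHYL.ThermoSeq d (ENNReal.ofReal κ),
          CycleHYL.HasCondensateDensity S β α a b μ (Δ b)) ∧
        Δ ~[𝓝[<] a] fun b => max (μ / (a - b)) 0) ∧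
    -- (c)
    (∀ a b κ : ℝ, 0 < b → b < a → 0 ≤ κ →
      ∃ Δ : ℝ → ℝ,
        (∀ᶠ μ in atTop, ∀ S : CycleHYL.ThermoSeq d (ENNReal.ofReal κ),
          CycleHYL.HasCondensateDensity S β α a b μ (Δ μ)) ∧
        Δ ~[atTop] fun μ => μ / (a - b)) := by
  refine ⟨fun a b hb hba =>
      ⟨⟨CycleHYL.hasCondensateDensity_iff_hasLongCycleDensity hd hβ hb hba α, ?_⟩,
        CycleHYL.hasCondensateDensity_top hd hβ hb hba α, fun κ _ => ?_⟩,
    fun a μ κ ha _ => CycleHYL.exists_hasCondensateDensity_isEquivalent_nhdsLT hd hβ α ha μ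
      ENNReal.ofReal_ne_top,
    fun a b κ hb hba _ => CycleHYL.exists_hasCondensateDensity_isEquivalent_atTop hd hβ α hb hba
      ENNReal.ofReal_ne_top⟩
  · obtain ⟨ν, hν⟩ := CycleHYL.exists_isTransitionPotential (d := d) hd hβ hb hba
      ENNReal.zero_ne_top
    exact ⟨ν, hν, fun μ hμ => hν.exists_densities_of_ne hd hβ hb hba α hμ⟩
  · obtain ⟨ν, hν⟩ := CycleHYL.exists_isTransitionPotential (d := d) hd hβ hb hba
      (ENNReal.ofReal_ne_top (r := κ))
    exact ⟨ν, hν, ν, ⟨le_rfl, le_max_left _ _⟩,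
      fun μ hμ => hν.hasCondensateDensity_of_lt hd hβ hb hba α hμ,
      fun μ hμ => hν.exists_densities_of_gt hd hβ hb hba α hμ⟩
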